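/- **Conventions.** A monoid means a commutative monoid $A$ with an absorbing element $0$; an $A$-set is a pointed set with an action of $A$ such that $1\cdot m=m$, $a(bm)=(ab)m$, $0\cdot m=*$, $a\cdot *=*$. An $\mathcal M_0$-scheme is a topological space with a sheaf of monoids that is covered by open subspaces isomorphic to spectra of monoids (with the Zariski topology on the set of prime ideals). It is *integral* if it is covered by spectra of monoids in which multiplication by each nonzero element is injective. Integral $\mathcal M_0$-schemes are assumed to be connected (in particular nonempty). An $\mathcal O_X$-module is a sheaf of $\mathcal O_X(U)$-sets; it is quasi-coherent (coherent) if on the members of an affine open cover it is the sheaf associated with an $A$-set (with a finitely generated $A$-set), and it is locally projective (a line bundle) if it is quasi-coherent and on the members $U$ of an affine open cover its sections form a projective $\mathcal O_X(U)$-set (a free $\mathcal O_X(U)$-set of rank one). $\operatorname{Pic}X$ is the group of isomorphism classes of line bundles under $\otimes$. A sequence $0\to\mathcal M_1\to\mathcal M_2\to\mathcal M_3\to0$ is admissible if it is exact and its maps are normal, i.e. on stalks all fibres except those over the base point have at most one element. $K_0(X)$ is the Grothendieck group generated by the classes $[\mathcal M]$ of locally projective coherent sheaves with the relations $[\mathcal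 M_2]=[\mathcal M_1]+[\mathcal M_3]$ for all admissible exact sequences; its ring structure is given by $[\mathcal M][\mathcal N]=[\mathcal M\otimes\mathcal N]$. **Theorem.** 1. For every connected integral $\mathcal M_0$-scheme $X$, the tensor product makes $\operatorname{Pic}X$ an abelian group and $K_0(X)$ a commutative ring, and there is a ring isomorphism $$\Theta_X:\ \mathbb Z[\operatorname{Pic}X]\ \longrightarrow\ K_0(X),\qquad [\mathcal L]\longmapsto[\mathcal L].$$ It is natural: for every morphism $\varphi:X\to Y$ of such schemes the inverse image $\varphi^*$ induces a group homomorphism $\operatorname{Pic}Y\to\operatorname{Pic}X$ and a ring homomorphism $K_0(Y)\to K_0(X)$, and $\varphi^*\circ\Theta_Y=\Theta_X\circ\mathbb Z[\varphi^*]$. 2. In particular $K_0(X)$ is, as an abelian group, free on the isomorphism classes of line bundles on $X$. 3. Every locally projective sheaf $\mathcal M$ on $X$ is isomorphic to a wedge $\bigvee_{i\in I}\mathcal L_i$ of line bundles, with $I$ finite if $\mathcal M$ is coherent. The decomposition is unique: if also $\mathcal M\cong\bigvee_{j\in J}\mathcal L'_j$ with line bundles $\mathcal L_j'$, there is a bijection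 $\sigma:I\to J$ with $\mathcal L_i\cong\mathcal L'_{\sigma(i)}$ for all $i$. 4. Let $n\ge1$. Projective space $\mathbb P^n_{\mathbb F_1}$ is a connected integral $\mathcal M_0$-scheme, the twisted sheaves $\mathcal O(k)$, $k\in\mathbb Z$, are line bundles on it with $\mathcal O(k)\otimes\mathcal O(l)\cong\mathcal O(k+l)$, and there is a ring isomorphism $$\mathbb Z[T,T^{-1}]\ \longrightarrow\ K_0(\mathbb P^n_{\mathbb F_1}),\qquad T^k\longmapsto[\mathcal O(k)]\quad(k\in\mathbb Z).$$ -/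

import Mathlib

open TopologicalSpace CategoryTheory

universe u

namespace MonoidGeometry

/-! ### Presheaves and sheaves of sets -/

/-- A presheaf of sets on a topological space. -/
structure SetPresheaf (X : Type u) [TopologicalSpace X] where
  obj : Opens X → Type u
  res : ∀ {U V : Opens X}, V ≤ U → obj U → obj V
  res_id : ∀ {U : Opens X} (h : U ≤ U) (s : obj U), res h s = s
  res_res : ∀ {U V W : Opens X} (h : V ≤ U) (h' : W ≤ V) (s : obj U),
    res h' (res h s) = res (h'.trans h) s

namespace SetPresheaf

variable {X : Type u} [TopologicalSpace X]

/-- The sheaf axiom: compatible families of sections glue uniquely. -/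
def IsSheaf (F : SetPresheaf X) : Prop :=
  ∀ (ι : Type u) (U : ι → Opens X) (s : ∀ i, F.obj (U i)),
    (∀ i j, F.res (inf_le_left : U i ⊓ U j ≤ U i) (s i) = F.res inf_le_right (s j)) →
    ∃! t : F.obj (iSup U), ∀ i, F.res (le_iSup U i) t = s i

/-- Two sections over neighbourhoods of `x` have the same germ at `x` if they agree on a smaller
neighbourhood. -/
def germSetoid (F : SetPresheaf X) (x : X) : Setoid (Σ U : {U : Opens X // x ∈ U}, F.obj U.1) where
  r a b := ∃ (W : Opens X) (_ : x ∈ W) (ha : W ≤ a.1.1) (hb : W ≤ b.1.1),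
    F.res ha a.2 = F.res hb b.2
  iseqv := by
    refine ⟨fun a => ⟨a.1.1, a.1.2, le_rfl, le_rfl, rfl⟩, ?_, ?_⟩
    · rintro a b ⟨W, hx, ha, hb, h⟩
      exact ⟨W, hx, hb, ha, h.symm⟩
    · rintro a b c ⟨W, hx, ha, hb, h⟩ ⟨W', hx', hb', hc, h'⟩
      refine ⟨W ⊓ W', ⟨hx, hx'⟩, inf_le_left.trans ha, inf_le_right.trans hc, ?_⟩
      rw [← F.res_res ha inf_le_left, h, ← F.res_res hc inf_le_right, ← h', F.res_res, F.res_res]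

/-- The stalk of a presheaf at `x`: the colimit of its sections over the neighbourhoods of `x`. -/
def Stalk (F : SetPresheaf X) (x : X) : Type u := Quotient (F.germSetoid x)

/-- The germ at `x` of a section. -/
def germ (F : SetPresheaf X) {U : Opens X} {x : X} (hx : x ∈ U) (s : F.obj U) : F.Stalk x :=
  Quotient.mk (F.germSetoid x) ⟨⟨U, hx⟩, s⟩

theorem germ_res (F : SetPresheaf X) {U V : Opens X} (h : V ≤ U) {x : X} (hx : x ∈ V)
    (s : F.obj U) : F.germ hx (F.res h s) = F.germ (h hx) s :=
  Quotient.sound ⟨V, hx, le_rfl, h, by rw [F.res_id]⟩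

/-- The presheaf of functions `x ↦ s x ∈ F x` that are locally of the form prescribed by `B`. -/
def localSections (F : X → Type u) (B : ∀ V : Opens X, (∀ x : V, F x) → Prop)
    (hB : ∀ (V W : Opens X) (h : W ≤ V) (s : ∀ x : V, F x),
      B V s → B W (fun y => s ⟨y.1, h y.2⟩)) : SetPresheaf X where
  obj U := {s : ∀ x : U, F x // ∀ x : U, ∃ (V : Opens X) (_ : x.1 ∈ V) (hV : V ≤ U),
    B V (fun y => s ⟨y.1, hV y.2⟩)}
  res {U V} h s := ⟨fun y => s.1 ⟨y.1, h y.2⟩, fun y => by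
    obtain ⟨W, hy, hW, hs⟩ := s.2 ⟨y.1, h y.2⟩
    exact ⟨W ⊓ V, ⟨hy, y.2⟩, inf_le_right, hB _ _ (inf_le_left : W ⊓ V ≤ W) _ hs⟩⟩
  res_id _ _ := rfl
  res_res _ _ _ := rfl

theorem localSections_isSheaf (F : X → Type u) (B : ∀ V : Opens X, (∀ x : V, F x) → Prop)
    (hB : ∀ (V W : Opens X) (h : W ≤ V) (s : ∀ x : V, F x),
      B V s → B W (fun y => s ⟨y.1, h y.2⟩)) : (localSections F B hB).IsSheaf := by
  intro ι U s hs
  have key : ∀ (x : X) (i j : ι) (hi : x ∈ U i) (hj : x ∈ U j),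
      (s i).1 ⟨x, hi⟩ = (s j).1 ⟨x, hj⟩ := fun x i j hi hj =>
    congrFun (congrArg Subtype.val (hs i j)) ⟨x, ⟨hi, hj⟩⟩
  have hmem : ∀ x : (iSup U : Opens X), ∃ i, x.1 ∈ U i := fun x => Opens.mem_iSup.1 x.2
  choose k hk using hmem
  refine ⟨⟨fun x => (s (k x)).1 ⟨x.1, hk x⟩, fun x => ?_⟩, fun i => ?_, fun t ht => ?_⟩
  · obtain ⟨V, hx, hV, h⟩ := (s (k x)).2 ⟨x.1, hk x⟩
    refine ⟨V, hx, hV.trans (le_iSup U _), ?_⟩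
    convert h using 2 with y
    exact key _ _ _ _ _
  · exact Subtype.ext (funext fun x => key _ _ _ _ _)
  · refine Subtype.ext (funext fun x => ?_)
    exact congrFun (congrArg Subtype.val (ht (k x))) ⟨x.1, hk x⟩

end SetPresheaf

/-! ### Monoidal spaces, modules over their structure sheaf -/

/-- A monoidal space: a topological space with a sheaf of commutative monoids with zero. -/
structure MonoidalSpace where
  carrier : Type u
  [top : TopologicalSpace carrier]
  sheaf : SetPresheaf carrier
  [monoid : ∀ U, CommMonoidWithZero (sheaf.obj U)]
  res_mul : ∀ {U V : Opens carrier} (h : V ≤ U) (a b : sheaf.obj U),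
    sheaf.res h (a * b) = sheaf.res h a * sheaf.res h b
  res_one : ∀ {U V : Opens carrier} (h : V ≤ U), sheaf.res h 1 = 1
  res_zero : ∀ {U V : Opens carrier} (h : V ≤ U), sheaf.res h 0 = 0
  isSheaf : sheaf.IsSheaf

attribute [instance] MonoidalSpace.top MonoidalSpace.monoid

/-- A presheaf of modules over a monoidal space `X`. For a monoid `A`, an `A`-set (a pointed set
with an action of `A` that respects `0` and `1`) is a `MulActionWithZero A`. -/
structure PreModule (X : MonoidalSpace.{u}) extends SetPresheaf X.carrier where
  [zero : ∀ U, Zero (obj U)]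
  [act : ∀ U, MulActionWithZero (X.sheaf.obj U) (obj U)]
  res_smul : ∀ {U V : Opens X.carrier} (h : V ≤ U) (a : X.sheaf.obj U) (m : obj U),
    res h (a • m) = X.sheaf.res h a • res h m

attribute [instance] PreModule.zero PreModule.act

/-- An `𝒪_X`-module: a presheaf of modules that is a sheaf. -/
structure OModule (X : MonoidalSpace.{u}) extends PreModule X where
  isSheaf : toPreModule.toSetPresheaf.IsSheaf

namespace PreModule

variable {X : MonoidalSpace.{u}}

theorem res_zero (T : PreModule X) {U V : Opens X.carrier} (h : V ≤ U) :
    T.res h (0 : T.obj U) = 0 := by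
  rw [← zero_smul (X.sheaf.obj U) (0 : T.obj U), T.res_smul, X.res_zero, zero_smul]

/-- The base point of the stalk. -/
def stalkZero (T : PreModule X) (x : X.carrier) : T.Stalk x :=
  T.germ (U := ⊤) (Set.mem_univ x) 0

theorem res_smul_res_eq (T : PreModule X) {U V V' W : Opens X.carrier} (h : W ≤ V) (h' : W ≤ V')
    (a : X.sheaf.obj U) (s : T.obj V) (s' : T.obj V') (e : T.res h s = T.res h' s') :
    T.res (inf_le_inf_left U h : U ⊓ W ≤ U ⊓ V)
        (X.sheaf.res (inf_le_left : U ⊓ V ≤ U) a • T.res (inf_le_right : U ⊓ V ≤ V) s) =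
      T.res (inf_le_inf_left U h' : U ⊓ W ≤ U ⊓ V')
        (X.sheaf.res (inf_le_left : U ⊓ V' ≤ U) a • T.res (inf_le_right : U ⊓ V' ≤ V') s') := by
  rw [T.res_smul, T.res_smul, X.sheaf.res_res, X.sheaf.res_res, T.res_res, T.res_res,
    ← T.res_res h (inf_le_right : U ⊓ W ≤ W), e, T.res_res]

/-- The action on the stalk at `x` of a section of the structure sheaf near `x`. -/
def stalkSMul (T : PreModule X) {U : Opens X.carrier} {x : X.carrier} (hx : x ∈ U)
    (a : X.sheaf.obj U) : T.Stalk x → T.Stalk x :=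
  Quotient.lift
    (fun s => T.germ (U := U ⊓ s.1.1) ⟨hx, s.1.2⟩
      (X.sheaf.res (inf_le_left : U ⊓ s.1.1 ≤ U) a • T.res (inf_le_right : U ⊓ s.1.1 ≤ s.1.1) s.2))
    (by
      rintro ⟨⟨V, hV⟩, s⟩ ⟨⟨V', hV'⟩, s'⟩ ⟨W, hW, h, h', e⟩
      exact Quotient.sound ⟨U ⊓ W, ⟨hx, hW⟩, inf_le_inf_left _ h, inf_le_inf_left _ h',
        T.res_smul_res_eq h h' a s s' e⟩)

theorem stalkSMul_germ (T : PreModule X) {U V : Opens X.carrier} {x : X.carrier} (hx : x ∈ U)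
    (hV : V ≤ U) (hx' : x ∈ V) (a : X.sheaf.obj U) (t : T.obj V) :
    T.stalkSMul hx a (T.germ hx' t) = T.germ hx' (X.sheaf.res hV a • t) := by
  refine Quotient.sound ⟨V, hx', le_inf hV le_rfl, le_rfl, ?_⟩
  change T.res _ (X.sheaf.res _ a • T.res _ t) = T.res _ (X.sheaf.res _ a • t)
  rw [T.res_smul, T.res_smul, X.sheaf.res_res, X.sheaf.res_res, T.res_res]

theorem stalkZero_eq (T : PreModule X) {U : Opens X.carrier} {x : X.carrier} (hx : x ∈ U) :
    T.stalkZero x = T.germ hx 0 := by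
  rw [← T.res_zero (le_top : U ≤ ⊤), T.germ_res]; rfl

theorem exists_germ (T : PreModule X) {U : Opens X.carrier} {x : X.carrier} (hx : x ∈ U)
    (s : T.Stalk x) : ∃ (V : Opens X.carrier) (_ : V ≤ U) (hV : x ∈ V) (t : T.obj V),
      T.germ hV t = s := by
  induction s using Quotient.inductionOn with
  | _ s =>
    exact ⟨U ⊓ s.1.1, inf_le_left, ⟨hx, s.1.2⟩, T.res inf_le_right s.2, T.germ_res _ _ _⟩

/-- The sheaf of sets associated with `T`: its sections are the functions into the stalks that are
locally given by germs of sections of `T`. -/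
def sheafifySet (T : PreModule X) : SetPresheaf X.carrier :=
  SetPresheaf.localSections T.Stalk
    (fun V s => ∃ t : T.obj V, ∀ x : V, s x = T.germ x.2 t)
    (by
      rintro V W h s ⟨t, ht⟩
      exact ⟨T.res h t, fun x => by rw [T.germ_res]; exact ht _⟩)

instance (T : PreModule X) (U : Opens X.carrier) : Zero (T.sheafifySet.obj U) :=
  ⟨⟨fun x => T.stalkZero x.1, fun x => ⟨U, x.2, le_rfl, 0, fun y => T.stalkZero_eq y.2⟩⟩⟩

instance (T : PreModule X) (U : Opens X.carrier) :
    MulActionWithZero (X.sheaf.obj U) (T.sheafifySet.obj U) where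
  smul a s := ⟨fun x => T.stalkSMul x.2 a (s.1 x), fun x => by
    obtain ⟨V, hx, hV, t, ht⟩ := s.2 x
    refine ⟨V, hx, hV, X.sheaf.res hV a • t, fun y => ?_⟩
    rw [← T.stalkSMul_germ (hV y.2) hV y.2, ← ht]⟩
  one_smul s := by
    refine Subtype.ext (funext fun x => ?_)
    obtain ⟨V, hV, hx, t, ht⟩ := T.exists_germ x.2 (s.1 x)
    change T.stalkSMul x.2 1 (s.1 x) = s.1 x
    rw [← ht, T.stalkSMul_germ _ hV, X.res_one, one_smul]
  mul_smul a b s := by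
    refine Subtype.ext (funext fun x => ?_)
    obtain ⟨V, hV, hx, t, ht⟩ := T.exists_germ x.2 (s.1 x)
    change T.stalkSMul x.2 (a * b) (s.1 x) = T.stalkSMul x.2 a (T.stalkSMul x.2 b (s.1 x))
    rw [← ht, T.stalkSMul_germ _ hV, T.stalkSMul_germ _ hV, T.stalkSMul_germ _ hV, X.res_mul,
      mul_smul]
  smul_zero a := by
    refine Subtype.ext (funext fun x => ?_)
    change T.stalkSMul x.2 a (T.stalkZero x.1) = T.stalkZero x.1
    rw [T.stalkZero_eq x.2, T.stalkSMul_germ _ le_rfl, smul_zero]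
  zero_smul s := by
    refine Subtype.ext (funext fun x => ?_)
    obtain ⟨V, hV, hx, t, ht⟩ := T.exists_germ x.2 (s.1 x)
    change T.stalkSMul x.2 0 (s.1 x) = T.stalkZero x.1
    rw [← ht, T.stalkSMul_germ _ hV, X.res_zero, zero_smul, T.stalkZero_eq hx]

/-- The sheafification of a presheaf of modules. -/
def sheafify (T : PreModule X) : OModule X where
  toSetPresheaf := T.sheafifySet
  res_smul {U V} h a s := by
    refine Subtype.ext (funext fun x => ?_)
    obtain ⟨W, hW, hx, t, ht⟩ := T.exists_germ x.2 (s.1 ⟨x.1, h x.2⟩)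
    change T.stalkSMul (h x.2) a (s.1 ⟨x.1, h x.2⟩) =
      T.stalkSMul x.2 (X.sheaf.res h a) (s.1 ⟨x.1, h x.2⟩)
    rw [← ht, T.stalkSMul_germ _ (hW.trans h), T.stalkSMul_germ _ hW, X.sheaf.res_res]
  isSheaf := SetPresheaf.localSections_isSheaf _ _ _

end PreModule

namespace OModule

variable {X : MonoidalSpace.{u}}

/-- A morphism of `𝒪_X`-modules: equivariant maps on sections that commute with restrictions. -/
@[ext]
structure Hom (M N : OModule X) where
  app : ∀ U, M.obj U → N.obj U
  map_smul : ∀ U (a : X.sheaf.obj U) (m : M.obj U), app U (a • m) = a • app U m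
  map_res : ∀ {U V : Opens X.carrier} (h : V ≤ U) (m : M.obj U),
    app V (M.res h m) = N.res h (app U m)

instance : Category (OModule X) where
  Hom := Hom
  id M := ⟨fun _ m => m, fun _ _ _ => rfl, fun _ _ => rfl⟩
  comp f g := ⟨fun U m => g.app U (f.app U m),
    fun U a m => by rw [f.map_smul, g.map_smul], fun h m => by rw [f.map_res, g.map_res]⟩

/-- The structure sheaf as a module over itself. -/
def structureModule (X : MonoidalSpace.{u}) : OModule X where
  toSetPresheaf := X.sheaf
  res_smul h a m := X.res_mul h a m
  isSheaf := X.isSheaf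

/-! #### Exact sequences -/

/-- The section `n` lies in the image sheaf of `f`, that is, locally it has a preimage. -/
def Hom.InImage {M N : OModule X} (f : Hom M N) {U : Opens X.carrier} (n : N.obj U) : Prop :=
  ∀ x ∈ U, ∃ (V : Opens X.carrier) (_ : x ∈ V) (hV : V ≤ U) (m : M.obj V), f.app V m = N.res hV n

/-- The map induced on stalks. -/
def Hom.stalkMap {M N : OModule X} (f : Hom M N) (x : X.carrier) : M.Stalk x → N.Stalk x :=
  Quotient.map (fun s => ⟨s.1, f.app s.1.1 s.2⟩) (by
    rintro ⟨⟨V, hV⟩, s⟩ ⟨⟨V', hV'⟩, s'⟩ ⟨W, hW, h, h', e⟩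
    exact ⟨W, hW, h, h', by
      change N.res h (f.app V s) = N.res h' (f.app V' s')
      rw [← f.map_res, ← f.map_res]; exact congrArg (f.app W) e⟩)

/-- A morphism is normal if on each stalk all its fibres except the one over the base point have
at most one element. -/
def Hom.IsNormal {M N : OModule X} (f : Hom M N) : Prop :=
  ∀ (x : X.carrier) (a b : M.Stalk x), f.stalkMap x a = f.stalkMap x b →
    f.stalkMap x a ≠ N.stalkZero x → a = b

/-- `0 ⟶ M₁ ⟶ M₂ ⟶ M₃ ⟶ 0` is an admissible short exact sequence: it is exact (the kernel of each
map is the image sheaf of the preceding one) and its morphisms are normal. -/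
structure IsAdmissibleExact {M₁ M₂ M₃ : OModule X} (f : Hom M₁ M₂) (g : Hom M₂ M₃) : Prop where
  exact_left : ∀ U (m : M₁.obj U), f.app U m = 0 ↔ m = 0
  exact_mid : ∀ U (m : M₂.obj U), g.app U m = 0 ↔ f.InImage m
  exact_right : ∀ U (m : M₃.obj U), g.InImage m
  normal_left : f.IsNormal
  normal_right : g.IsNormal

/-! #### Wedge sums and tensor products -/

/-- The sheaf of sets underlying the wedge sum of a family of `𝒪_X`-modules. The presheaf wedge
`U ↦ ⋁ L i (U)` is the part of `∏ L i (U)` where at most one coordinate is not the base point;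
its sheafification consists of the sections of `∏ L i` that locally have this property. -/
def wedgeSet {ι : Type u} (L : ι → OModule X) : SetPresheaf X.carrier where
  obj U := {m : ∀ i, (L i).obj U // ∀ x ∈ U, ∃ (V : Opens X.carrier) (_ : x ∈ V) (hV : V ≤ U),
    ∀ i j, i ≠ j → (L i).res hV (m i) = 0 ∨ (L j).res hV (m j) = 0}
  res {U V} h m := ⟨fun i => (L i).res h (m.1 i), fun x hx => by
    obtain ⟨W, hxW, hW, H⟩ := m.2 x (h hx)
    refine ⟨W ⊓ V, ⟨hxW, hx⟩, inf_le_right, fun i j hij => ?_⟩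
    refine (H i j hij).imp (fun e => ?_) (fun e => ?_) <;>
    · rw [SetPresheaf.res_res, ← SetPresheaf.res_res _ hW (inf_le_left : W ⊓ V ≤ W), e,
        PreModule.res_zero]⟩
  res_id h m := Subtype.ext (funext fun i => (L i).res_id h _)
  res_res h h' m := Subtype.ext (funext fun i => (L i).res_res h h' _)

instance {ι : Type u} (L : ι → OModule X) (U : Opens X.carrier) : Zero ((wedgeSet L).obj U) :=
  ⟨⟨fun _ => 0, fun x hx => ⟨U, hx, le_rfl, fun i _ _ => Or.inl ((L i).res_zero _)⟩⟩⟩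

instance {ι : Type u} (L : ι → OModule X) (U : Opens X.carrier) :
    MulActionWithZero (X.sheaf.obj U) ((wedgeSet L).obj U) where
  smul a m := ⟨fun i => a • m.1 i, fun x hx => by
    obtain ⟨V, hxV, hV, H⟩ := m.2 x hx
    refine ⟨V, hxV, hV, fun i j hij => (H i j hij).imp (fun e => ?_) (fun e => ?_)⟩ <;>
    · rw [PreModule.res_smul, e, smul_zero]⟩
  one_smul m := Subtype.ext (funext fun i => one_smul _ _)
  mul_smul a b m := Subtype.ext (funext fun i => mul_smul _ _ _)
  smul_zero a := Subtype.ext (funext fun i => smul_zero _)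
  zero_smul m := Subtype.ext (funext fun i => zero_smul _ _)

/-- The wedge sum (coproduct) of a family of `𝒪_X`-modules. -/
def wedge {ι : Type u} (L : ι → OModule X) : OModule X where
  toSetPresheaf := wedgeSet L
  res_smul h a m := Subtype.ext (funext fun i => (L i).res_smul h a _)
  isSheaf := by
    intro κ U s hs
    have hs' : ∀ i k l, (L i).res (inf_le_left : U k ⊓ U l ≤ U k) ((s k).1 i) =
        (L i).res inf_le_right ((s l).1 i) := fun i k l =>
      congrFun (congrArg Subtype.val (hs k l)) i
    choose t ht huniq using fun i => (L i).isSheaf κ U (fun k => (s k).1 i) (hs' i)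
    refine ⟨⟨t, fun x hx => ?_⟩, fun k => Subtype.ext (funext fun i => ht i k), fun t' ht' => ?_⟩
    · obtain ⟨k, hk⟩ := Opens.mem_iSup.1 hx
      obtain ⟨V, hxV, hV, H⟩ := (s k).2 x hk
      refine ⟨V, hxV, hV.trans (le_iSup U k), fun i j hij => ?_⟩
      have e : ∀ i, (L i).res (hV.trans (le_iSup U k)) (t i) = (L i).res hV ((s k).1 i) := by
        intro i
        rw [← ht i k, SetPresheaf.res_res]
      rw [e, e]
      exact H i j hij
    · exact Subtype.ext (funext fun i => huniq i _ fun k =>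
        congrFun (congrArg Subtype.val (ht' k)) i)

/-- The relation on `M × N` generating the tensor product of two `A`-sets. -/
inductive TensorRel (A M N : Type u) [CommMonoidWithZero A] [Zero M] [Zero N]
    [MulActionWithZero A M] [MulActionWithZero A N] : M × N → M × N → Prop
  | intro (a : A) (m : M) (n : N) : TensorRel A M N (a • m, n) (m, a • n)

/-- The tensor product of two `A`-sets: the quotient of `M × N` by the equivalence relation
generated by `(a • m, n) ∼ (m, a • n)`. -/
def TensorSet (A M N : Type u) [CommMonoidWithZero A] [Zero M] [Zero N]
    [MulActionWithZero A M] [MulActionWithZero A N] : Type u := Quot (TensorRel A M N)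

section TensorSet

variable (A M N : Type u) [CommMonoidWithZero A] [Zero M] [Zero N]
  [MulActionWithZero A M] [MulActionWithZero A N]

instance : Zero (TensorSet A M N) := ⟨Quot.mk _ (0, 0)⟩

instance : MulActionWithZero A (TensorSet A M N) where
  smul a := Quot.map (fun p => (a • p.1, p.2)) (by
    rintro _ _ ⟨b, m, n⟩
    change TensorRel A M N (a • b • m, n) (a • m, b • n)
    rw [smul_smul, mul_comm, ← smul_smul]
    exact ⟨b, a • m, n⟩)
  one_smul := by
    rintro ⟨m, n⟩
    exact congrArg (fun m => Quot.mk _ (m, n)) (one_smul A m)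
  mul_smul a b := by
    rintro ⟨m, n⟩
    exact congrArg (fun m => Quot.mk _ (m, n)) (mul_smul a b m)
  smul_zero a := congrArg (fun m : M => Quot.mk _ (m, (0 : N))) (smul_zero a)
  zero_smul := by
    rintro ⟨m, n⟩
    have h := Quot.sound (TensorRel.intro (A := A) 0 (0 : M) n)
    rw [smul_zero, zero_smul] at h
    exact (congrArg (fun m => Quot.mk _ (m, n)) (zero_smul A m)).trans h

end TensorSet

/-- The presheaf `U ↦ M(U) ⊗ N(U)`. -/
def preTensor (M N : OModule X) : PreModule X where
  obj U := TensorSet (X.sheaf.obj U) (M.obj U) (N.obj U)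
  res h := Quot.map (fun p => (M.res h p.1, N.res h p.2)) (by
    rintro _ _ ⟨a, m, n⟩
    change TensorRel _ _ _ (M.res h (a • m), N.res h n) (M.res h m, N.res h (a • n))
    rw [M.res_smul, N.res_smul]
    exact ⟨_, _, _⟩)
  res_id h := by
    rintro ⟨m, n⟩
    exact congrArg₂ (fun m n => Quot.mk _ (m, n)) (M.res_id h m) (N.res_id h n)
  res_res h h' := by
    rintro ⟨m, n⟩
    exact congrArg₂ (fun m n => Quot.mk _ (m, n)) (M.res_res h h' m) (N.res_res h h' n)
  res_smul h a := by
    rintro ⟨m, n⟩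
    exact congrArg (fun m => Quot.mk _ (m, N.res h n)) (M.res_smul h a m)

/-- The tensor product of two `𝒪_X`-modules. -/
def tensor (M N : OModule X) : OModule X := (preTensor M N).sheafify

end OModule

/-! ### Spectra and schemes -/

/-- The prime ideals of a commutative monoid with zero. -/
@[ext]
structure PrimeSpec (A : Type u) [CommMonoidWithZero A] where
  carrier : Set A
  zero_mem : 0 ∈ carrier
  mul_mem : ∀ (a : A) {b : A}, b ∈ carrier → a * b ∈ carrier
  one_notMem : 1 ∉ carrier
  mem_or_mem : ∀ {a b : A}, a * b ∈ carrier → a ∈ carrier ∨ b ∈ carrier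

section Spec

variable (A : Type u) [CommMonoidWithZero A]

variable {A} in
/-- The complement of a prime ideal. -/
def PrimeSpec.compl (p : PrimeSpec A) : Submonoid A where
  carrier := {a | a ∉ p.carrier}
  one_mem' := p.one_notMem
  mul_mem' ha hb h := (p.mem_or_mem h).elim ha hb

/-- The topology generated by the sets `D_f` of all prime ideals not containing `f`. -/
instance : TopologicalSpace (PrimeSpec A) :=
  .generateFrom (Set.range fun f : A => {p : PrimeSpec A | f ∉ p.carrier})

/-- The localization `S⁻¹M` of an `A`-set is an `S⁻¹A`-set. -/
instance localizationAct (S : Submonoid A) (M : Type u) [Zero M] [MulActionWithZero A M] :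
    MulActionWithZero (Localization S) (OreLocalization S M) where
  smul_zero r := by
    induction r using OreLocalization.ind with
    | _ a s =>
      rw [OreLocalization.zero_def, OreLocalization.oreDiv_smul_char a 0 s 1 a 1 (by simp),
        smul_zero, OreLocalization.oreDiv_eq_iff]
      exact ⟨s, 1, by simp [Submonoid.smul_def], by simp⟩
  zero_smul m := by
    induction m using OreLocalization.ind with
    | _ m s =>
      rw [OreLocalization.zero_def, OreLocalization.zero_def,
        OreLocalization.oreDiv_smul_char 0 m 1 s 0 1 (by simp), zero_smul]
      simp

/-- The sheaf of sets on `Spec A` associated with an `A`-set `M`: its sections are the functions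
`p ↦ s p ∈ M_p` that are locally of the form `m / f`. -/
def tildeSheaf (M : Type u) [Zero M] [MulActionWithZero A M] : SetPresheaf (PrimeSpec A) :=
  SetPresheaf.localSections (fun p => OreLocalization p.compl M)
    (fun V s => ∃ (m : M) (f : A), ∀ p : V, ∃ hf : f ∈ p.1.compl,
      s p = OreLocalization.oreDiv m ⟨f, hf⟩)
    (by
      rintro V W h s ⟨m, f, H⟩
      exact ⟨m, f, fun p => H ⟨p.1, h p.2⟩⟩)

theorem tildeSheaf_isSheaf (M : Type u) [Zero M] [MulActionWithZero A M] :
    (tildeSheaf A M).IsSheaf := SetPresheaf.localSections_isSheaf _ _ _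

variable {A} in
theorem oreDiv_smul_oreDiv (S : Submonoid A) (M : Type u) [Zero M] [MulActionWithZero A M]
    (a : A) (m : M) (s t : S) :
    (OreLocalization.oreDiv a s : Localization S) • OreLocalization.oreDiv m t =
      OreLocalization.oreDiv (a • m) (s * t) := by
  rw [OreLocalization.oreDiv_smul_char a m s t a t (mul_comm _ _), mul_comm]

variable {A} in
/-- A section of the structure sheaf acts pointwise. -/
def tildeSMul {M : Type u} [Zero M] [MulActionWithZero A M] {U : Opens (PrimeSpec A)}
    (a : (tildeSheaf A A).obj U) (s : (tildeSheaf A M).obj U) : (tildeSheaf A M).obj U :=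
  ⟨fun p => (a.1 p : Localization p.1.compl) • s.1 p, fun p => by
    obtain ⟨V, hx, hV, b, f, hb⟩ := a.2 p
    obtain ⟨W, hx', hW, m, g, hm⟩ := s.2 p
    refine ⟨V ⊓ W, ⟨hx, hx'⟩, inf_le_left.trans hV, b • m, f * g, fun q => ?_⟩
    obtain ⟨hf, e⟩ := hb ⟨q.1, q.2.1⟩
    obtain ⟨hg, e'⟩ := hm ⟨q.1, q.2.2⟩
    refine ⟨mul_mem hf hg, ?_⟩
    change (a.1 ⟨q.1, _⟩ : Localization q.1.compl) • s.1 ⟨q.1, _⟩ = _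
    dsimp only at e e'
    rw [e, e', oreDiv_smul_oreDiv]
    rfl⟩

instance (U : Opens (PrimeSpec A)) : CommMonoidWithZero ((tildeSheaf A A).obj U) where
  mul := tildeSMul
  one := ⟨fun _ => (1 : Localization _), fun p => ⟨U, p.2, le_rfl, 1, 1, fun q =>
    ⟨one_mem q.1.compl, OreLocalization.one_def⟩⟩⟩
  zero := ⟨fun _ => (0 : Localization _), fun p => ⟨U, p.2, le_rfl, 0, 1, fun q =>
    ⟨one_mem q.1.compl, OreLocalization.zero_def⟩⟩⟩
  mul_assoc a b c := Subtype.ext (funext fun p => mul_assoc (G := Localization p.1.compl) _ _ _)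
  mul_comm a b := Subtype.ext (funext fun p => mul_comm (G := Localization p.1.compl) _ _)
  one_mul a := Subtype.ext (funext fun p => one_mul (M := Localization p.1.compl) _)
  mul_one a := Subtype.ext (funext fun p => mul_one (M := Localization p.1.compl) _)
  zero_mul a := Subtype.ext (funext fun p => zero_mul (M₀ := Localization p.1.compl) _)
  mul_zero a := Subtype.ext (funext fun p => mul_zero (M₀ := Localization p.1.compl) _)

/-- The spectrum of a commutative monoid with zero. -/
def Spec : MonoidalSpace.{u} where
  carrier := PrimeSpec A
  sheaf := tildeSheaf A A
  res_mul _ _ _ := rfl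
  res_one _ := rfl
  res_zero _ := rfl
  isSheaf := tildeSheaf_isSheaf A A

instance tildeZero (M : Type u) [Zero M] [MulActionWithZero A M] (U : Opens (PrimeSpec A)) :
    Zero ((tildeSheaf A M).obj U) :=
  ⟨⟨fun _ => 0, fun p => ⟨U, p.2, le_rfl, 0, 1, fun q =>
    ⟨one_mem q.1.compl, OreLocalization.zero_def⟩⟩⟩⟩

instance tildeAct (M : Type u) [Zero M] [MulActionWithZero A M] (U : Opens (PrimeSpec A)) :
    MulActionWithZero ((tildeSheaf A A).obj U) ((tildeSheaf A M).obj U) where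
  smul := tildeSMul
  one_smul s := Subtype.ext (funext fun p => one_smul (Localization p.1.compl) _)
  mul_smul a b s := Subtype.ext (funext fun p => mul_smul (α := Localization p.1.compl) _ _ _)
  smul_zero a := Subtype.ext (funext fun p =>
    smul_zero (M := Localization p.1.compl) (A := OreLocalization p.1.compl M) _)
  zero_smul s := Subtype.ext (funext fun p => zero_smul (Localization p.1.compl) _)

/-- The `𝒪`-module on `Spec A` associated with an `A`-set. -/
def tilde (M : Type u) [Zero M] [MulActionWithZero A M] : OModule (Spec A) where
  toSetPresheaf := tildeSheaf A M
  zero U := tildeZero A M U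
  act U := tildeAct A M U
  res_smul _ _ _ := rfl
  isSheaf := tildeSheaf_isSheaf A M

end Spec

/-- An affine open subspace of `X` with coordinate monoid `A`: an isomorphism of monoidal spaces
from `Spec A` onto an open subspace of `X`. -/
structure AffineChart (A : Type u) [CommMonoidWithZero A] (X : MonoidalSpace.{u}) where
  toFun : (Spec A).carrier → X.carrier
  isOpenEmbedding : Topology.IsOpenEmbedding toFun
  sec : ∀ V : Opens (Spec A).carrier, (Spec A).sheaf.obj V ≃*
    X.sheaf.obj ⟨toFun '' V, isOpenEmbedding.isOpenMap _ V.2⟩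
  sec_res : ∀ {V W : Opens (Spec A).carrier} (h : W ≤ V) (a : (Spec A).sheaf.obj V),
    sec W ((Spec A).sheaf.res h a) = X.sheaf.res (Set.image_mono h) (sec V a)

namespace AffineChart

variable {A : Type u} [CommMonoidWithZero A] {X : MonoidalSpace.{u}} (c : AffineChart A X)

/-- The image of an open subset of `Spec A` in `X`. -/
def image (V : Opens (Spec A).carrier) : Opens X.carrier :=
  ⟨c.toFun '' V, c.isOpenEmbedding.isOpenMap _ V.2⟩

theorem image_mono {V W : Opens (Spec A).carrier} (h : W ≤ V) : c.image W ≤ c.image V :=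
  Set.image_mono h

/-- The affine open subset itself. -/
def range : Opens X.carrier := c.image ⊤

/-- The restriction of `M` to the affine open subset is isomorphic to the module associated with
the `A`-set `N`. -/
def RestrictsToTilde (M : OModule X) (N : Type u) [Zero N] [MulActionWithZero A N] : Prop :=
  ∃ e : ∀ V : Opens (Spec A).carrier, M.obj (c.image V) ≃ (tilde A N).obj V,
    (∀ (V : Opens (Spec A).carrier) (a : (Spec A).sheaf.obj V) (m : M.obj (c.image V)),
      e V ((show X.sheaf.obj (c.image V) from c.sec V a) • m) = a • e V m) ∧
    ∀ {V W : Opens (Spec A).carrier} (h : W ≤ V) (m : M.obj (c.image V)),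
      e W (M.res (c.image_mono h) m) = (tilde A N).res h (e V m)

end AffineChart

/-- `X` is covered by spectra of monoids. -/
def MonoidalSpace.IsM0Scheme (X : MonoidalSpace.{u}) : Prop :=
  ∀ x : X.carrier, ∃ (A : Type u) (_ : CommMonoidWithZero A) (c : AffineChart A X), x ∈ c.range

/-- `X` is covered by spectra of integral monoids, that is, monoids in which multiplication by
every nonzero element is injective. -/
def MonoidalSpace.IsIntegral (X : MonoidalSpace.{u}) : Prop :=
  ∀ x : X.carrier, ∃ (A : Type u) (_ : CommMonoidWithZero A) (c : AffineChart A X),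
    IsCancelMulZero A ∧ x ∈ c.range

/-- Connected (in particular nonempty) integral schemes over monoids. -/
structure IntegralScheme extends MonoidalSpace.{u} where
  isM0Scheme : toMonoidalSpace.IsM0Scheme
  isIntegral : toMonoidalSpace.IsIntegral
  connected : ConnectedSpace toMonoidalSpace.carrier

/-- A morphism of schemes over monoids: a local morphism of monoidal spaces. -/
structure SchemeHom (X Y : MonoidalSpace.{u}) where
  base : C(X.carrier, Y.carrier)
  app : ∀ V : Opens Y.carrier, Y.sheaf.obj V →*₀ X.sheaf.obj (V.comap base)
  app_res : ∀ {V W : Opens Y.carrier} (h : W ≤ V) (b : Y.sheaf.obj V),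
    app W (Y.sheaf.res h b) = X.sheaf.res (Opens.comap_mono base h) (app V b)
  /-- If the germ at `x` of the image of `b` is a unit, then so is the germ at `base x` of `b`. -/
  isLocal : ∀ (x : X.carrier) (V : Opens Y.carrier) (_ : base x ∈ V) (b : Y.sheaf.obj V),
    (∃ (U : Opens X.carrier) (_ : x ∈ U) (h : U ≤ V.comap base),
      IsUnit (X.sheaf.res h (app V b))) →
    ∃ (W : Opens Y.carrier) (_ : base x ∈ W) (h : W ≤ V), IsUnit (Y.sheaf.res h b)

/-! ### Classes of `𝒪_X`-modules -/

/-- A projective `A`-set. -/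
def IsProjectiveSet (A P : Type u) [CommMonoidWithZero A] [Zero P] [MulActionWithZero A P] :
    Prop :=
  ∀ (M N : Type u) [Zero M] [MulActionWithZero A M] [Zero N] [MulActionWithZero A N]
    (g : M →[A] N) (h : P →[A] N), Function.Surjective g → ∃ l : P →[A] M, ∀ p, g (l p) = h p

/-- A finitely generated `A`-set: `M = A m₁ ∪ ⋯ ∪ A mₜ`. -/
def IsFinitelyGenerated (A M : Type u) [CommMonoidWithZero A] [Zero M] [MulActionWithZero A M] :
    Prop :=
  ∃ s : Finset M, ∀ m : M, ∃ g ∈ s, ∃ a : A, m = a • g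

/-- A free `A`-set of rank one: `M = A e` with `a ↦ a • e` bijective. -/
def IsFreeOfRankOne (A M : Type u) [CommMonoidWithZero A] [Zero M] [MulActionWithZero A M] :
    Prop :=
  ∃ e : M, Function.Bijective fun a : A => a • e

namespace OModule

variable {X : MonoidalSpace.{u}}

def IsQuasiCoherent (M : OModule X) : Prop :=
  ∀ x : X.carrier, ∃ (A : Type u) (_ : CommMonoidWithZero A) (c : AffineChart A X)
    (N : Type u) (_ : Zero N) (_ : MulActionWithZero A N),
    x ∈ c.range ∧ c.RestrictsToTilde M N

def IsCoherent (M : OModule X) : Prop :=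
  ∀ x : X.carrier, ∃ (A : Type u) (_ : CommMonoidWithZero A) (c : AffineChart A X)
    (N : Type u) (_ : Zero N) (_ : MulActionWithZero A N),
    x ∈ c.range ∧ IsFinitelyGenerated A N ∧ c.RestrictsToTilde M N

/-- Quasi-coherent, and `M(U)` is a projective `𝒪_X(U)`-set for the members `U` of an affine
open cover. -/
def IsLocallyProjective (M : OModule X) : Prop :=
  M.IsQuasiCoherent ∧
    ∀ x : X.carrier, ∃ (A : Type u) (_ : CommMonoidWithZero A) (c : AffineChart A X),
      x ∈ c.range ∧ IsProjectiveSet (X.sheaf.obj c.range) (M.obj c.range)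

/-- Line bundles (locally free sheaves of rank one): quasi-coherent, and `M(U)` is a free
`𝒪_X(U)`-set of rank one for the members `U` of an affine open cover. -/
def IsLineBundle (M : OModule X) : Prop :=
  M.IsQuasiCoherent ∧
    ∀ x : X.carrier, ∃ (A : Type u) (_ : CommMonoidWithZero A) (c : AffineChart A X),
      x ∈ c.range ∧ IsFreeOfRankOne (X.sheaf.obj c.range) (M.obj c.range)

/-- The objects of `Bun X`: locally projective coherent sheaves. -/
def IsBundle (M : OModule X) : Prop := M.IsLocallyProjective ∧ M.IsCoherent

end OModule

/-! ### The Picard group and `K₀` -/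

section K0

variable (X : MonoidalSpace.{u})

/-- Locally projective coherent sheaves on `X`. -/
def Bundle : Type (u + 1) := {M : OModule X // M.IsBundle}

/-- Line bundles on `X`. -/
def LineBundle : Type (u + 1) := {L : OModule X // L.IsLineBundle}

/-- Isomorphism of line bundles. -/
def LineBundle.setoid : Setoid (LineBundle X) where
  r L L' := Nonempty (L.1 ≅ L'.1)
  iseqv := ⟨fun L => ⟨Iso.refl L.1⟩, fun ⟨e⟩ => ⟨e.symm⟩, fun ⟨e⟩ ⟨e'⟩ => ⟨e ≪≫ e'⟩⟩

/-- The set of isomorphism classes of line bundles. -/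
def Pic : Type (u + 1) := Quotient (LineBundle.setoid X)

/-- The relations `[M₂] = [M₁] + [M₃]` for all admissible short exact sequences
`0 ⟶ M₁ ⟶ M₂ ⟶ M₃ ⟶ 0` of locally projective coherent sheaves. -/
def k0Relations : Set (FreeAbelianGroup (Bundle X)) :=
  {r | ∃ (M₁ M₂ M₃ : Bundle X) (f : OModule.Hom M₁.1 M₂.1) (g : OModule.Hom M₂.1 M₃.1),
    OModule.IsAdmissibleExact f g ∧ r = .of M₂ - .of M₁ - .of M₃}

/-- The Grothendieck group of the locally projective coherent sheaves on `X`. -/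
def K0 : Type (u + 1) := FreeAbelianGroup (Bundle X) ⧸ AddSubgroup.closure (k0Relations X)

instance : AddCommGroup (K0 X) :=
  inferInstanceAs (AddCommGroup (FreeAbelianGroup (Bundle X) ⧸ AddSubgroup.closure (k0Relations X)))

end K0

section Classes

variable {X : MonoidalSpace.{u}}

/-- The isomorphism class of a line bundle. -/
def Pic.mk (L : OModule X) (hL : L.IsLineBundle) : Pic X := Quotient.mk _ ⟨L, hL⟩

/-- The class of a locally projective coherent sheaf in `K₀`. -/
def K0.mk (M : OModule X) (hM : M.IsBundle) : K0 X := QuotientAddGroup.mk (.of ⟨M, hM⟩)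

/-- The group structure of `Pic X` is induced by the tensor product: the tensor product of two
line bundles is a line bundle and its class is the product of the classes. -/
structure IsTensorGroup (G : CommGroup (Pic X)) : Prop where
  one : ∃ h, (1 : Pic X) = Pic.mk (OModule.structureModule X) h
  mul : ∀ (L L' : OModule X) (hL : L.IsLineBundle) (hL' : L'.IsLineBundle),
    ∃ h, Pic.mk L hL * Pic.mk L' hL' = Pic.mk (L.tensor L') h

/-- The ring structure of `K₀(X)` is induced by the tensor product: its addition is the one of the
Grothendieck group, the tensor product of two locally projective coherent sheaves is again such a
sheaf, and its class is the product of the classes. -/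
structure IsTensorRing (R : CommRing (K0 X)) : Prop where
  add : ∀ a b : K0 X, R.add a b = (inferInstance : AddCommGroup (K0 X)).add a b
  one : ∃ h, (1 : K0 X) = K0.mk (OModule.structureModule X) h
  mul : ∀ (M N : OModule X) (hM : M.IsBundle) (hN : N.IsBundle),
    ∃ h, R.mul (K0.mk M hM) (K0.mk N hN) = K0.mk (M.tensor N) h

end Classes

/-! ### Inverse images -/

section Pullback

variable {X Y : MonoidalSpace.{u}} (φ : SchemeHom X Y) (M : OModule Y)

/-- Symbols `m ⊗ a` with `m ∈ M(V)`, `a ∈ 𝒪_X(U)` and `φ(U) ⊆ V`. -/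
structure PullbackSymbol (U : Opens X.carrier) where
  V : Opens Y.carrier
  le : U ≤ V.comap φ.base
  m : M.obj V
  a : X.sheaf.obj U

/-- The relations between the symbols: `m` may be restricted to a smaller `V`, and
`(b • m) ⊗ a = m ⊗ (φ(b) a)`. -/
inductive PullbackRel (U : Opens X.carrier) :
    PullbackSymbol φ M U → PullbackSymbol φ M U → Prop
  | res (V V' : Opens Y.carrier) (h : V' ≤ V) (hV : U ≤ V'.comap φ.base) (m : M.obj V)
      (a : X.sheaf.obj U) :
      PullbackRel U ⟨V, hV.trans (Opens.comap_mono φ.base h), m, a⟩ ⟨V', hV, M.res h m, a⟩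
  | smul (V : Opens Y.carrier) (hV : U ≤ V.comap φ.base) (b : Y.sheaf.obj V) (m : M.obj V)
      (a : X.sheaf.obj U) :
      PullbackRel U ⟨V, hV, b • m, a⟩ ⟨V, hV, m, X.sheaf.res hV (φ.app V b) * a⟩

/-- The pointed set `(φ⁻¹M)(U) ⊗ 𝒪_X(U)`, the tensor product over `(φ⁻¹𝒪_Y)(U)`, where
`(φ⁻¹M)(U)` and `(φ⁻¹𝒪_Y)(U)` are the colimits of the sections over the open `V ⊇ φ(U)`. -/
def PullbackSet (U : Opens X.carrier) : Type u := Quot (PullbackRel φ M U)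

/-- The class of a symbol `m ⊗ a`. -/
def PullbackSet.mk {U : Opens X.carrier} (V : Opens Y.carrier) (h : U ≤ V.comap φ.base)
    (m : M.obj V) (a : X.sheaf.obj U) : PullbackSet φ M U := Quot.mk _ ⟨V, h, m, a⟩

instance (U : Opens X.carrier) : Zero (PullbackSet φ M U) :=
  ⟨PullbackSet.mk φ M ⊤ (fun _ _ => trivial) 0 0⟩

instance (U : Opens X.carrier) : MulActionWithZero (X.sheaf.obj U) (PullbackSet φ M U) where
  smul c := Quot.map (fun s => ⟨s.V, s.le, s.m, c * s.a⟩) (by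
    rintro _ _ (⟨V, V', h', hV, m, a⟩ | ⟨V, hV, b, m, a⟩)
    · exact .res V V' h' hV m _
    · have := PullbackRel.smul V hV b m (c * a) (φ := φ) (M := M)
      rw [mul_left_comm] at this
      exact this)
  one_smul := by
    rintro ⟨V, hV, m, a⟩
    exact congrArg (PullbackSet.mk φ M V hV m) (one_mul a)
  mul_smul c d := by
    rintro ⟨V, hV, m, a⟩
    exact congrArg (PullbackSet.mk φ M V hV m) (mul_assoc c d a)
  smul_zero c := congrArg (PullbackSet.mk φ M ⊤ _ 0) (mul_zero c)
  zero_smul := by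
    rintro ⟨V, hV, m, a⟩
    have h₁ := Quot.sound (PullbackRel.smul V hV 0 m (0 : X.sheaf.obj U) (φ := φ) (M := M))
    have h₂ := Quot.sound (PullbackRel.res ⊤ V le_top hV 0 (0 : X.sheaf.obj U)
      (φ := φ) (M := M))
    rw [zero_smul, mul_zero] at h₁
    rw [M.res_zero, h₁] at h₂
    exact (congrArg (PullbackSet.mk φ M V hV m) (zero_mul a)).trans h₂.symm

/-- The presheaf `U ↦ (φ⁻¹M)(U) ⊗ 𝒪_X(U)`. -/
def prePullback : PreModule X where
  obj U := PullbackSet φ M U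
  res {U U'} h := Quot.map (fun s => ⟨s.V, h.trans s.le, s.m, X.sheaf.res h s.a⟩) (by
    rintro _ _ (⟨V, V', h', hV, m, a⟩ | ⟨V, hV, b, m, a⟩)
    · exact .res V V' h' (h.trans hV) m _
    · have := PullbackRel.smul V (h.trans hV) b m (X.sheaf.res h a) (φ := φ) (M := M)
      rw [← X.sheaf.res_res hV h, ← X.res_mul] at this
      exact this)
  res_id h := by
    rintro ⟨V, hV, m, a⟩
    exact congrArg (PullbackSet.mk φ M V hV m) (X.sheaf.res_id h a)
  res_res h h' := by
    rintro ⟨V, hV, m, a⟩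
    exact congrArg (PullbackSet.mk φ M V _ m) (X.sheaf.res_res h h' a)
  res_smul h c := by
    rintro ⟨V, hV, m, a⟩
    exact congrArg (PullbackSet.mk φ M V (h.trans hV) m) (X.res_mul h c a)

/-- The inverse image `φ^* M`. -/
def pullback : OModule X := (prePullback φ M).sheafify

end Pullback

/-! ### Projective space -/

section Proj

variable (n : ℕ)

/-- The points of projective `n`-space: the nonempty sets of homogeneous coordinates, a point
being given by the coordinates that do not vanish at it. -/
def ProjPoint : Type := {I : Set (Fin (n + 1)) // I.Nonempty}

/-- Non-vanishing of a coordinate is an open condition: the open sets are generated by the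
`U_i`, the set of points where the `i`-th coordinate does not vanish. -/
instance : TopologicalSpace (ProjPoint n) :=
  .generateFrom (Set.range fun i : Fin (n + 1) => {I : ProjPoint n | i ∈ I.1})

/-- Zero and the Laurent monomials `x^e` in `x_0, …, x_n`. -/
abbrev LaurentMonomials : Type := WithZero (Multiplicative (Fin (n + 1) → ℤ))

variable {n} in
/-- `a` is zero, or a Laurent monomial of degree `k` without pole at `I`: the variables that
vanish at `I` do not occur with negative exponent. -/
def IsRegularAt (k : ℤ) (I : ProjPoint n) (a : LaurentMonomials n) : Prop :=
  ∀ e : Fin (n + 1) → ℤ, a = ((Multiplicative.ofAdd e : Multiplicative (Fin (n + 1) → ℤ)) :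
    LaurentMonomials n) → ∑ i, e i = k ∧ ∀ i ∉ I.1, 0 ≤ e i

/-- Functions locally given by zero or a Laurent monomial of degree `k` that is regular at all
points under consideration. -/
def twistSheaf (k : ℤ) : SetPresheaf (ProjPoint n) :=
  SetPresheaf.localSections (fun _ => LaurentMonomials n)
    (fun V s => ∃ a : LaurentMonomials n, ∀ I : V, s I = a ∧ IsRegularAt k I.1 a)
    (by
      rintro V W h s ⟨a, H⟩
      exact ⟨a, fun I => H ⟨I.1, h I.2⟩⟩)

variable {n} in
theorem IsRegularAt.mul {k l : ℤ} {I : ProjPoint n} {a b : LaurentMonomials n}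
    (ha : IsRegularAt k I a) (hb : IsRegularAt l I b) : IsRegularAt (k + l) I (a * b) := by
  intro e he
  induction a using WithZero.recZeroCoe with
  | zero => rw [zero_mul] at he; exact absurd he.symm WithZero.coe_ne_zero
  | coe a =>
    induction b using WithZero.recZeroCoe with
    | zero => rw [mul_zero] at he; exact absurd he.symm WithZero.coe_ne_zero
    | coe b =>
      obtain ⟨ha₁, ha₂⟩ := ha (Multiplicative.toAdd a) rfl
      obtain ⟨hb₁, hb₂⟩ := hb (Multiplicative.toAdd b) rfl
      rw [← WithZero.coe_mul, WithZero.coe_inj] at he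
      have he' : e = Multiplicative.toAdd a + Multiplicative.toAdd b := by
        rw [← toAdd_mul, he]; rfl
      subst he'
      refine ⟨?_, fun i hi => add_nonneg (ha₂ i hi) (hb₂ i hi)⟩
      simp only [Pi.add_apply, Finset.sum_add_distrib, ha₁, hb₁]

variable {n} in
theorem isRegularAt_zero (k : ℤ) (I : ProjPoint n) : IsRegularAt k I 0 := fun e he => by
  exact absurd he.symm WithZero.coe_ne_zero

variable {n} in
theorem isRegularAt_one (I : ProjPoint n) : IsRegularAt 0 I 1 := fun e he => by
  have : e = 0 := by
    rw [← WithZero.coe_one, WithZero.coe_inj] at he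
    exact (congrArg Multiplicative.toAdd he).symm
  subst this
  simp

variable {n} in
/-- Multiplication of sections, `𝒪 × 𝒪(k) ⟶ 𝒪(k)`. -/
def twistSMul {k : ℤ} {U : Opens (ProjPoint n)} (a : (twistSheaf n 0).obj U)
    (s : (twistSheaf n k).obj U) : (twistSheaf n k).obj U :=
  ⟨fun I => a.1 I * s.1 I, fun I => by
    obtain ⟨V, hx, hV, b, hb⟩ := a.2 I
    obtain ⟨W, hx', hW, c, hc⟩ := s.2 I
    refine ⟨V ⊓ W, ⟨hx, hx'⟩, inf_le_left.trans hV, b * c, fun J => ?_⟩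
    obtain ⟨e, h⟩ := hb ⟨J.1, J.2.1⟩
    obtain ⟨e', h'⟩ := hc ⟨J.1, J.2.2⟩
    dsimp only at e e'
    refine ⟨by rw [← e, ← e'], ?_⟩
    simpa using h.mul h'⟩

instance (U : Opens (ProjPoint n)) : CommMonoidWithZero ((twistSheaf n 0).obj U) where
  mul := twistSMul
  one := ⟨fun _ => 1, fun I => ⟨U, I.2, le_rfl, 1, fun J => ⟨rfl, isRegularAt_one _⟩⟩⟩
  zero := ⟨fun _ => 0, fun I => ⟨U, I.2, le_rfl, 0, fun J => ⟨rfl, isRegularAt_zero _ _⟩⟩⟩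
  mul_assoc a b c := Subtype.ext (funext fun _ => mul_assoc _ _ _)
  mul_comm a b := Subtype.ext (funext fun _ => mul_comm _ _)
  one_mul a := Subtype.ext (funext fun _ => one_mul _)
  mul_one a := Subtype.ext (funext fun _ => mul_one _)
  zero_mul a := Subtype.ext (funext fun _ => zero_mul _)
  mul_zero a := Subtype.ext (funext fun _ => mul_zero _)

theorem twistSheaf_isSheaf (k : ℤ) : (twistSheaf n k).IsSheaf :=
  SetPresheaf.localSections_isSheaf _ _ _

/-- Projective `n`-space over `𝔽₁`. -/
def ProjSpace : MonoidalSpace.{0} where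
  carrier := ProjPoint n
  sheaf := twistSheaf n 0
  res_mul _ _ _ := rfl
  res_one _ := rfl
  res_zero _ := rfl
  isSheaf := twistSheaf_isSheaf n 0

instance twistZero (k : ℤ) (U : Opens (ProjPoint n)) : Zero ((twistSheaf n k).obj U) :=
  ⟨⟨fun _ => 0, fun I => ⟨U, I.2, le_rfl, 0, fun J => ⟨rfl, isRegularAt_zero _ _⟩⟩⟩⟩

instance twistAct (k : ℤ) (U : Opens (ProjPoint n)) :
    MulActionWithZero ((twistSheaf n 0).obj U) ((twistSheaf n k).obj U) where
  smul := twistSMul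
  one_smul s := Subtype.ext (funext fun _ => one_mul _)
  mul_smul a b s := Subtype.ext (funext fun _ => mul_assoc _ _ _)
  smul_zero a := Subtype.ext (funext fun _ => mul_zero _)
  zero_smul s := Subtype.ext (funext fun _ => zero_mul _)

/-- The twisted sheaf `𝒪(k)` on projective `n`-space. -/
def twist (k : ℤ) : OModule (ProjSpace n) where
  toSetPresheaf := twistSheaf n k
  zero U := twistZero n k U
  act U := twistAct n k U
  res_smul _ _ _ := rfl
  isSheaf := twistSheaf_isSheaf n k

end Proj

end MonoidGeometry

/-! Everything is computed with local bases and their transition functions.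

An element of a free set over a monoid is zero or a multiple of exactly one basis element, so a
basis over a nontrivial monoid is unique up to a bijection and units (`IsSetBasis.exists_smul_eq`).
Change-of-basis matrices are therefore monomial: a permutation times units. A connected integral
scheme has a generic point `η` lying in every nonempty open set, and restriction of functions to an
open set containing `η` is injective (`exists_isGeneric`). Hence the permutation cannot vary from
place to place: all local bases can be indexed by the one near `η`, and then the transition
functions are diagonal (`OModule.exists_diagonal`). This splits a locally free sheaf into line
bundles, and the same rigidity makes the splitting unique (`DecompOf.exists_equiv`).

Locally projective sheaves are locally free because a projective set over an integral monoid is free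
(`IsProjectiveSet.exists_isSetBasis`). Bases extend over whole charts because the spectrum of a
monoid has a largest prime, the nonunits, whose only neighbourhood is the entire spectrum.

In an admissible exact sequence, normality makes lifts of basis elements of the quotient unique. The
lifts then have the transition functions of the quotient, so the middle term is decomposed by the
line bundles of the two outer terms (`OModule.IsAdmissibleExact.decompOf`). Sending a sheaf to the
sum of its line bundles is therefore additive, and it is inverse to the map from the free group on
`Pic X` to `K₀(X)` (`K0.exists_addEquiv`). Tensor products and inverse images carry bases to bases,
with products and images of transition functions; this gives the ring structure and naturality. The
relation `DecompOf` records a decomposition through its transition functions, so that no explicit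
map to a wedge has to be carried along.

On projective space a line bundle has a unique generator where `x_i` does not vanish, because the
only unit there is `1`. Its transition functions are monomials of degree zero involving only `x_i`
and `x_j`, and the cocycle condition makes them `(x_i / x_j)^m` with a single `m`. So `Pic` is
infinite cyclic, generated by the class of `𝒪(1)`, and its group ring is the Laurent polynomial
ring. -/

namespace MonoidGeometry

/-! ### Local bases, gluing, and decompositions read off from transition functions -/

section

/-! ### Bases of sets over a monoid -/

section SetBasis

/-- `e` is a basis of the `A`-set `M`: every nonzero element is `a • e i` for unique `i` and `a`. -/
structure IsSetBasis (A : Type*) {M ι : Type*} [CommMonoidWithZero A] [Zero M]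
    [MulActionWithZero A M] (e : ι → M) : Prop where
  span : ∀ m : M, m = 0 ∨ ∃ (i : ι) (a : A), m = a • e i
  unique : ∀ {i j : ι} {a b : A}, a ≠ 0 → a • e i = b • e j → i = j ∧ a = b

variable {A M N ι κ : Type*} [CommMonoidWithZero A] [Zero M] [MulActionWithZero A M]
  [Zero N] [MulActionWithZero A N]

/-- This disposes of open sets on which the structure sheaf is trivial, where every module has a
single section. -/
theorem eq_of_one_eq_zero (h : (1 : A) = 0) (m m' : M) : m = m' := by
  rw [← one_smul A m, ← one_smul A m', h, zero_smul, zero_smul]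

theorem map_zero_of_map_smul {l : M → N} (hl : ∀ (a : A) m, l (a • m) = a • l m) : l 0 = 0 := by
  rw [← zero_smul A (0 : M), hl, zero_smul]

namespace IsSetBasis

variable {e : ι → M}

theorem smul_eq_zero (he : IsSetBasis A e) {i : ι} {a : A} : a • e i = 0 ↔ a = 0 := by
  refine ⟨fun h => ?_, fun h => by rw [h, zero_smul]⟩
  by_contra ha
  exact ha (he.unique ha (h.trans (zero_smul A (e i)).symm)).2

theorem smul_inj (he : IsSetBasis A e) {i : ι} {a b : A} (h : a • e i = b • e i) : a = b := by
  by_cases ha : a = 0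
  · rw [ha, zero_smul] at h
    rw [ha, (he.smul_eq_zero).1 h.symm]
  · exact (he.unique ha h).2

/-- The universal property of a free set: an expression `a • e i` of a nonzero element is unique,
and `0` has only expressions with `a = 0`, so `a • f i` depends on `a • e i` alone. -/
theorem exists_lift (he : IsSetBasis A e) (f : ι → N) :
    ∃ l : M → N, (∀ (a : A) m, l (a • m) = a • l m) ∧ ∀ i, l (e i) = f i := by
  classical
  have H : ∀ m : M, ∃ n : N, ∀ i (a : A), m = a • e i → n = a • f i := by
    intro m
    by_cases hm : ∃ i, ∃ a : A, m = a • e i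
    · obtain ⟨i, a, rfl⟩ := hm
      refine ⟨a • f i, fun j b h => ?_⟩
      by_cases ha : a = 0
      · subst ha
        rw [zero_smul] at h ⊢
        rw [(he.smul_eq_zero).1 h.symm, zero_smul]
      · obtain ⟨rfl, rfl⟩ := he.unique ha h
        rfl
    · exact ⟨0, fun i a h => absurd ⟨i, a, h⟩ hm⟩
  -- For empty `ι` the property `H` imposes no condition, not even on the image of `0`, so that case
  -- needs its own map.
  by_cases hι : Nonempty ι
  · choose l hl using H
    refine ⟨l, fun a m => ?_, fun i => ?_⟩
    · rcases he.span m with rfl | ⟨i, b, rfl⟩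
      · obtain ⟨i⟩ := hι
        rw [smul_zero, hl 0 i 0 (zero_smul A _).symm, zero_smul, smul_zero]
      · rw [hl _ i b rfl, ← mul_smul, ← mul_smul]
        exact hl _ i _ rfl
    · rw [hl _ i 1 (one_smul A _).symm, one_smul]
  · exact ⟨fun _ => 0, fun a m => (smul_zero a).symm, fun i => (hι ⟨i⟩).elim⟩

theorem map_eq (he : IsSetBasis A e) {l l' : M → N} (hl : ∀ (a : A) m, l (a • m) = a • l m)
    (hl' : ∀ (a : A) m, l' (a • m) = a • l' m) (h : ∀ i, l (e i) = l' (e i)) (m : M) :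
    l m = l' m := by
  rcases he.span m with rfl | ⟨i, a, rfl⟩
  · rw [map_zero_of_map_smul hl, map_zero_of_map_smul hl']
  · rw [hl, hl', h]

/-- The coordinate functions with respect to a basis. -/
theorem exists_coord (he : IsSetBasis A e) (i : ι) :
    ∃ c : M → A, (∀ (a : A) m, c (a • m) = a * c m) ∧ c (e i) = 1 ∧ ∀ j, j ≠ i → c (e j) = 0 := by
  classical
  obtain ⟨c, hc, h⟩ := he.exists_lift (fun j => if j = i then (1 : A) else 0)
  exact ⟨c, hc, by simp [h], fun j hj => by simp [h, hj]⟩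

/-- A coordinate function that is `1` on `e i` and `0` on the other basis elements detects both the
index and the coefficient. The criterion suits quotients such as tensor products, where maps out are
easy to define and equality is hard to decide. -/
theorem of_coord (hspan : ∀ m : M, m = 0 ∨ ∃ (i : ι) (a : A), m = a • e i)
    (hc : ∀ i, ∃ c : M → A, (∀ (a : A) m, c (a • m) = a * c m) ∧ c (e i) = 1 ∧
      ∀ j, j ≠ i → c (e j) = 0) : IsSetBasis A e := by
  refine ⟨hspan, fun {i j a b} ha h => ?_⟩
  obtain ⟨c, hc, h1, h0⟩ := hc i
  have h' := congrArg c h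
  rw [hc, hc, h1, mul_one] at h'
  by_cases hij : j = i
  · subst hij
    exact ⟨rfl, by rw [h', h1, mul_one]⟩
  · rw [h0 j hij, mul_zero] at h'
    exact absurd h' ha

theorem comp_equiv (he : IsSetBasis A e) (σ : κ ≃ ι) : IsSetBasis A (fun k => e (σ k)) := by
  refine ⟨fun m => (he.span m).imp_right ?_, fun ha h => ?_⟩
  · rintro ⟨i, a, rfl⟩
    exact ⟨σ.symm i, a, by rw [σ.apply_symm_apply]⟩
  · obtain ⟨h1, h2⟩ := he.unique ha h
    exact ⟨σ.injective h1, h2⟩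

theorem unit_smul (he : IsSetBasis A e) {g : ι → A} (hg : ∀ i, IsUnit (g i)) :
    IsSetBasis A (fun i => g i • e i) := by
  refine ⟨fun m => (he.span m).imp_right ?_, fun {i j a b} ha h => ?_⟩
  · rintro ⟨i, a, rfl⟩
    obtain ⟨b, hb⟩ := (hg i).exists_right_inv
    exact ⟨i, a * b, by rw [← mul_smul, mul_assoc, mul_comm b, hb, mul_one]⟩
  · rw [← mul_smul, ← mul_smul] at h
    have ha' : a * g i ≠ 0 := fun h0 => ha (((hg i).mul_left_eq_zero).1 h0)
    obtain ⟨rfl, h2⟩ := he.unique ha' h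
    exact ⟨rfl, (hg i).mul_right_cancel h2⟩

theorem congr_equiv (he : IsSetBasis A e) (σ : M ≃ N) (hσ : ∀ (a : A) m, σ (a • m) = a • σ m) :
    IsSetBasis A (fun i => σ (e i)) := by
  refine ⟨fun n => ?_, fun ha h => ?_⟩
  · rcases he.span (σ.symm n) with h | ⟨i, a, h⟩
    · left
      rw [← σ.apply_symm_apply n, h, map_zero_of_map_smul hσ]
    · right
      exact ⟨i, a, by rw [← hσ, ← h, σ.apply_symm_apply]⟩
  · rw [← hσ, ← hσ] at h
    exact he.unique ha (σ.injective h)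

/-- Two bases of the same set over a nontrivial monoid differ by a bijection and units. -/
theorem exists_smul_eq [Nontrivial A] {e' : κ → M} (he : IsSetBasis A e) (he' : IsSetBasis A e')
    (i : ι) : ∃ (j : κ) (a : A), e i = a • e' j ∧ IsUnit a := by
  have h1 : e i ≠ 0 := fun h => one_ne_zero ((he.smul_eq_zero (a := (1 : A))).1
    ((one_smul A (e i)).trans h))
  obtain ⟨j, a, h⟩ := (he'.span (e i)).resolve_left h1
  obtain ⟨k, b, h'⟩ := (he.span (e' j)).resolve_left (by
    intro h0
    rw [h0, smul_zero] at h
    exact h1 h)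
  refine ⟨j, a, h, ?_⟩
  -- Expanding `e i` in the other basis and back gives `e i = (a * b) • e k`; uniqueness yields `a *
  -- b = 1`.
  rw [h', ← mul_smul] at h
  have := (he.unique one_ne_zero ((one_smul A (e i)).trans h)).2
  exact IsUnit.of_mul_eq_one b this.symm

end IsSetBasis

end SetBasis

/-! ### Gluing -/

namespace SetPresheaf

variable {X : Type u} [TopologicalSpace X] {F : SetPresheaf X}

/-- The sheaf axiom for an open set that is covered by the `U k` without being literally their
supremum. -/
theorem IsSheaf.glue (hF : F.IsSheaf) {κ : Type u} {V : Opens X} (U : κ → Opens X)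
    (hU : ∀ k, U k ≤ V) (hV : ∀ x ∈ V, ∃ k, x ∈ U k) (s : ∀ k, F.obj (U k))
    (hs : ∀ k l (W : Opens X) (hk : W ≤ U k) (hl : W ≤ U l), F.res hk (s k) = F.res hl (s l)) :
    ∃! t : F.obj V, ∀ k, F.res (hU k) t = s k := by
  have e : V = iSup U := le_antisymm (fun x hx => Opens.mem_iSup.2 (hV x hx)) (iSup_le hU)
  subst e
  exact hF κ U s fun i j => hs i j _ _ _

theorem IsSheaf.ext (hF : F.IsSheaf) {V : Opens X} {s t : F.obj V}
    (h : ∀ x ∈ V, ∃ (W : Opens X) (_ : x ∈ W) (hW : W ≤ V), F.res hW s = F.res hW t) : s = t := by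
  choose W hx hW h using h
  obtain ⟨r, -, hr⟩ := hF.glue (κ := V) (fun x => W x.1 x.2) (fun x => hW _ _)
    (fun x hxV => ⟨⟨x, hxV⟩, hx _ _⟩) (fun x => F.res (hW x.1 x.2) s)
    (fun k l W hk hl => by rw [F.res_res, F.res_res])
  exact (hr s fun _ => rfl).trans (hr t fun x => (h _ _).symm).symm

theorem IsSheaf.glue_of_mem (hF : F.IsSheaf) {V : Opens X} (W : ∀ x ∈ V, Opens X)
    (hx : ∀ x h, x ∈ W x h) (hW : ∀ x h, W x h ≤ V) (s : ∀ x h, F.obj (W x h))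
    (hs : ∀ x hx y hy (W' : Opens X) (h : W' ≤ W x hx) (h' : W' ≤ W y hy),
      F.res h (s x hx) = F.res h' (s y hy)) : ∃ t : F.obj V, ∀ x h, F.res (hW x h) t = s x h := by
  obtain ⟨t, ht, -⟩ := hF.glue (κ := V) (fun x => W x.1 x.2) (fun x => hW _ _)
    (fun x hxV => ⟨⟨x, hxV⟩, hx _ _⟩) (fun x => s x.1 x.2) (fun k l => hs _ _ _ _)
  exact ⟨t, fun x h => ht ⟨x, h⟩⟩

end SetPresheaf

/-! ### Bases of modules, morphisms defined on an open subset -/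

variable {X : MonoidalSpace.{u}}

/-- The restrictions of the sections `e` are a basis over every open subset of `U`. -/
def IsBasisOn (T : PreModule X) (U : Opens X.carrier) {ι : Type*} (e : ι → T.obj U) : Prop :=
  ∀ (V : Opens X.carrier) (h : V ≤ U), IsSetBasis (X.sheaf.obj V) (fun i => T.res h (e i))

/-- A morphism of presheaves of modules defined on the open subsets of `U`. -/
structure LocalHom (T T' : PreModule X) (U : Opens X.carrier) where
  app : ∀ V, V ≤ U → T.obj V → T'.obj V
  map_smul : ∀ V h (a : X.sheaf.obj V) m, app V h (a • m) = a • app V h m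
  map_res : ∀ {V W} (h : V ≤ U) (h' : W ≤ V) (m : T.obj V),
    app W (h'.trans h) (T.res h' m) = T'.res h' (app V h m)

namespace IsBasisOn

variable {T T' : PreModule X} {U : Opens X.carrier} {ι : Type*} {e : ι → T.obj U}

theorem mono (he : IsBasisOn T U e) {V : Opens X.carrier} (h : V ≤ U) :
    IsBasisOn T V (fun i => T.res h (e i)) := fun W hW => by
  simpa only [T.res_res] using he W (hW.trans h)

theorem self (he : IsBasisOn T U e) : IsSetBasis (X.sheaf.obj U) e := by
  simpa only [T.res_id] using he U le_rfl

theorem comp_equiv {κ : Type*} (he : IsBasisOn T U e) (σ : κ ≃ ι) :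
    IsBasisOn T U (fun k => e (σ k)) := fun V h => (he V h).comp_equiv σ

theorem unit_smul (he : IsBasisOn T U e) {g : ι → X.sheaf.obj U} (hg : ∀ i, IsUnit (g i)) :
    IsBasisOn T U (fun i => g i • e i) := fun V h => by
  simp only [T.res_smul]
  refine (he V h).unit_smul fun i => ?_
  obtain ⟨b, hb⟩ := (hg i).exists_right_inv
  exact IsUnit.of_mul_eq_one (X.sheaf.res h b) (by rw [← X.res_mul, hb, X.res_one])

theorem exists_localHom (he : IsBasisOn T U e) (e' : ι → T'.obj U) :
    ∃ l : LocalHom T T' U, ∀ V h i, l.app V h (T.res h (e i)) = T'.res h (e' i) := by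
  choose l hl h using fun V h => (he V h).exists_lift (fun i => T'.res h (e' i))
  refine ⟨⟨l, hl, fun {V W} hV hW m => ?_⟩, h⟩
  rcases (he V hV).span m with rfl | ⟨i, a, rfl⟩
  · rw [T.res_zero, map_zero_of_map_smul (hl _ _), map_zero_of_map_smul (hl _ _), T'.res_zero]
  · rw [hl, h, T'.res_smul, T'.res_res, T.res_smul, T.res_res, hl, h]

theorem exists_localEquiv {e' : ι → T'.obj U} (he : IsBasisOn T U e) (he' : IsBasisOn T' U e') :
    ∃ (l : LocalHom T T' U) (l' : LocalHom T' T U),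
      (∀ V h i, l.app V h (T.res h (e i)) = T'.res h (e' i)) ∧
      (∀ V h m, l'.app V h (l.app V h m) = m) ∧ ∀ V h m, l.app V h (l'.app V h m) = m := by
  obtain ⟨l, hl⟩ := he.exists_localHom e'
  obtain ⟨l', hl'⟩ := he'.exists_localHom e
  refine ⟨l, l', hl, fun V hV m => ?_, fun V hV m => ?_⟩
  · refine (he V hV).map_eq (l := fun m => l'.app V hV (l.app V hV m)) (l' := id)
      (fun a m => ?_) (fun a m => rfl) (fun i => ?_) m
    · rw [l.map_smul, l'.map_smul]
    · rw [hl, hl']; rfl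
  · refine (he' V hV).map_eq (l := fun m => l.app V hV (l'.app V hV m)) (l' := id)
      (fun a m => ?_) (fun a m => rfl) (fun i => ?_) m
    · rw [l'.map_smul, l.map_smul]
    · rw [hl', hl]; rfl

end IsBasisOn

namespace OModule

/-- Morphisms defined on the members of an open cover that agree on the overlaps can be glued. -/
theorem exists_hom_of_localHom {M N : OModule X} {U : X.carrier → Opens X.carrier}
    (hU : ∀ x, x ∈ U x) (l : ∀ x, LocalHom M.toPreModule N.toPreModule (U x))
    (hl : ∀ x y V (hx : V ≤ U x) (hy : V ≤ U y) m, (l x).app V hx m = (l y).app V hy m) :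
    ∃ φ : Hom M N, ∀ x V (h : V ≤ U x) m, φ.app V m = (l x).app V h m := by
  -- The glued section is described on every open set inside `V` and some `U x`, so that
  -- equivariance and compatibility with restrictions can be checked locally.
  have H : ∀ V (m : M.obj V), ∃ n : N.obj V, ∀ x W (hx : W ≤ U x) (h : W ≤ V),
      N.res h n = (l x).app W hx (M.res h m) := by
    intro V m
    obtain ⟨n, hn⟩ := N.isSheaf.glue_of_mem (V := V) (fun x _ => V ⊓ U x)
      (fun x hx => ⟨hx, hU x⟩) (fun x _ => inf_le_left)
      (fun x _ => (l x).app _ inf_le_right (M.res inf_le_left m)) (by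
        intro x hx y hy W h h'
        rw [← (l x).map_res, ← (l y).map_res, M.res_res, M.res_res]
        exact hl _ _ _ _ _ _)
    refine ⟨n, fun x W hx h => N.isSheaf.ext fun y hy => ?_⟩
    refine ⟨W ⊓ U y, ⟨hy, hU y⟩, inf_le_left, ?_⟩
    have := congrArg (N.res (inf_le_inf_right (U y) h)) (hn y (h hy))
    rw [N.res_res, ← (l y).map_res, M.res_res] at this
    rw [N.res_res, this, ← (l x).map_res, M.res_res]
    exact hl _ _ _ _ _ _
  choose f hf using H
  have hf' : ∀ x V (h : V ≤ U x) m, f V m = (l x).app V h m := by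
    intro x V h m
    have := hf V m x V h le_rfl
    rwa [N.res_id, M.res_id] at this
  refine ⟨⟨f, fun V a m => ?_, fun {V W} h m => ?_⟩, hf'⟩
  · refine N.isSheaf.ext fun x hx => ⟨V ⊓ U x, ⟨hx, hU x⟩, inf_le_left, ?_⟩
    rw [hf V _ x _ inf_le_right, N.res_smul, hf V _ x _ inf_le_right, M.res_smul, (l x).map_smul]
  · refine N.isSheaf.ext fun x hx => ⟨W ⊓ U x, ⟨hx, hU x⟩, inf_le_left, ?_⟩
    rw [hf W _ x _ inf_le_right, N.res_res, hf V _ x _ inf_le_right, M.res_res]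

theorem Hom.eq_of_local {M N : OModule X} {φ ψ : Hom M N} {U : X.carrier → Opens X.carrier}
    (hU : ∀ x, x ∈ U x) (h : ∀ x V, V ≤ U x → ∀ m, φ.app V m = ψ.app V m) : φ = ψ := by
  refine Hom.ext (funext fun V => funext fun m => N.isSheaf.ext fun x hx => ?_)
  refine ⟨V ⊓ U x, ⟨hx, hU x⟩, inf_le_left, ?_⟩
  rw [← φ.map_res, ← ψ.map_res]
  exact h x _ inf_le_right _

/-- Modules with local bases that have the same transition functions are isomorphic. -/
theorem nonempty_iso_of_basis {M N : OModule X} {U : X.carrier → Opens X.carrier}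
    (hU : ∀ x, x ∈ U x) {ι : Type*} (b : ∀ x, ι → M.obj (U x)) (b' : ∀ x, ι → N.obj (U x))
    (hb : ∀ x, IsBasisOn M.toPreModule (U x) (b x))
    (hb' : ∀ x, IsBasisOn N.toPreModule (U x) (b' x))
    (h : ∀ x y i j (g : X.sheaf.obj (U x ⊓ U y)),
      M.res inf_le_left (b x i) = g • M.res inf_le_right (b y j) →
      N.res inf_le_left (b' x i) = g • N.res inf_le_right (b' y j)) : Nonempty (M ≅ N) := by
  choose l l' hl left right using fun x => (hb x).exists_localEquiv (hb' x)
  have agree : ∀ x y V (hx : V ≤ U x) (hy : V ≤ U y) m,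
      (l x).app V hx m = (l y).app V hy m := fun x y V hx hy m => by
    refine (hb x V hx).map_eq ((l x).map_smul V hx) ((l y).map_smul V hy) (fun i => ?_) m
    rw [hl]
    have e : M.res hx (b x i) = M.res (le_inf hx hy) (M.res inf_le_left (b x i)) := by
      rw [M.res_res]
    have e' : N.res hx (b' x i) = N.res (le_inf hx hy) (N.res inf_le_left (b' x i)) := by
      rw [N.res_res]
    -- If a basis element vanishes on the overlap, then `1 = 0` there and any two sections over `V`
    -- agree. Otherwise its expansion in the other basis is a transition function, and `h` applies.
    rcases (hb y _ inf_le_right).span (M.res (inf_le_left : U x ⊓ U y ≤ U x) (b x i)) with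
      h0 | ⟨j, g, hg⟩
    · have h1 : M.res (inf_le_left : U x ⊓ U y ≤ U x) (b x i) =
          (0 : X.sheaf.obj (U x ⊓ U y)) • M.res (inf_le_left : U x ⊓ U y ≤ U x) (b x i) := by
        rw [zero_smul, h0]
      have h2 : (1 : X.sheaf.obj (U x ⊓ U y)) = 0 :=
        ((hb x _ inf_le_left).smul_inj ((one_smul _ _).trans h1))
      have h3 : (1 : X.sheaf.obj V) = 0 := by
        rw [← X.res_one (le_inf hx hy), h2, X.res_zero]
      exact eq_of_one_eq_zero h3 _ _
    · rw [e, e', hg, h _ _ _ _ _ hg, M.res_smul, N.res_smul, (l y).map_smul, M.res_res, N.res_res,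
        hl]
  have agree' : ∀ x y V (hx : V ≤ U x) (hy : V ≤ U y) m,
      (l' x).app V hx m = (l' y).app V hy m := fun x y V hx hy m => by
    rw [← right y V hy m, left, ← agree x y V hx hy, left]
  obtain ⟨φ, hφ⟩ := exists_hom_of_localHom hU l agree
  obtain ⟨ψ, hψ⟩ := exists_hom_of_localHom hU l' agree'
  refine ⟨⟨φ, ψ, Hom.eq_of_local hU fun x V hV m => ?_, Hom.eq_of_local hU fun x V hV m => ?_⟩⟩
  · change ψ.app V (φ.app V m) = m
    rw [hφ x V hV, hψ x V hV, left]
  · change φ.app V (ψ.app V m) = m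
    rw [hψ x V hV, hφ x V hV, right]

theorem iso_hom_app_inv {M N : OModule X} (e : M ≅ N) (V : Opens X.carrier) (n : N.obj V) :
    Hom.app e.hom V (Hom.app e.inv V n) = n :=
  congrFun (congrFun (congrArg Hom.app e.inv_hom_id) V) n

theorem iso_inv_app_hom {M N : OModule X} (e : M ≅ N) (V : Opens X.carrier) (m : M.obj V) :
    Hom.app e.inv V (Hom.app e.hom V m) = m :=
  congrFun (congrFun (congrArg Hom.app e.hom_inv_id) V) m

theorem IsBasisOn.map_iso {M N : OModule X} (e : M ≅ N) {U : Opens X.carrier} {ι : Type*}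
    {b : ι → M.obj U} (hb : IsBasisOn M.toPreModule U b) :
    IsBasisOn N.toPreModule U (fun i => Hom.app e.hom U (b i)) := fun V h => by
  simp only [← Hom.map_res e.hom]
  exact (hb V h).congr_equiv ⟨Hom.app e.hom V, Hom.app e.inv V, iso_inv_app_hom e V,
    iso_hom_app_inv e V⟩ (Hom.map_smul e.hom V)

end OModule

/-! ### Decompositions into modules of rank one -/

/-- On each member `U x` of a cover `M` has a basis `b x`, and `L i` has a basis `e x i` with one
element, such that `b x i` and `e x i` have the same transition functions. -/
structure DecompOn (M : OModule X) {ι : Type*} (L : ι → OModule X)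
    (U : X.carrier → Opens X.carrier) (e : ∀ x i, (L i).obj (U x)) (b : ∀ x, ι → M.obj (U x)) :
    Prop where
  gen : ∀ x i, IsBasisOn (L i).toPreModule (U x) (fun _ : Unit => e x i)
  basis : ∀ x, IsBasisOn M.toPreModule (U x) (b x)
  trans : ∀ x y i (g : X.sheaf.obj (U x ⊓ U y)),
    (L i).res inf_le_left (e x i) = g • (L i).res inf_le_right (e y i) →
    M.res inf_le_left (b x i) = g • M.res inf_le_right (b y i)

/-- `M` is the wedge of the modules `L i`, which are free of rank one locally. -/
def DecompOf (M : OModule X) {ι : Type*} (L : ι → OModule X) : Prop :=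
  ∃ (U : X.carrier → Opens X.carrier) (_ : ∀ x, x ∈ U x) (e : ∀ x i, (L i).obj (U x))
    (b : ∀ x, ι → M.obj (U x)), DecompOn M L U e b

theorem IsBasisOn.exists_smul_of_unit {T : PreModule X} {U V : Opens X.carrier} {e : T.obj U}
    (he : IsBasisOn T U (fun _ : Unit => e)) (h : V ≤ U) (m : T.obj V) :
    ∃ g : X.sheaf.obj V, m = g • T.res h e := by
  rcases (he V h).span m with h0 | ⟨_, g, hg⟩
  · exact ⟨0, by rw [h0, zero_smul]⟩
  · exact ⟨g, hg⟩

theorem isBasisOn_unit {T : PreModule X} {U : Opens X.carrier} {e : T.obj U}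
    (span : ∀ V (h : V ≤ U) (m : T.obj V), ∃ g : X.sheaf.obj V, m = g • T.res h e)
    (inj : ∀ V (h : V ≤ U) (a b : X.sheaf.obj V), a • T.res h e = b • T.res h e → a = b) :
    IsBasisOn T U (fun _ : Unit => e) := fun V h =>
  ⟨fun m => Or.inr ⟨(), span V h m⟩, fun _ hab => ⟨rfl, inj V h _ _ hab⟩⟩

namespace DecompOn

variable {M M' : OModule X} {ι : Type*} {L : ι → OModule X} {U : X.carrier → Opens X.carrier}
  {e : ∀ x i, (L i).obj (U x)} {b : ∀ x, ι → M.obj (U x)}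

/-- A factor `g` on the smaller overlap need not be given as a restriction. But a transition
function `g'` exists on the larger overlap, and its restriction equals `g` because coefficients in a
basis are unique. -/
theorem mono (h : DecompOn M L U e b) {U' : X.carrier → Opens X.carrier} (hU : ∀ x, U' x ≤ U x) :
    DecompOn M L U' (fun x i => (L i).res (hU x) (e x i)) (fun x i => M.res (hU x) (b x i)) where
  gen x i := (h.gen x i).mono (hU x)
  basis x := (h.basis x).mono (hU x)
  trans x y i g hg := by
    obtain ⟨g', hg'⟩ := (h.gen y i).exists_smul_of_unit (V := U x ⊓ U y) inf_le_right
      ((L i).res inf_le_left (e x i))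
    have e1 := congrArg ((L i).res (inf_le_inf (hU x) (hU y))) hg'
    have e2 := congrArg (M.res (inf_le_inf (hU x) (hU y))) (h.trans x y i g' hg')
    rw [PreModule.res_smul] at e1 e2
    simp only [SetPresheaf.res_res] at e1 e2 hg ⊢
    rw [e2]
    have := (h.gen y i _ (inf_le_right.trans (hU y))).smul_inj (i := ()) (e1.symm.trans hg)
    rw [this]

theorem exists_trans (h : DecompOn M L U e b) (x y : X.carrier) (i : ι) :
    ∃ g : X.sheaf.obj (U x ⊓ U y),
      (L i).res inf_le_left (e x i) = g • (L i).res inf_le_right (e y i) ∧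
      M.res inf_le_left (b x i) = g • M.res inf_le_right (b y i) := by
  obtain ⟨g, hg⟩ := (h.gen y i).exists_smul_of_unit (V := U x ⊓ U y) inf_le_right
      ((L i).res inf_le_left (e x i))
  exact ⟨g, hg, h.trans x y i g hg⟩

/-- The transition function of `L i` is unique, so exhibiting one factor valid for both modules is
as good as treating every factor valid for `L i`. -/
theorem of_exists (hL : ∀ x i, IsBasisOn (L i).toPreModule (U x) (fun _ : Unit => e x i))
    (hb : ∀ x, IsBasisOn M.toPreModule (U x) (b x))
    (h : ∀ x y i, ∃ g : X.sheaf.obj (U x ⊓ U y),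
      (L i).res inf_le_left (e x i) = g • (L i).res inf_le_right (e y i) ∧
      M.res inf_le_left (b x i) = g • M.res inf_le_right (b y i)) : DecompOn M L U e b where
  gen := hL
  basis := hb
  trans x y i g hg := by
    obtain ⟨g', h1, h2⟩ := h x y i
    rw [h2, (hL y i _ inf_le_right).smul_inj (i := ()) (h1.symm.trans hg)]

/-- The generators `e` and `e'` of the same modules differ by units `u`. After rescaling `b` by `u`,
the bases of `M` and `M'` have the same transition functions. -/
theorem nonempty_iso (h : DecompOn M L U e b) (hU : ∀ x, x ∈ U x)
    {e' : ∀ x i, (L i).obj (U x)} {b' : ∀ x, ι → M'.obj (U x)}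
    (h' : DecompOn M' L U e' b') : Nonempty (M ≅ M') := by
  have hu : ∀ x i, ∃ g : X.sheaf.obj (U x), IsUnit g ∧ e' x i = g • e x i := by
    intro x i
    obtain ⟨g, hg⟩ := (h.gen x i).exists_smul_of_unit le_rfl (e' x i)
    obtain ⟨f, hf⟩ := (h'.gen x i).exists_smul_of_unit le_rfl (e x i)
    rw [(L i).res_id] at hg hf
    refine ⟨g, IsUnit.of_mul_eq_one f ?_, hg⟩
    refine ((h'.gen x i).self.smul_inj (i := ()) (?_ : (_ : X.sheaf.obj (U x)) • e' x i = _))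
    rw [mul_smul, ← hf, ← hg, one_smul]
  choose u hu hue using hu
  refine OModule.nonempty_iso_of_basis hU (fun x i => u x i • b x i) b'
    (fun x => (h.basis x).unit_smul (hu x)) h'.basis ?_
  intro x y i j g hg
  obtain ⟨k, hk1, hk2⟩ := h.exists_trans x y i
  obtain ⟨k', hk1', hk2'⟩ := h'.exists_trans x y i
  rw [M.res_smul, M.res_smul, hk2, ← mul_smul, ← mul_smul] at hg
  rw [hue, hue, (L i).res_smul, (L i).res_smul, hk1, ← mul_smul, ← mul_smul] at hk1'
  have hk := (h.gen y i _ inf_le_right).smul_inj (i := ()) hk1'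
  -- Uniqueness of coefficients needs a nonzero one. If this coefficient vanishes, then so does `k`,
  -- the generator of `L i` is zero on the overlap, and `1 = 0` there.
  by_cases h0 : X.sheaf.res (inf_le_left : U x ⊓ U y ≤ U x) (u x i) * k = 0
  · have hk0 : k = 0 := by
      obtain ⟨v, hv⟩ := (hu x i).exists_right_inv
      calc k = X.sheaf.res inf_le_left (u x i * v) * k := by rw [hv, X.res_one, one_mul]
        _ = X.sheaf.res inf_le_left v * (X.sheaf.res inf_le_left (u x i) * k) := by
          rw [X.res_mul, mul_comm (X.sheaf.res _ (u x i)), mul_assoc]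
        _ = 0 := by rw [h0, mul_zero]
    rw [hk0, zero_smul] at hk1
    have h1 : (1 : X.sheaf.obj (U x ⊓ U y)) = 0 :=
      (h.gen x i _ inf_le_left).smul_inj (i := ()) (by rw [one_smul, zero_smul, hk1])
    exact eq_of_one_eq_zero h1 _ _
  · obtain ⟨rfl, h2⟩ := (h.basis y _ inf_le_right).unique h0 hg
    obtain ⟨v, hv⟩ := ((hu y i)).exists_right_inv
    have hv' := congrArg (X.sheaf.res (inf_le_right : U x ⊓ U y ≤ U y)) hv
    rw [X.res_mul, X.res_one] at hv'
    have : k' = g := by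
      rw [← mul_one k', ← mul_one g, ← hv', ← mul_assoc, ← hk, h2, mul_assoc]
    rw [hk2', this]

end DecompOn

namespace DecompOf

variable {M M' : OModule X} {ι κ : Type*} {L : ι → OModule X}

theorem nonempty_iso (h : DecompOf M L) (h' : DecompOf M' L) : Nonempty (M ≅ M') := by
  obtain ⟨U, hU, e, b, h⟩ := h
  obtain ⟨U', hU', e', b', h'⟩ := h'
  exact (h.mono (U' := fun x => U x ⊓ U' x) fun x => inf_le_left).nonempty_iso
    (fun x => ⟨hU x, hU' x⟩) (h'.mono fun x => inf_le_right)

theorem of_iso (h : DecompOf M L) (f : M ≅ M') : DecompOf M' L := by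
  obtain ⟨U, hU, e, b, h⟩ := h
  refine ⟨U, hU, e, _, h.gen, fun x => OModule.IsBasisOn.map_iso f (h.basis x),
    fun x y i g hg => ?_⟩
  rw [← OModule.Hom.map_res f.hom, ← OModule.Hom.map_res f.hom, h.trans x y i g hg,
    OModule.Hom.map_smul f.hom]

theorem reindex (h : DecompOf M L) (σ : κ ≃ ι) : DecompOf M (fun k => L (σ k)) := by
  obtain ⟨U, hU, e, b, h⟩ := h
  exact ⟨U, hU, fun x k => e x (σ k), fun x k => b x (σ k), fun x k => h.gen x (σ k),
    fun x => (h.basis x).comp_equiv σ, fun x y k => h.trans x y (σ k)⟩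

end DecompOf

end

/-! ### Generic points; bases of sheafifications, tensor products and inverse images -/

section

/-! ### Generic points -/

/-- `η` is a generic point of `X`, and the structure sheaf embeds into its stalk at `η`, in which
nonzero elements can be cancelled. -/
structure IsGeneric (X : MonoidalSpace.{u}) (η : X.carrier) : Prop where
  mem : ∀ {x : X.carrier} {V : Opens X.carrier}, x ∈ V → η ∈ V
  res_inj : ∀ {V W : Opens X.carrier} (h : V ≤ W), η ∈ V → Function.Injective (X.sheaf.res h)
  one_ne_zero : ∀ {V : Opens X.carrier}, η ∈ V → (1 : X.sheaf.obj V) ≠ 0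
  mul_left_cancel : ∀ {V : Opens X.carrier}, η ∈ V → ∀ {a b c : X.sheaf.obj V}, a ≠ 0 →
    a * b = a * c → b = c

variable {X : MonoidalSpace.{u}} {η : X.carrier}

namespace IsGeneric

theorem one_eq_zero_of_notMem (hη : IsGeneric X η) {V : Opens X.carrier} (h : η ∉ V) :
    (1 : X.sheaf.obj V) = 0 :=
  X.isSheaf.ext fun _ hx => (h (hη.mem hx)).elim

theorem res_ne_zero (hη : IsGeneric X η) {V W : Opens X.carrier} (h : V ≤ W) (hV : η ∈ V)
    {a : X.sheaf.obj W} (ha : a ≠ 0) : X.sheaf.res h a ≠ 0 := fun h0 =>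
  ha (hη.res_inj h hV (h0.trans (X.res_zero h).symm))

theorem mul_ne_zero (hη : IsGeneric X η) {V : Opens X.carrier} (hV : η ∈ V)
    {a b : X.sheaf.obj V} (ha : a ≠ 0) (hb : b ≠ 0) : a * b ≠ 0 := fun h =>
  hb (hη.mul_left_cancel hV ha (h.trans (mul_zero a).symm))

theorem ne_zero_of_isUnit (hη : IsGeneric X η) {V : Opens X.carrier} (hV : η ∈ V)
    {a : X.sheaf.obj V} (ha : IsUnit a) : a ≠ 0 := fun h => by
  obtain ⟨b, hb⟩ := ha.exists_right_inv
  rw [h, zero_mul] at hb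
  exact hη.one_ne_zero hV hb.symm

theorem nontrivial (hη : IsGeneric X η) {V : Opens X.carrier} (hV : η ∈ V) :
    Nontrivial (X.sheaf.obj V) := ⟨⟨1, 0, hη.one_ne_zero hV⟩⟩

/-- A family of sections of a sheaf is a basis if it is one locally. -/
theorem isBasisOn_of_local (hη : IsGeneric X η) {M : OModule X} {U : Opens X.carrier}
    {ι : Type*} {b : ι → M.obj U}
    (unique : ∀ V (h : V ≤ U), η ∈ V → ∀ (i j : ι) (a a' : X.sheaf.obj V), a ≠ 0 →
      a • M.res h (b i) = a' • M.res h (b j) → i = j ∧ a = a')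
    (span : ∀ V (h : V ≤ U) (m : M.obj V), η ∈ V → ∀ x ∈ V, ∃ (W : Opens X.carrier) (_ : x ∈ W)
      (hW : W ≤ V), M.res hW m = 0 ∨
        ∃ (i : ι) (a : X.sheaf.obj W), M.res hW m = a • M.res (hW.trans h) (b i)) :
    IsBasisOn M.toPreModule U b := by
  intro V h
  -- An open set without `η` is empty, and over it every module is trivial.
  by_cases hV : η ∈ V
  swap
  · have h1 := hη.one_eq_zero_of_notMem hV
    exact ⟨fun m => Or.inl (eq_of_one_eq_zero h1 _ _),
      fun ha _ => absurd (eq_of_one_eq_zero h1 _ _) ha⟩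
  refine ⟨fun m => ?_, fun {i j a a'} ha e => unique V h hV i j a a' ha e⟩
  choose W hxW hW H using span V h m hV
  have hηW : ∀ x hx, η ∈ W x hx := fun x hx => hη.mem (hxW x hx)
  have inj : ∀ V (h : V ≤ U), η ∈ V → ∀ i (a a' : X.sheaf.obj V),
      a • M.res h (b i) = a' • M.res h (b i) → a = a' := by
    intro V h hV i a a' e
    by_cases ha : a = 0
    · by_contra hne
      have ha' : a' ≠ 0 := fun h' => hne (ha.trans h'.symm)
      exact hne (unique V h hV i i a' a ha' e.symm).2.symm
    · exact (unique V h hV i i a a' ha e).2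
  -- An index that occurs with nonzero coefficient near one point occurs near all others: the two
  -- expressions of `m` are compared on the overlap, which contains `η`, so that nonzero
  -- coefficients stay nonzero.
  have key : ∀ x hx i (a : X.sheaf.obj (W x hx)), a ≠ 0 →
      M.res (hW x hx) m = a • M.res ((hW x hx).trans h) (b i) →
      ∀ y hy, ∃ a' : X.sheaf.obj (W y hy), a' ≠ 0 ∧
        M.res (hW y hy) m = a' • M.res ((hW y hy).trans h) (b i) := by
    intro x hx i a ha e y hy
    have hη' : η ∈ W x hx ⊓ W y hy := ⟨hηW _ _, hηW _ _⟩
    have e' := congrArg (M.res (inf_le_left : W x hx ⊓ W y hy ≤ _)) e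
    rw [M.res_smul, M.res_res, M.res_res] at e'
    have ha' := hη.res_ne_zero (inf_le_left : W x hx ⊓ W y hy ≤ _) hη' ha
    rcases H y hy with h0 | ⟨j, c, hc⟩
    · have h0' := congrArg (M.res (inf_le_right : W x hx ⊓ W y hy ≤ _)) h0
      rw [M.res_res, e', M.res_zero] at h0'
      exact absurd (inj _ _ hη' i _ 0 (h0'.trans (zero_smul _ _).symm)) ha'
    · have hc' := congrArg (M.res (inf_le_right : W x hx ⊓ W y hy ≤ _)) hc
      rw [M.res_res, e', M.res_smul, M.res_res] at hc'
      obtain ⟨rfl, hac⟩ := unique _ _ hη' i j _ _ ha' hc'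
      refine ⟨c, fun h0 => ha' ?_, hc⟩
      rw [hac, h0, X.res_zero]
  -- Either one index serves on all of `V`, and the unique coefficients glue, or `m` is zero locally
  -- and hence zero.
  by_cases hx : ∃ x hx i, ∃ a : X.sheaf.obj (W x hx), a ≠ 0 ∧
      M.res (hW x hx) m = a • M.res ((hW x hx).trans h) (b i)
  · obtain ⟨x, hx, i, a, ha, e⟩ := hx
    right
    choose c hc0 hc using key x hx i a ha e
    obtain ⟨t, ht⟩ := X.isSheaf.glue_of_mem W hxW hW c (by
      intro y hy z hz W' h1 h2
      by_cases hη' : η ∈ W'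
      · refine inj W' (h1.trans ((hW _ _).trans h)) hη' i _ _ ?_
        have e1 := congrArg (M.res h1) (hc y hy)
        have e2 := congrArg (M.res h2) (hc z hz)
        rw [M.res_smul, M.res_res, M.res_res] at e1 e2
        exact e1.symm.trans e2
      · exact eq_of_one_eq_zero (hη.one_eq_zero_of_notMem hη') _ _)
    refine ⟨i, t, M.isSheaf.ext fun y hy => ⟨W y hy, hxW _ _, hW _ _, ?_⟩⟩
    rw [M.res_smul, ht, M.res_res, hc]
  · left
    refine M.isSheaf.ext fun y hy => ⟨W y hy, hxW _ _, hW _ _, ?_⟩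
    rw [M.res_zero]
    rcases H y hy with h0 | ⟨i, c, hc⟩
    · exact h0
    · by_cases hc0 : c = 0
      · rw [hc, hc0, zero_smul]
      · exact absurd ⟨y, hy, i, c, hc0, hc⟩ hx

end IsGeneric

/-! ### Sheafification -/

namespace PreModule

variable (T : PreModule X)

/-- The section of the associated sheaf given by a section of `T`. -/
def toSheafify {U : Opens X.carrier} (t : T.obj U) : T.sheafify.obj U :=
  ⟨fun x => T.germ x.2 t, fun x => ⟨U, x.2, le_rfl, t, fun _ => rfl⟩⟩

theorem res_toSheafify {U V : Opens X.carrier} (h : V ≤ U) (t : T.obj U) :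
    T.sheafify.res h (T.toSheafify t) = T.toSheafify (T.res h t) :=
  Subtype.ext (funext fun x => (T.germ_res h x.2 t).symm)

theorem smul_toSheafify {U : Opens X.carrier} (a : X.sheaf.obj U) (t : T.obj U) :
    a • T.toSheafify t = T.toSheafify (a • t) :=
  Subtype.ext (funext fun x => by
    change T.stalkSMul x.2 a (T.germ x.2 t) = T.germ x.2 (a • t)
    rw [T.stalkSMul_germ x.2 le_rfl, X.sheaf.res_id])

theorem zero_toSheafify {U : Opens X.carrier} : (0 : T.sheafify.obj U) = T.toSheafify 0 := by
  rw [← zero_smul (X.sheaf.obj U) (0 : T.obj U), ← smul_toSheafify, zero_smul]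

theorem exists_res_eq_toSheafify {U : Opens X.carrier} (s : T.sheafify.obj U) {x : X.carrier}
    (hx : x ∈ U) : ∃ (V : Opens X.carrier) (_ : x ∈ V) (hV : V ≤ U) (t : T.obj V),
      T.sheafify.res hV s = T.toSheafify t := by
  obtain ⟨V, hxV, hV, t, ht⟩ := s.2 ⟨x, hx⟩
  exact ⟨V, hxV, hV, t, Subtype.ext (funext ht)⟩

theorem exists_res_eq_of_toSheafify_eq {U : Opens X.carrier} {s t : T.obj U}
    (h : T.toSheafify s = T.toSheafify t) {x : X.carrier} (hx : x ∈ U) :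
    ∃ (V : Opens X.carrier) (_ : x ∈ V) (hV : V ≤ U), T.res hV s = T.res hV t := by
  obtain ⟨W, hxW, h1, h2, e⟩ := Quotient.exact (congrFun (congrArg Subtype.val h) ⟨x, hx⟩)
  exact ⟨W, hxW, h1, e⟩

end PreModule

/-- Sections of the sheafification come locally from `T`, which gives local spanning. An equation
between them holds in `T` on a neighbourhood of `η`, where coefficients can be compared, and they
restrict injectively to it. -/
theorem IsBasisOn.toSheafify (hη : IsGeneric X η) {T : PreModule X} {U : Opens X.carrier}
    {ι : Type*} {b : ι → T.obj U} (hb : IsBasisOn T U b) :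
    IsBasisOn T.sheafify.toPreModule U (fun i => T.toSheafify (b i)) := by
  refine hη.isBasisOn_of_local (fun V h hV i j a a' ha e => ?_) (fun V h m hV x hx => ?_)
  · rw [T.res_toSheafify, T.res_toSheafify, T.smul_toSheafify, T.smul_toSheafify] at e
    obtain ⟨W, hW, hWV, e'⟩ := T.exists_res_eq_of_toSheafify_eq e hV
    rw [T.res_smul, T.res_smul, T.res_res, T.res_res] at e'
    obtain ⟨h1, h2⟩ := (hb W (hWV.trans h)).unique (hη.res_ne_zero hWV hW ha) e'
    exact ⟨h1, hη.res_inj hWV hW h2⟩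
  · obtain ⟨W, hxW, hWV, t, ht⟩ := T.exists_res_eq_toSheafify m hx
    refine ⟨W, hxW, hWV, ?_⟩
    rw [ht]
    refine ((hb W (hWV.trans h)).span t).imp (fun h0 => ?_) ?_
    · rw [h0, T.zero_toSheafify]
    · rintro ⟨i, a, rfl⟩
      exact ⟨i, a, by rw [T.res_toSheafify, T.smul_toSheafify]⟩

/-! ### Bases of tensor products -/

section TensorSet

variable {A M N : Type u} {ι κ : Type*} [CommMonoidWithZero A] [Zero M] [Zero N]
  [MulActionWithZero A M] [MulActionWithZero A N]

/-- The class of `(m, n)` in the tensor product. -/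
def TensorSet.mk (A : Type u) {M N : Type u} [CommMonoidWithZero A] [Zero M] [Zero N]
    [MulActionWithZero A M] [MulActionWithZero A N] (m : M) (n : N) :
    OModule.TensorSet A M N := Quot.mk _ (m, n)

theorem TensorSet.smul_mk (a : A) (m : M) (n : N) :
    a • TensorSet.mk A m n = TensorSet.mk A (a • m) n := rfl

theorem TensorSet.mk_smul (a : A) (m : M) (n : N) :
    TensorSet.mk A m (a • n) = TensorSet.mk A (a • m) n :=
  (Quot.sound (OModule.TensorRel.intro a m n)).symm

/-- The product of a coordinate function of `M` and one of `N` respects the relation of the tensor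
product and serves as a coordinate function there. -/
theorem IsSetBasis.tensor {e : ι → M} {f : κ → N} (he : IsSetBasis A e) (hf : IsSetBasis A f) :
    IsSetBasis A (fun p : ι × κ => TensorSet.mk A (e p.1) (f p.2)) := by
  refine .of_coord ?_ ?_
  · rintro ⟨m, n⟩
    change TensorSet.mk A m n = TensorSet.mk A 0 0 ∨ ∃ i a, TensorSet.mk A m n = _
    rcases he.span m with rfl | ⟨i, a, rfl⟩
    · left
      rw [← zero_smul A (0 : M), ← TensorSet.mk_smul, ← TensorSet.mk_smul, zero_smul, zero_smul]
    · rcases hf.span n with rfl | ⟨j, b, rfl⟩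
      · left
        rw [← zero_smul A (0 : N), TensorSet.mk_smul, TensorSet.mk_smul, zero_smul, zero_smul]
      · right
        exact ⟨(i, j), b * a, by
          rw [TensorSet.mk_smul, TensorSet.smul_mk, ← mul_smul]⟩
  · rintro ⟨i, j⟩
    obtain ⟨c, hc, hc1, hc0⟩ := he.exists_coord i
    obtain ⟨d, hd, hd1, hd0⟩ := hf.exists_coord j
    refine ⟨Quot.lift (fun p => c p.1 * d p.2) ?_, ?_, ?_, ?_⟩
    · rintro _ _ ⟨a, m, n⟩
      change c (a • m) * d n = c m * d (a • n)
      rw [hc, hd, mul_left_comm, mul_assoc]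
    · rintro a ⟨m, n⟩
      change c (a • m) * d n = a * (c m * d n)
      rw [hc, mul_assoc]
    · change c (e i) * d (f j) = 1
      rw [hc1, hd1, one_mul]
    · rintro ⟨i', j'⟩ h
      change c (e i') * d (f j') = 0
      by_cases hi : i' = i
      · rw [hd0 j' (fun hj => h (by rw [hi, hj])), mul_zero]
      · rw [hc0 i' hi, zero_mul]

end TensorSet

namespace OModule

variable {M N : OModule X}

/-- The section `m ⊗ n` of the tensor product. -/
def tmul {U : Opens X.carrier} (m : M.obj U) (n : N.obj U) : (M.tensor N).obj U :=
  (preTensor M N).toSheafify (TensorSet.mk _ m n)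

theorem res_tmul {U V : Opens X.carrier} (h : V ≤ U) (m : M.obj U) (n : N.obj U) :
    (M.tensor N).res h (tmul m n) = tmul (M.res h m) (N.res h n) :=
  (preTensor M N).res_toSheafify h _

theorem smul_tmul_smul {U : Opens X.carrier} (a b : X.sheaf.obj U) (m : M.obj U) (n : N.obj U) :
    tmul (a • m) (b • n) = (a * b) • tmul m n := by
  refine Eq.trans (congrArg (preTensor M N).toSheafify ?_)
    ((preTensor M N).smul_toSheafify (a * b) (TensorSet.mk _ m n)).symm
  rw [TensorSet.mk_smul, smul_smul, mul_comm b a]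
  rfl

end OModule

theorem IsBasisOn.tensor (hη : IsGeneric X η) {M N : OModule X} {U : Opens X.carrier}
    {ι κ : Type*} {b : ι → M.obj U} {c : κ → N.obj U} (hb : IsBasisOn M.toPreModule U b)
    (hc : IsBasisOn N.toPreModule U c) :
    IsBasisOn (M.tensor N).toPreModule U
      (fun p : ι × κ => OModule.tmul (b p.1) (c p.2)) := by
  refine IsBasisOn.toSheafify hη (T := OModule.preTensor M N)
    (b := fun p : ι × κ => TensorSet.mk _ (b p.1) (c p.2)) fun V h => ?_
  exact (hb V h).tensor (hc V h)

/-- Transition functions of a tensor product are the products of those of the factors, for the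
modules and for their constituents alike. -/
theorem DecompOf.tensor (hη : IsGeneric X η) {M N : OModule X} {ι κ : Type*} {L : ι → OModule X}
    {L' : κ → OModule X} (h : DecompOf M L) (h' : DecompOf N L') :
    DecompOf (M.tensor N) (fun p : ι × κ => (L p.1).tensor (L' p.2)) := by
  obtain ⟨U, hU, e, b, h⟩ := h
  obtain ⟨U', hU', e', b', h'⟩ := h'
  replace h := h.mono (U' := fun x => U x ⊓ U' x) fun x => inf_le_left
  replace h' := h'.mono (U' := fun x => U x ⊓ U' x) fun x => inf_le_right
  refine ⟨fun x => U x ⊓ U' x, fun x => Set.mem_inter (hU x) (hU' x),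
    fun x p => OModule.tmul ((L p.1).res inf_le_left (e x p.1))
      ((L' p.2).res inf_le_right (e' x p.2)),
    fun x p => OModule.tmul (M.res inf_le_left (b x p.1)) (N.res inf_le_right (b' x p.2)),
    DecompOn.of_exists (fun x p => ?_)
    (fun x => (h.basis x).tensor hη (h'.basis x)) (fun x y p => ?_)⟩
  · exact (h.gen x p.1).tensor hη (h'.gen x p.2) |>.comp_equiv
      (⟨fun _ => ((), ()), fun _ => (), fun _ => rfl, fun _ => rfl⟩ : Unit ≃ Unit × Unit)
  · obtain ⟨g, hg1, hg2⟩ := h.exists_trans x y p.1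
    obtain ⟨g', hg1', hg2'⟩ := h'.exists_trans x y p.2
    refine ⟨g * g', ?_, ?_⟩
    · rw [OModule.res_tmul, OModule.res_tmul, hg1, hg1', OModule.smul_tmul_smul]
    · rw [OModule.res_tmul, OModule.res_tmul, hg2, hg2', OModule.smul_tmul_smul]

/-! ### Bases of inverse images -/

section Pullback

variable {Y : MonoidalSpace.{u}} (φ : SchemeHom X Y) (M : OModule Y)

theorem PullbackSet.mk_res {U : Opens X.carrier} {V V' : Opens Y.carrier} (h : V' ≤ V)
    (hV : U ≤ V'.comap φ.base) (m : M.obj V) (a : X.sheaf.obj U) :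
    PullbackSet.mk φ M V (hV.trans (Opens.comap_mono φ.base h)) m a =
      PullbackSet.mk φ M V' hV (M.res h m) a :=
  Quot.sound (.res V V' h hV m a)

theorem PullbackSet.mk_smul {U : Opens X.carrier} {V : Opens Y.carrier}
    (hV : U ≤ V.comap φ.base) (b : Y.sheaf.obj V) (m : M.obj V) (a : X.sheaf.obj U) :
    PullbackSet.mk φ M V hV (b • m) a =
      PullbackSet.mk φ M V hV m (X.sheaf.res hV (φ.app V b) * a) :=
  Quot.sound (.smul V hV b m a)

theorem PullbackSet.smul_mk {U : Opens X.carrier} {V : Opens Y.carrier}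
    (hV : U ≤ V.comap φ.base) (m : M.obj V) (a c : X.sheaf.obj U) :
    c • PullbackSet.mk φ M V hV m a = PullbackSet.mk φ M V hV m (c * a) := rfl

theorem PullbackSet.mk_zero {U : Opens X.carrier} {V : Opens Y.carrier}
    (hV : U ≤ V.comap φ.base) (a : X.sheaf.obj U) :
    PullbackSet.mk φ M V hV 0 a = 0 := by
  rw [← zero_smul (Y.sheaf.obj V) (0 : M.obj V), PullbackSet.mk_smul, map_zero, X.res_zero,
    ← PullbackSet.smul_mk, zero_smul]

variable {φ} in
theorem le_comap_inf {U : Opens X.carrier} {V W : Opens Y.carrier} (hV : U ≤ V.comap φ.base)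
    (hW : U ≤ W.comap φ.base) : U ≤ (V ⊓ W).comap φ.base := le_inf hV hW

/-- A symbol `m ⊗ a` may be restricted to `V ⊓ W`, where `m` is zero or a multiple of a basis
element, and the coefficient moves to the right factor. Coordinate functions of `b` give coordinate
functions of the symbols. -/
theorem IsSetBasis.pullbackSet {W : Opens Y.carrier} {ι : Type*} {b : ι → M.obj W}
    (hb : IsBasisOn M.toPreModule W b) {U : Opens X.carrier} (hU : U ≤ W.comap φ.base) :
    IsSetBasis (X.sheaf.obj U) (fun i => PullbackSet.mk φ M W hU (b i) 1) := by
  classical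
  refine .of_coord ?_ fun i => ?_
  · rintro ⟨V, hV, m, a⟩
    have hVW : U ≤ (V ⊓ W).comap φ.base := le_inf hV hU
    change PullbackSet.mk φ M V hV m a = 0 ∨ ∃ i c, PullbackSet.mk φ M V hV m a = _
    have e : PullbackSet.mk φ M V hV m a = PullbackSet.mk φ M (V ⊓ W) hVW (M.res inf_le_left m) a :=
      PullbackSet.mk_res φ M inf_le_left hVW m a
    rcases (hb (V ⊓ W) inf_le_right).span (M.res inf_le_left m) with h | ⟨i, c, h⟩
    · left
      rw [e, h, PullbackSet.mk_zero]
    · right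
      refine ⟨i, X.sheaf.res hVW (φ.app _ c) * a, ?_⟩
      have e' : PullbackSet.mk φ M W hU (b i) 1 =
          PullbackSet.mk φ M (V ⊓ W) hVW (M.res inf_le_right (b i)) 1 :=
        PullbackSet.mk_res φ M inf_le_right hVW _ _
      rw [e, h, PullbackSet.mk_smul, e', PullbackSet.smul_mk, mul_one]
  · obtain ⟨l, hl⟩ := hb.exists_localHom (T' := (OModule.structureModule Y).toPreModule)
      (fun j => (if j = i then 1 else 0 : Y.sheaf.obj W))
    have hl' : ∀ j, l.app W le_rfl (b j) = (if j = i then 1 else 0 : Y.sheaf.obj W) := fun j => by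
      have := hl W le_rfl j
      rw [M.res_id] at this
      exact this.trans (SetPresheaf.res_id _ _ _)
    obtain ⟨f, hf, hf_smul, hf_res⟩ : ∃ f : ∀ V, V ≤ W → M.obj V → Y.sheaf.obj V,
        (∀ j, f W le_rfl (b j) = if j = i then 1 else 0) ∧
        (∀ V h (a : Y.sheaf.obj V) m, f V h (a • m) = a * f V h m) ∧
        ∀ V V' (h : V ≤ W) (h' : V' ≤ V) m,
          f V' (h'.trans h) (M.res h' m) = Y.sheaf.res h' (f V h m) :=
      ⟨l.app, hl', l.map_smul, fun V V' h h' m => l.map_res h h' m⟩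
    -- The coordinate `f` is defined only inside `W`, so `m` is first restricted to `V ⊓ W`, whose
    -- preimage still contains `U`.
    let c : PullbackSymbol φ M U → X.sheaf.obj U := fun s =>
      X.sheaf.res (le_comap_inf s.le hU)
        (φ.app (s.V ⊓ W) (f (s.V ⊓ W) inf_le_right (M.res inf_le_left s.m))) * s.a
    have hcW : ∀ m a, c ⟨W, hU, m, a⟩ = X.sheaf.res hU (φ.app W (f W le_rfl m)) * a := by
      intro m a
      change X.sheaf.res (le_comap_inf hU hU) (φ.app _ (f (W ⊓ W) (inf_le_left.trans le_rfl)
        (M.res inf_le_left m))) * a = _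
      rw [hf_res, φ.app_res, X.sheaf.res_res]
    refine ⟨Quot.lift c ?_, ?_, ?_, ?_⟩
    · rintro _ _ (⟨V, V', h', hV, m, a⟩ | ⟨V, hV, d, m, a⟩)
      · change X.sheaf.res (le_comap_inf (hV.trans (Opens.comap_mono φ.base h')) hU)
            (φ.app _ (f (V ⊓ W) inf_le_right (M.res inf_le_left m))) * a =
          X.sheaf.res (le_comap_inf hV hU) (φ.app _ (f (V' ⊓ W) inf_le_right
            (M.res inf_le_left (M.res h' m)))) * a
        have : M.res (inf_le_left : V' ⊓ W ≤ V') (M.res h' m) =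
            M.res (inf_le_inf_right W h' : V' ⊓ W ≤ V ⊓ W) (M.res inf_le_left m) := by
          rw [M.res_res, M.res_res]
        rw [this, hf_res _ _ inf_le_right (inf_le_inf_right W h'), φ.app_res, X.sheaf.res_res]
      · change X.sheaf.res (le_comap_inf hV hU) (φ.app _ (f (V ⊓ W) inf_le_right
            (M.res inf_le_left (d • m)))) * a =
          X.sheaf.res (le_comap_inf hV hU) (φ.app _ (f (V ⊓ W) inf_le_right
            (M.res inf_le_left m))) * (X.sheaf.res hV (φ.app V d) * a)
        rw [M.res_smul, hf_smul, map_mul, X.res_mul, φ.app_res, X.sheaf.res_res, mul_assoc,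
          mul_left_comm]
    · rintro a ⟨V, hV, m, a'⟩
      exact mul_left_comm _ _ _
    · change c ⟨W, hU, b i, 1⟩ = 1
      rw [hcW, hf, if_pos rfl, map_one, X.res_one, one_mul]
    · intro j hj
      change c ⟨W, hU, b j, 1⟩ = 0
      rw [hcW, hf, if_neg hj, map_zero, X.res_zero, zero_mul]

/-- The section `φ^* m` of the inverse image. -/
def pullbackSection {U : Opens X.carrier} {V : Opens Y.carrier} (h : U ≤ V.comap φ.base)
    (m : M.obj V) : (pullback φ M).obj U :=
  (prePullback φ M).toSheafify (PullbackSet.mk φ M V h m 1)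

variable {M}

theorem res_pullbackSection {U U' : Opens X.carrier} {V V' : Opens Y.carrier}
    (hU : U' ≤ U) (hV : V' ≤ V) (h : U ≤ V.comap φ.base) (h' : U' ≤ V'.comap φ.base)
    (m : M.obj V) :
    (pullback φ M).res hU (pullbackSection φ M h m) = pullbackSection φ M h' (M.res hV m) := by
  refine ((prePullback φ M).res_toSheafify hU _).trans (congrArg _ ?_)
  refine Eq.trans ?_ (PullbackSet.mk_res φ M hV h' m 1)
  exact congrArg (PullbackSet.mk φ M V _ m) (X.res_one hU)

theorem pullbackSection_smul {U : Opens X.carrier} {V : Opens Y.carrier}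
    (h : U ≤ V.comap φ.base) (b : Y.sheaf.obj V) (m : M.obj V) :
    pullbackSection φ M h (b • m) =
      X.sheaf.res h (φ.app V b) • pullbackSection φ M h m := by
  refine Eq.trans (congrArg (prePullback φ M).toSheafify ?_)
    ((prePullback φ M).smul_toSheafify _ (PullbackSet.mk φ M V h m 1)).symm
  exact PullbackSet.mk_smul φ M h b m 1

theorem IsBasisOn.pullback (hη : IsGeneric X η) {W : Opens Y.carrier} {ι : Type*}
    {b : ι → M.obj W} (hb : IsBasisOn M.toPreModule W b) {U : Opens X.carrier}
    (hU : U ≤ W.comap φ.base) :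
    IsBasisOn (pullback φ M).toPreModule U (fun i => pullbackSection φ M hU (b i)) := by
  refine IsBasisOn.toSheafify hη (T := prePullback φ M) fun V h => ?_
  have := IsSetBasis.pullbackSet φ M hb (h.trans hU)
  refine (congrArg (IsSetBasis (X.sheaf.obj V)) (funext fun i => ?_)).mpr this
  exact congrArg (PullbackSet.mk φ M W _ (b i)) (X.res_one h)

/-- The images under `φ` of the transition functions on `Y` are transition functions on `X`, with
respect to the preimage cover. -/
theorem DecompOf.pullback (hη : IsGeneric X η) {ι : Type*} {L : ι → OModule Y}
    (h : DecompOf M L) : DecompOf (pullback φ M) (fun i => pullback φ (L i)) := by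
  obtain ⟨U, hU, e, b, h⟩ := h
  refine ⟨fun x => (U (φ.base x)).comap φ.base, fun x => hU _,
    fun x i => pullbackSection φ (L i) le_rfl (e _ i),
    fun x i => pullbackSection φ M le_rfl (b _ i),
    DecompOn.of_exists (fun x i => (h.gen _ i).pullback φ hη le_rfl)
      (fun x => (h.basis _).pullback φ hη le_rfl) fun x y i => ?_⟩
  obtain ⟨g, hg, hg'⟩ := h.exists_trans (φ.base x) (φ.base y) i
  have hle : (U (φ.base x)).comap φ.base ⊓ (U (φ.base y)).comap φ.base ≤
    (U (φ.base x) ⊓ U (φ.base y)).comap φ.base := le_comap_inf inf_le_left inf_le_right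
  refine ⟨X.sheaf.res hle (φ.app _ g), ?_, ?_⟩
  · rw [res_pullbackSection φ inf_le_left inf_le_left le_rfl hle,
      res_pullbackSection φ inf_le_right inf_le_right le_rfl hle, hg, pullbackSection_smul]
  · rw [res_pullbackSection φ inf_le_left inf_le_left le_rfl hle,
      res_pullbackSection φ inf_le_right inf_le_right le_rfl hle, hg', pullbackSection_smul]

end Pullback

end

/-! ### Spectra of integral monoids; projective sets are free -/

section

/-! ### Spectra -/

section Spec

variable {A : Type u} [CommMonoidWithZero A] {N : Type u} [Zero N] [MulActionWithZero A N]

theorem PrimeSpec.nontrivial (p : PrimeSpec A) : Nontrivial A :=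
  ⟨⟨1, 0, fun h => p.one_notMem (h ▸ p.zero_mem)⟩⟩

/-- Each generating set `D_f` is stable under passing to smaller primes. Consequently the nonunits
lie in no open set but the whole spectrum, and the zero ideal of an integral monoid lies in every
nonempty one. -/
theorem PrimeSpec.mem_of_subset {p q : PrimeSpec A} (h : p.carrier ⊆ q.carrier)
    {V : Opens (PrimeSpec A)} (hq : q ∈ V) : p ∈ V := by
  obtain ⟨V, hV⟩ := V
  change q ∈ V at hq
  change p ∈ V
  induction hV with
  | basic s hs =>
    obtain ⟨f, rfl⟩ := hs
    exact fun hf => hq (h hf)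
  | univ => trivial
  | inter s t _ _ hs ht => exact ⟨hs hq.1, ht hq.2⟩
  | sUnion S _ ih =>
    obtain ⟨s, hs, hqs⟩ := hq
    exact ⟨s, hs, ih s hs hqs⟩

/-- The prime ideal of all nonunits. -/
def PrimeSpec.nonunits (A : Type u) [CommMonoidWithZero A] [Nontrivial A] : PrimeSpec A where
  carrier := {a | ¬ IsUnit a}
  zero_mem := not_isUnit_zero
  mul_mem a b hb h := hb (isUnit_of_mul_isUnit_right h)
  one_notMem h := h isUnit_one
  mem_or_mem {a b} h := by
    by_contra hab
    obtain ⟨h1, h2⟩ := not_or.1 hab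
    exact h ((not_not.1 h1).mul (not_not.1 h2))

theorem PrimeSpec.subset_nonunits [Nontrivial A] (p : PrimeSpec A) :
    p.carrier ⊆ (PrimeSpec.nonunits A).carrier := by
  rintro a ha ⟨u, rfl⟩
  apply p.one_notMem
  rw [← u.inv_mul]
  exact p.mul_mem _ ha

/-- The zero ideal of an integral monoid. -/
def PrimeSpec.zero (A : Type u) [CommMonoidWithZero A] [IsCancelMulZero A] [Nontrivial A] :
    PrimeSpec A where
  carrier := {0}
  zero_mem := rfl
  mul_mem a b hb := by
    rw [Set.mem_singleton_iff.1 hb, mul_zero]; rfl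
  one_notMem h := one_ne_zero h
  mem_or_mem {a b} h := mul_eq_zero.1 h

theorem PrimeSpec.zero_subset [IsCancelMulZero A] [Nontrivial A] (p : PrimeSpec A) :
    (PrimeSpec.zero A).carrier ⊆ p.carrier := by
  rintro _ rfl
  exact p.zero_mem

/-- The open set on which `f` does not vanish. -/
def PrimeSpec.basicOpen (f : A) : Opens (PrimeSpec A) :=
  ⟨{p | f ∉ p.carrier}, isOpen_generateFrom_of_mem ⟨f, rfl⟩⟩

/-- The section `n / f` of the module associated with `N`. -/
def tildeFrac {W : Opens (Spec A).carrier} (n : N) (f : A) (h : ∀ q ∈ W, f ∉ q.carrier) :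
    (tilde A N).obj W :=
  ⟨fun q => OreLocalization.oreDiv n (⟨f, h q.1 q.2⟩ : q.1.compl),
    fun p => ⟨W, p.2, le_rfl, n, f, fun q => ⟨h q.1 q.2, rfl⟩⟩⟩

/-- The section `a / f` of the structure sheaf. -/
def specFrac {W : Opens (Spec A).carrier} (a f : A) (h : ∀ q ∈ W, f ∉ q.carrier) :
    (Spec A).sheaf.obj W := tildeFrac a f h

/-- The section `n / 1`. -/
def tildeConst (W : Opens (Spec A).carrier) (n : N) : (tilde A N).obj W :=
  tildeFrac n 1 (fun q _ => q.one_notMem)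

/-- The section `a / 1`. -/
def specConst (W : Opens (Spec A).carrier) (a : A) : (Spec A).sheaf.obj W :=
  specFrac a 1 (fun q _ => q.one_notMem)

theorem res_tildeConst {V W : Opens (Spec A).carrier} (hW : W ≤ V) (n : N) :
    (tilde A N).res hW (tildeConst V n) = tildeConst W n := rfl

/-- The formula is given for every `W'` inside `W`, so that several sections can be written as
fractions on a common intersection. -/
theorem exists_res_eq_tildeFrac {V : Opens (Spec A).carrier} (s : (tilde A N).obj V)
    {p : PrimeSpec A} (hp : p ∈ V) : ∃ (W : Opens (Spec A).carrier) (_ : p ∈ W) (_ : W ≤ V)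
      (n : N) (f : A) (h : ∀ q ∈ W, f ∉ q.carrier), ∀ W' (hW : W' ≤ W) (hV : W' ≤ V),
        (tilde A N).res hV s = tildeFrac n f (fun q hq => h q (hW hq)) := by
  obtain ⟨W, hpW, hW, n, f, h⟩ := s.2 ⟨p, hp⟩
  exact ⟨W, hpW, hW, n, f, fun q hq => (h ⟨q, hq⟩).1, fun W' hW' _ =>
    Subtype.ext (funext fun q => (h ⟨q.1, hW' q.2⟩).2)⟩

theorem exists_res_eq_specFrac {V : Opens (Spec A).carrier} (s : (Spec A).sheaf.obj V)
    {p : PrimeSpec A} (hp : p ∈ V) : ∃ (W : Opens (Spec A).carrier) (_ : p ∈ W) (_ : W ≤ V)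
      (a f : A) (h : ∀ q ∈ W, f ∉ q.carrier), ∀ W' (hW : W' ≤ W) (hV : W' ≤ V),
        (Spec A).sheaf.res hV s = specFrac a f (fun q hq => h q (hW hq)) :=
  exists_res_eq_tildeFrac (N := A) s hp

theorem specFrac_smul {W : Opens (Spec A).carrier} (a f : A) (h : ∀ q ∈ W, f ∉ q.carrier) (n : N)
    (g : A) (h' : ∀ q ∈ W, g ∉ q.carrier) :
    specFrac a f h • tildeFrac n g h' =
      tildeFrac (a • n) (f * g) (fun q hq hfg => (q.mem_or_mem hfg).elim (h q hq) (h' q hq)) :=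
  Subtype.ext (funext fun q => oreDiv_smul_oreDiv q.1.compl N a n _ _)

theorem specFrac_mul {W : Opens (Spec A).carrier} (a f : A) (h : ∀ q ∈ W, f ∉ q.carrier) (b : A)
    (g : A) (h' : ∀ q ∈ W, g ∉ q.carrier) :
    specFrac a f h * specFrac b g h' =
      specFrac (a * b) (f * g) (fun q hq hfg => (q.mem_or_mem hfg).elim (h q hq) (h' q hq)) :=
  specFrac_smul (N := A) a f h b g h'

theorem oreDiv_eq_oreDiv_iff {S : Submonoid A} {n n' : N} {s s' : S} :
    OreLocalization.oreDiv n s = OreLocalization.oreDiv n' s' ↔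
      ∃ t ∈ S, t • (s' : A) • n = t • (s : A) • n' := by
  rw [OreLocalization.oreDiv_eq_iff]
  constructor
  · rintro ⟨u, v, h1, h2⟩
    refine ⟨u, u.2, ?_⟩
    rw [Submonoid.smul_def] at h1
    rw [smul_smul, h2, mul_smul, smul_comm v, ← h1, smul_comm]
  · rintro ⟨t, ht, h⟩
    refine ⟨⟨t, ht⟩ * s, t * s', ?_, ?_⟩
    · rw [Submonoid.smul_def, mul_smul, h]
      exact mul_smul _ _ _
    · change t * s * s' = t * s' * s
      rw [mul_right_comm]

theorem tildeFrac_congr {W : Opens (Spec A).carrier} {n n' : N} {f f' : A}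
    {h : ∀ q ∈ W, f ∉ q.carrier} {h' : ∀ q ∈ W, f' ∉ q.carrier} (e : f' • n = f • n') :
    tildeFrac n f h = tildeFrac n' f' h' :=
  Subtype.ext (funext fun q => oreDiv_eq_oreDiv_iff.2 ⟨1, one_mem _, by
    rw [one_smul, one_smul]; exact e⟩)

theorem specFrac_congr {W : Opens (Spec A).carrier} {a a' f f' : A}
    {h : ∀ q ∈ W, f ∉ q.carrier} {h' : ∀ q ∈ W, f' ∉ q.carrier} (e : f' * a = f * a') :
    specFrac a f h = specFrac a' f' h' := tildeFrac_congr e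

theorem exists_of_tildeFrac_eq {W : Opens (Spec A).carrier} {n n' : N} {f f' : A}
    {h : ∀ q ∈ W, f ∉ q.carrier} {h' : ∀ q ∈ W, f' ∉ q.carrier}
    (e : tildeFrac n f h = tildeFrac n' f' h') {q : PrimeSpec A} (hq : q ∈ W) :
    ∃ t ∉ q.carrier, t • f' • n = t • f • n' :=
  oreDiv_eq_oreDiv_iff.1 (congrFun (congrArg Subtype.val e) ⟨q, hq⟩)

theorem one_eq_specConst (W : Opens (Spec A).carrier) : 1 = specConst W (1 : A) :=
  Subtype.ext (funext fun _ => OreLocalization.one_def)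

theorem zero_eq_tildeConst (W : Opens (Spec A).carrier) : 0 = tildeConst W (0 : N) :=
  Subtype.ext (funext fun _ => OreLocalization.zero_def)

theorem zero_eq_specConst (W : Opens (Spec A).carrier) : 0 = specConst W (0 : A) :=
  zero_eq_tildeConst (N := A) W

theorem isUnit_specConst {W : Opens (Spec A).carrier} {g : A} (h : ∀ q ∈ W, g ∉ q.carrier) :
    IsUnit (specConst W g) := by
  refine IsUnit.of_mul_eq_one (specFrac (1 : A) g h) ?_
  rw [specConst, specFrac_mul, one_eq_specConst]
  exact specFrac_congr (by simp)

theorem tildeConst_smul {W : Opens (Spec A).carrier} (a : A) (n : N) :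
    tildeConst W (a • n) = specConst W a • tildeConst W n := by
  rw [specConst, tildeConst, tildeConst, specFrac_smul]
  exact tildeFrac_congr (by simp)

theorem specConst_smul_tildeFrac {W : Opens (Spec A).carrier} (n : N) {f : A}
    (h : ∀ q ∈ W, f ∉ q.carrier) : specConst W f • tildeFrac n f h = tildeConst W n := by
  rw [specConst, tildeConst, specFrac_smul]
  exact tildeFrac_congr (by simp)

section Integral

variable [IsCancelMulZero A]

theorem mul_eq_mul_of_specFrac_eq {W : Opens (Spec A).carrier} {a a' f f' : A}
    {h : ∀ q ∈ W, f ∉ q.carrier} {h' : ∀ q ∈ W, f' ∉ q.carrier}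
    (e : specFrac a f h = specFrac a' f' h') {q : PrimeSpec A} (hq : q ∈ W) :
    f' * a = f * a' := by
  obtain ⟨t, ht, e⟩ := exists_of_tildeFrac_eq (N := A) e hq
  have ht0 : t ≠ 0 := by
    rintro rfl
    exact ht q.zero_mem
  exact mul_left_cancel₀ ht0 e

variable [Nontrivial A]

/-- Equality of two fractions at the zero ideal is an identity in `A`, by cancellation, and so makes
them equal wherever both are defined. -/
theorem Spec.res_injective {V W : Opens (Spec A).carrier} (h : V ≤ W) (hV : PrimeSpec.zero A ∈ V) :
    Function.Injective ((Spec A).sheaf.res h) := by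
  intro s t hst
  refine (Spec A).isSheaf.ext fun p hp => ?_
  obtain ⟨W₁, hp₁, h₁, a, f, hf, e⟩ := exists_res_eq_specFrac s hp
  obtain ⟨W₂, hp₂, h₂, b, g, hg, e'⟩ := exists_res_eq_specFrac t hp
  refine ⟨W₁ ⊓ W₂, ⟨hp₁, hp₂⟩, inf_le_left.trans h₁, ?_⟩
  have hz : PrimeSpec.zero A ∈ V ⊓ (W₁ ⊓ W₂) :=
    ⟨hV, PrimeSpec.mem_of_subset (V := W₁) p.zero_subset hp₁,
      PrimeSpec.mem_of_subset (V := W₂) p.zero_subset hp₂⟩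
  rw [e _ inf_le_left, e' _ inf_le_right]
  have e₃ := congrArg ((Spec A).sheaf.res (inf_le_left : V ⊓ (W₁ ⊓ W₂) ≤ V)) hst
  rw [SetPresheaf.res_res, SetPresheaf.res_res, e _ (inf_le_right.trans inf_le_left),
    e' _ (inf_le_right.trans inf_le_right)] at e₃
  exact specFrac_congr (mul_eq_mul_of_specFrac_eq e₃ hz)

/-- Identities between sections become identities between numerators and denominators in `A`, where
nonzero elements cancel. -/
theorem isGeneric_zero : IsGeneric (Spec A) (PrimeSpec.zero A) where
  mem {x V} hx := PrimeSpec.mem_of_subset (V := V) x.zero_subset hx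
  res_inj := Spec.res_injective
  one_ne_zero {V} hV h := by
    rw [one_eq_specConst, zero_eq_specConst] at h
    have := mul_eq_mul_of_specFrac_eq h hV
    rw [one_mul, one_mul] at this
    exact one_ne_zero this
  mul_left_cancel {V} hV a b c ha h := by
    refine (Spec A).isSheaf.ext fun p hp => ?_
    obtain ⟨W₁, hp₁, h₁, α, f, hf, e₁⟩ := exists_res_eq_specFrac a hp
    obtain ⟨W₂, hp₂, h₂, β, g, hg, e₂⟩ := exists_res_eq_specFrac b hp
    obtain ⟨W₃, hp₃, h₃, γ, k, hk, e₃⟩ := exists_res_eq_specFrac c hp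
    have l₂ : W₁ ⊓ (W₂ ⊓ W₃) ≤ W₂ := inf_le_right.trans inf_le_left
    have l₃ : W₁ ⊓ (W₂ ⊓ W₃) ≤ W₃ := inf_le_right.trans inf_le_right
    have hpW : p ∈ W₁ ⊓ (W₂ ⊓ W₃) := ⟨hp₁, hp₂, hp₃⟩
    refine ⟨_, hpW, inf_le_left.trans h₁, ?_⟩
    have e := congrArg ((Spec A).sheaf.res
      (inf_le_left.trans h₁ : W₁ ⊓ (W₂ ⊓ W₃) ≤ V)) h
    rw [(Spec A).res_mul, (Spec A).res_mul, e₁ _ inf_le_left, e₂ _ l₂, e₃ _ l₃, specFrac_mul,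
      specFrac_mul] at e
    rw [e₂ _ l₂, e₃ _ l₃]
    have hα : α ≠ 0 := by
      rintro rfl
      refine ha (Spec.res_injective h₁ (PrimeSpec.mem_of_subset (V := W₁) p.zero_subset hp₁) ?_)
      rw [e₁ _ le_rfl, (Spec A).res_zero, zero_eq_specConst]
      exact specFrac_congr (by simp)
    refine specFrac_congr (mul_left_cancel₀ hα (mul_left_cancel₀ (?_ : f ≠ 0) ?_))
    · rintro rfl
      exact hf p hp₁ p.zero_mem
    · have := mul_eq_mul_of_specFrac_eq e hpW
      calc f * (α * (k * β)) = f * k * (α * β) := by ac_rfl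
        _ = f * g * (α * γ) := this
        _ = f * (α * (g * γ)) := by ac_rfl

/-- A basis of `N` over `A` is a basis of the associated module. -/
theorem IsSetBasis.tilde {ι : Type*} {e : ι → N} (he : IsSetBasis A e) :
    IsBasisOn (tilde A N).toPreModule ⊤ (fun i => tildeConst ⊤ (e i)) := by
  refine isGeneric_zero.isBasisOn_of_local (fun V h hV i j a b ha e' => ?_)
    (fun V h m hV p hp => ?_)
  · obtain ⟨W₁, hz₁, h₁, α, f, hf, e₁⟩ := exists_res_eq_specFrac a hV
    obtain ⟨W₂, hz₂, h₂, β, g, hg, e₂⟩ := exists_res_eq_specFrac b hV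
    have hzW : PrimeSpec.zero A ∈ W₁ ⊓ W₂ := ⟨hz₁, hz₂⟩
    have hW : W₁ ⊓ W₂ ≤ V := inf_le_left.trans h₁
    replace e' := congrArg ((MonoidGeometry.tilde A N).res hW) e'
    rw [PreModule.res_smul, PreModule.res_smul, e₁ _ inf_le_left, e₂ _ inf_le_right,
      res_tildeConst, res_tildeConst, res_tildeConst, res_tildeConst, tildeConst, tildeConst,
      specFrac_smul, specFrac_smul] at e'
    -- At the zero ideal every nonzero element is an admissible denominator; clearing denominators
    -- leaves an equation between multiples of `e i` and `e j` in `N`.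
    obtain ⟨t, ht, e''⟩ := exists_of_tildeFrac_eq e' hzW
    have ht0 : t ≠ 0 := ht
    have hf0 : f ≠ 0 := hf _ hz₁
    have hg0 : g ≠ 0 := hg _ hz₂
    have hα : α ≠ 0 := by
      rintro rfl
      refine ha (Spec.res_injective h₁ hz₁ ?_)
      rw [e₁ _ le_rfl, (Spec A).res_zero, zero_eq_specConst]
      exact specFrac_congr (by simp)
    rw [mul_one, mul_one, smul_smul, smul_smul, smul_smul, smul_smul] at e''
    obtain ⟨hij, e₃⟩ := he.unique (by simp [*]) e''
    refine ⟨hij, Spec.res_injective hW hzW ?_⟩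
    rw [e₁ _ inf_le_left, e₂ _ inf_le_right]
    rw [mul_assoc, mul_assoc] at e₃
    exact specFrac_congr (mul_left_cancel₀ ht0 e₃)
  · obtain ⟨W, hpW, hWV, n, f, hf, e'⟩ := exists_res_eq_tildeFrac m hp
    refine ⟨W, hpW, hWV, ?_⟩
    rw [e' _ le_rfl]
    refine (he.span n).imp ?_ ?_
    · rintro rfl
      rw [zero_eq_tildeConst]
      exact tildeFrac_congr (by simp)
    · rintro ⟨i, a, rfl⟩
      refine ⟨i, specFrac a f hf, ?_⟩
      rw [res_tildeConst, tildeConst, specFrac_smul]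
      exact tildeFrac_congr (by simp)

end Integral

/-! ### Free sets over a monoid -/

/-- The free `A`-set on `ι`: the families in which at most one coordinate is nonzero. -/
def FreeSet (A ι : Type u) [CommMonoidWithZero A] : Type u :=
  {f : ι → A // ∀ i j, i ≠ j → f i = 0 ∨ f j = 0}

namespace FreeSet

variable {ι : Type u}

instance : Zero (FreeSet A ι) := ⟨⟨fun _ => 0, fun _ _ _ => Or.inl rfl⟩⟩

instance : MulActionWithZero A (FreeSet A ι) where
  smul a f := ⟨fun i => a * f.1 i, fun i j h => (f.2 i j h).imp
    (fun e => (congrArg (a * ·) e).trans (mul_zero a))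
    (fun e => (congrArg (a * ·) e).trans (mul_zero a))⟩
  one_smul f := Subtype.ext (funext fun i => one_mul _)
  mul_smul a b f := Subtype.ext (funext fun i => mul_assoc _ _ _)
  smul_zero a := Subtype.ext (funext fun i => mul_zero _)
  zero_smul f := Subtype.ext (funext fun i => zero_mul _)

open Classical in
/-- The standard basis vectors. -/
noncomputable def single (A : Type u) [CommMonoidWithZero A] (i : ι) : FreeSet A ι :=
  ⟨Pi.single i 1, fun j k h => by
    by_cases hj : j = i
    · right
      rw [Pi.single_eq_of_ne]
      rintro rfl
      exact h hj
    · left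
      rw [Pi.single_eq_of_ne hj]⟩

open Classical in
theorem isSetBasis_single : IsSetBasis A (fun i : ι => single A i) := by
  refine .of_coord (fun f => ?_) fun i => ⟨fun f => f.1 i, fun a f => rfl, ?_, fun j hj => ?_⟩
  · by_cases hf : ∃ i, f.1 i ≠ 0
    · obtain ⟨i, hi⟩ := hf
      refine Or.inr ⟨i, f.1 i, Subtype.ext (funext fun j => ?_)⟩
      change f.1 j = f.1 i * (Pi.single i 1 : ι → A) j
      by_cases hj : j = i
      · subst hj
        rw [Pi.single_eq_same, mul_one]
      · rw [Pi.single_eq_of_ne hj, mul_zero]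
        exact (f.2 j i hj).resolve_right hi
    · push Not at hf
      exact Or.inl (Subtype.ext (funext hf))
  · exact Pi.single_eq_same i 1
  · exact Pi.single_eq_of_ne (Ne.symm hj) 1

end FreeSet

theorem IsSetBasis.isFinitelyGenerated {ι : Type*} [Finite ι] {e : ι → N}
    (he : IsSetBasis A e) : IsFinitelyGenerated A N := by
  classical
  have := Fintype.ofFinite ι
  refine ⟨insert 0 (Finset.univ.image e), fun m => ?_⟩
  rcases he.span m with rfl | ⟨i, a, rfl⟩
  · exact ⟨0, by simp, 0, by simp⟩
  · exact ⟨e i, by simp, a, rfl⟩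

theorem IsSetBasis.isProjectiveSet {ι : Type*} {e : ι → N} (he : IsSetBasis A e) :
    IsProjectiveSet A N := by
  intro M N' _ _ _ _ g h hg
  choose f hf using fun i => hg (h (e i))
  obtain ⟨l, hl, hle⟩ := he.exists_lift f
  refine ⟨⟨l, hl⟩, fun p => he.map_eq (l := fun p => g (l p)) (l' := h) (fun a m => ?_)
    (fun a m => map_smul h a m) (fun i => ?_) p⟩
  · rw [hl, map_smul]
  · rw [hle, hf]

/-- A projective set over an integral monoid is free. -/
theorem IsProjectiveSet.exists_isSetBasis {P : Type u} [Zero P] [MulActionWithZero A P]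
    [Nontrivial A] (hA : ∀ {a b c : A}, a ≠ 0 → a * b = a * c → b = c)
    (hP : IsProjectiveSet A P) : ∃ (ι : Type u) (e : ι → P), IsSetBasis A e := by
  -- The surjection from the free set on all elements of `P` has a section `l`. The basis of `P`
  -- will consist of the elements `q` that `l` sends to their own basis vector.
  have hb := FreeSet.isSetBasis_single (A := A) (ι := P)
  obtain ⟨g, hg, hge⟩ := hb.exists_lift (fun p => p)
  obtain ⟨l, hl⟩ := hP (FreeSet A P) P ⟨g, hg⟩ (.id A) (fun p => ⟨_, hge p⟩)
  replace hl : ∀ p, g (l p) = p := hl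
  have hl0 : ∀ p, l p = 0 → p = 0 := fun p h => by
    rw [← hl p, h]
    exact map_zero_of_map_smul hg
  refine ⟨{q : P // l q = FreeSet.single A q}, fun q => q.1, fun p => ?_, ?_⟩
  · rcases hb.span (l p) with h | ⟨q, a, h⟩
    · exact Or.inl (hl0 p h)
    · have hp : p = a • q := by rw [← hl p, h, hg, hge]
      by_cases ha : a = 0
      · left
        rw [hp, ha, zero_smul]
      · refine Or.inr ⟨⟨q, ?_⟩, a, hp⟩
        rw [hp, map_smul] at h
        -- From `p = a • q` and `l p = a • single A q` one gets `a • l q = a • single A q`, and `a`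
        -- cancels in each coordinate.
        refine Subtype.ext (funext fun j => hA ha ?_)
        exact congrFun (congrArg Subtype.val h) j
  · rintro ⟨q, hq⟩ ⟨q', hq'⟩ a b ha h
    have := congrArg l h
    rw [map_smul, map_smul, hq, hq'] at this
    obtain ⟨h1, h2⟩ := hb.unique ha this
    exact ⟨Subtype.ext h1, h2⟩

theorem isFreeOfRankOne_iff {M : Type u} [Zero M] [MulActionWithZero A M] :
    IsFreeOfRankOne A M ↔ ∃ e : M, IsSetBasis A (fun _ : Unit => e) := by
  constructor
  · rintro ⟨e, he⟩
    exact ⟨e, fun m => Or.inr ⟨(), (he.2 m).imp fun a h => h.symm⟩, fun _ h => ⟨rfl, he.1 h⟩⟩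
  · rintro ⟨e, he⟩
    refine ⟨e, fun a b h => he.smul_inj (i := ()) h, fun m => ?_⟩
    rcases he.span m with h | ⟨-, a, h⟩
    · exact ⟨0, by rw [h]; exact zero_smul A e⟩
    · exact ⟨a, h.symm⟩

end Spec

end

/-! ### Charts, existence of the generic point, and local freeness -/

section

/-! ### Affine charts -/

variable {X : MonoidalSpace.{u}}

namespace AffineChart

section

variable {A : Type u} [CommMonoidWithZero A] (c : AffineChart A X)

/-- The preimage of an open subset of `X` in `Spec A`. -/
def pre (V : Opens X.carrier) : Opens (Spec A).carrier :=
  ⟨c.toFun ⁻¹' V, V.2.preimage c.isOpenEmbedding.continuous⟩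

theorem image_pre_le (V : Opens X.carrier) : c.image (c.pre V) ≤ V :=
  Set.image_preimage_subset _ _

theorem mem_range {x : X.carrier} : x ∈ c.range ↔ ∃ p, c.toFun p = x :=
  ⟨fun ⟨p, _, h⟩ => ⟨p, h⟩, fun ⟨p, h⟩ => ⟨p, trivial, h⟩⟩

theorem image_le_range (V : Opens (Spec A).carrier) : c.image V ≤ c.range := c.image_mono le_top

theorem mem_image_of_mem {V : Opens (Spec A).carrier} {p : (Spec A).carrier} (h : p ∈ V) :
    c.toFun p ∈ c.image V := ⟨p, h, rfl⟩

/-- The sections of the structure sheaf over an open subset of the chart. -/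
def secEquiv (V : Opens (Spec A).carrier) :
    (Spec A).sheaf.obj V ≃* X.sheaf.obj (c.image V) := c.sec V

theorem secEquiv_res {V W : Opens (Spec A).carrier} (h : W ≤ V) (a : (Spec A).sheaf.obj V) :
    c.secEquiv W ((Spec A).sheaf.res h a) = X.sheaf.res (c.image_mono h) (c.secEquiv V a) :=
  c.sec_res h a

/-- The section over the chart given by an element of its coordinate monoid. -/
def coord (a : A) : X.sheaf.obj c.range := c.secEquiv ⊤ (specConst ⊤ a)

theorem secEquiv_specConst (W : Opens (Spec A).carrier) (a : A) :
    c.secEquiv W (specConst W a) = X.sheaf.res (c.image_le_range W) (c.coord a) := by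
  exact c.secEquiv_res le_top (specConst ⊤ a)

theorem isUnit_res_coord {W : Opens (Spec A).carrier} {g : A} (h : ∀ q ∈ W, g ∉ q.carrier) :
    IsUnit (X.sheaf.res (c.image_le_range W) (c.coord g)) := by
  rw [← secEquiv_specConst]
  exact (isUnit_specConst h).map (c.secEquiv W)

theorem nontrivial_of_mem {x : X.carrier} (h : x ∈ c.range) : Nontrivial A := by
  obtain ⟨p, -⟩ := c.mem_range.1 h
  exact p.nontrivial

/-- An affine chart is the smallest open neighbourhood of one of its points. -/
theorem exists_mem_range_forall_le {x : X.carrier} (h : x ∈ c.range) :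
    ∃ y ∈ c.range, ∀ V : Opens X.carrier, y ∈ V → c.range ≤ V := by
  have := c.nontrivial_of_mem h
  refine ⟨c.toFun (PrimeSpec.nonunits A), c.mem_range.2 ⟨_, rfl⟩, fun V hV => ?_⟩
  intro z hz
  obtain ⟨p, rfl⟩ := c.mem_range.1 hz
  exact PrimeSpec.mem_of_subset (V := c.pre V) p.subset_nonunits hV

theorem zero_mem_of_mem [IsCancelMulZero A] [Nontrivial A] {x : X.carrier} (h : x ∈ c.range)
    {V : Opens X.carrier} (hV : x ∈ V) : PrimeSpec.zero A ∈ c.pre V := by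
  obtain ⟨p, rfl⟩ := c.mem_range.1 h
  exact PrimeSpec.mem_of_subset (V := c.pre V) p.zero_subset hV

variable {c} {N : Type u} [Zero N] [MulActionWithZero A N] {M : OModule X}

/-- The sections of a quasi-coherent module over a chart, as fractions. -/
theorem RestrictsToTilde.exists_sections (h : c.RestrictsToTilde M N) :
    ∃ σ : N → M.obj c.range, (∀ a n, σ (a • n) = c.coord a • σ n) ∧
      (∀ (x : X.carrier) (V : Opens X.carrier) (hV : V ≤ c.range) (_ : x ∈ V) (s : M.obj V),
        ∃ (W : Opens X.carrier) (_ : x ∈ W) (hW : W ≤ V) (g : A) (n : N),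
          IsUnit (X.sheaf.res (hW.trans hV) (c.coord g)) ∧
          X.sheaf.res (hW.trans hV) (c.coord g) • M.res hW s = M.res (hW.trans hV) (σ n)) ∧
      ∀ (n n' : N) (x : X.carrier) (V : Opens X.carrier) (hV : V ≤ c.range) (_ : x ∈ V),
        M.res hV (σ n) = M.res hV (σ n') →
        ∃ (t : A) (W : Opens X.carrier) (_ : x ∈ W) (hW : W ≤ V),
          IsUnit (X.sheaf.res (hW.trans hV) (c.coord t)) ∧ t • n = t • n' := by
  obtain ⟨e, he, hres⟩ := h
  replace he : ∀ (V : Opens (Spec A).carrier) (a : (Spec A).sheaf.obj V) (m : M.obj (c.image V)),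
      e V (c.secEquiv V a • m) = a • e V m := he
  obtain ⟨σ, hσ'⟩ : ∃ σ : N → M.obj c.range, ∀ n, e ⊤ (σ n) = tildeConst ⊤ n :=
    ⟨fun n => (e ⊤).symm (tildeConst ⊤ n), fun n => (e ⊤).apply_symm_apply _⟩
  have hσ : ∀ W n, e W (M.res (c.image_le_range W) (σ n)) = tildeConst W n := by
    intro W n
    refine (hres le_top _).trans ?_
    rw [hσ', res_tildeConst]
  refine ⟨σ, fun a n => ?_, ?_, ?_⟩
  · refine (e ⊤).injective ((hσ' _).trans ?_)
    refine (tildeConst_smul a n).trans (Eq.trans ?_ (he ⊤ (specConst ⊤ a) (σ n)).symm)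
    rw [hσ']
  · intro x V hV hx s
    obtain ⟨p, rfl⟩ := c.mem_range.1 (hV hx)
    obtain ⟨W, hpW, hW, n, f, hf, hs⟩ := exists_res_eq_tildeFrac
      (e (c.pre V) (M.res (c.image_pre_le V) s)) (p := p) hx
    refine ⟨c.image W, c.mem_image_of_mem hpW, (c.image_mono hW).trans (c.image_pre_le V), f, n,
      c.isUnit_res_coord hf, (e W).injective ?_⟩
    rw [hσ, ← secEquiv_specConst, he, ← M.res_res (c.image_pre_le V) (c.image_mono hW), hres hW,
      hs _ le_rfl hW, specConst_smul_tildeFrac]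
  · intro n n' x V hV hx hn
    obtain ⟨p, rfl⟩ := c.mem_range.1 (hV hx)
    have hn' := congrArg (fun m => e (c.pre V) (M.res (c.image_pre_le V) m)) hn
    simp only [M.res_res] at hn'
    rw [hσ, hσ] at hn'
    obtain ⟨t, ht, h⟩ := exists_of_tildeFrac_eq hn' (q := p) hx
    -- Shrinking to the set where `t` does not vanish makes its coordinate function a unit.
    refine ⟨t, c.image (c.pre V ⊓ PrimeSpec.basicOpen t), c.mem_image_of_mem ⟨hx, ht⟩,
      (c.image_mono inf_le_left).trans (c.image_pre_le V), c.isUnit_res_coord fun q hq => hq.2, ?_⟩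
    rwa [one_smul, one_smul] at h

variable (c) in
theorem restrictsToTilde_structureModule :
    c.RestrictsToTilde (OModule.structureModule X) A := by
  have h1 : ∀ V (a : (Spec A).sheaf.obj V) (m : X.sheaf.obj (c.image V)),
      (c.secEquiv V).symm (c.secEquiv V a * m) = a * (c.secEquiv V).symm m := fun V a m => by
    rw [map_mul, MulEquiv.symm_apply_apply]
  have h2 : ∀ V W (h : W ≤ V) (m : X.sheaf.obj (c.image V)),
      (c.secEquiv W).symm (X.sheaf.res (c.image_mono h) m) =
        (Spec A).sheaf.res h ((c.secEquiv V).symm m) := fun V W h m => by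
    rw [MulEquiv.symm_apply_eq, secEquiv_res, MulEquiv.apply_symm_apply]
  exact ⟨fun V => (c.secEquiv V).symm.toEquiv, h1, fun {V W} h m => h2 V W h m⟩

end

section restrict

variable {A : Type u} [CommMonoidWithZero A] (c : AffineChart A X) (M : OModule X)

/-- The restriction of a module to the chart, as a presheaf of modules on `Spec A`. -/
def restrict : PreModule (Spec A) where
  obj V := M.obj (c.image V)
  res h := M.res (c.image_mono h)
  res_id h := M.res_id _
  res_res h h' := M.res_res _ _
  zero V := inferInstanceAs (Zero (M.obj (c.image V)))
  act V :=
    { smul := fun a m => c.secEquiv V a • m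
      one_smul := fun m => by
        change c.secEquiv V 1 • m = m
        rw [map_one, one_smul]
      mul_smul := fun a b m => by
        change c.secEquiv V (a * b) • m = c.secEquiv V a • c.secEquiv V b • m
        rw [map_mul, mul_smul]
      smul_zero := fun a => smul_zero (c.secEquiv V a)
      zero_smul := fun m => by
        change c.secEquiv V 0 • m = 0
        rw [map_zero, zero_smul] }
  res_smul {U V} h a m := (M.res_smul (c.image_mono h) (c.secEquiv U a) m).trans
    (congrArg (fun b : X.sheaf.obj (c.image V) => b • M.res (c.image_mono h) m)
      (c.secEquiv_res h a).symm)

variable {M}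

theorem isBasisOn_restrict {V : Opens (Spec A).carrier} {ι : Type*} {b : ι → M.obj (c.image V)}
    (hb : IsBasisOn M.toPreModule (c.image V) b) :
    IsBasisOn (c.restrict M) V b := by
  intro W hW
  refine ⟨fun m => ((hb _ (c.image_mono hW)).span m).imp_right ?_, fun {i j a a'} ha h => ?_⟩
  · rintro ⟨i, a, h⟩
    obtain ⟨a, rfl⟩ := (c.secEquiv W).surjective a
    exact ⟨i, a, h⟩
  · obtain ⟨h1, h2⟩ := (hb _ (c.image_mono hW)).unique (a := c.secEquiv W a)
      (b := c.secEquiv W a') (by simpa using ha) h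
    exact ⟨h1, (c.secEquiv W).injective h2⟩

theorem restrictsToTilde_of_isBasisOn [IsCancelMulZero A] [Nontrivial A] {ι : Type u}
    {b : ι → M.obj c.range} (hb : IsBasisOn M.toPreModule c.range b) :
    c.RestrictsToTilde M (FreeSet A ι) := by
  obtain ⟨l, l', -, h1, h2⟩ := (c.isBasisOn_restrict hb).exists_localEquiv
    (IsSetBasis.tilde (FreeSet.isSetBasis_single (A := A) (ι := ι)))
  exact ⟨fun V => ⟨l.app V le_top, l'.app V le_top, h1 V le_top, h2 V le_top⟩,
    fun V => l.map_smul V le_top, fun h => l.map_res le_top h⟩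

end restrict

end AffineChart

/-! ### The generic point of a connected integral scheme -/

/-- The statements about sections are checked in integral charts. Every chart around a point
contains `η`, so the zero ideal of the chart lies in the preimage of each open set containing `η`,
and `isGeneric_zero` applies. -/
theorem isGeneric_of_isIntegral (hX : X.IsIntegral) {η : X.carrier}
    (hmem : ∀ (x : X.carrier) (V : Opens X.carrier), x ∈ V → η ∈ V) : IsGeneric X η := by
  have res_inj : ∀ {V W : Opens X.carrier} (h : V ≤ W), η ∈ V →
      Function.Injective (X.sheaf.res h) := by
    intro V W h hV s t hst
    refine X.isSheaf.ext fun x hx => ?_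
    obtain ⟨A, _, c, _, hxc⟩ := hX x
    have := c.nontrivial_of_mem hxc
    refine ⟨c.image (c.pre W), ?_, c.image_pre_le W, ?_⟩
    · obtain ⟨p, rfl⟩ := c.mem_range.1 hxc
      exact c.mem_image_of_mem hx
    obtain ⟨s', hs⟩ := (c.secEquiv (c.pre W)).surjective (X.sheaf.res (c.image_pre_le W) s)
    obtain ⟨t', ht⟩ := (c.secEquiv (c.pre W)).surjective (X.sheaf.res (c.image_pre_le W) t)
    rw [← hs, ← ht]
    congr 1
    have hle : c.pre V ≤ c.pre W := fun p hp => h hp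
    refine Spec.res_injective hle (c.zero_mem_of_mem (hmem x _ hxc) hV)
      ((c.secEquiv (c.pre V)).injective ?_)
    rw [c.secEquiv_res, c.secEquiv_res, hs, ht, X.sheaf.res_res, X.sheaf.res_res,
      ← X.sheaf.res_res h (c.image_pre_le V), hst, X.sheaf.res_res]
  refine ⟨fun {x V} => hmem x V, res_inj, fun {V} hV h => ?_, fun {V} hV a b d ha h => ?_⟩
  · obtain ⟨A, _, c, _, hxc⟩ := hX η
    have := c.nontrivial_of_mem hxc
    have h' := congrArg (X.sheaf.res (c.image_pre_le V)) h
    rw [X.res_one, X.res_zero, ← map_one (c.secEquiv (c.pre V)),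
      ← map_zero (c.secEquiv (c.pre V))] at h'
    exact isGeneric_zero.one_ne_zero (c.zero_mem_of_mem hxc hV) ((c.secEquiv _).injective h')
  · refine X.isSheaf.ext fun x hx => ?_
    obtain ⟨A, _, c, _, hxc⟩ := hX x
    have := c.nontrivial_of_mem hxc
    have hxW : x ∈ c.image (c.pre V) := by
      obtain ⟨p, rfl⟩ := c.mem_range.1 hxc
      exact c.mem_image_of_mem hx
    refine ⟨c.image (c.pre V), hxW, c.image_pre_le V, ?_⟩
    obtain ⟨a', ha'⟩ := (c.secEquiv (c.pre V)).surjective (X.sheaf.res (c.image_pre_le V) a)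
    obtain ⟨b', hb'⟩ := (c.secEquiv (c.pre V)).surjective (X.sheaf.res (c.image_pre_le V) b)
    obtain ⟨d', hd'⟩ := (c.secEquiv (c.pre V)).surjective (X.sheaf.res (c.image_pre_le V) d)
    have h' := congrArg (X.sheaf.res (c.image_pre_le V)) h
    rw [X.res_mul, X.res_mul, ← ha', ← hb', ← hd', ← map_mul, ← map_mul] at h'
    rw [← hb', ← hd']
    congr 1
    refine isGeneric_zero.mul_left_cancel (c.zero_mem_of_mem hxc hx) ?_
      ((c.secEquiv _).injective h')
    rintro rfl
    rw [map_zero] at ha'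
    refine ha (res_inj (c.image_pre_le V) (hmem x _ hxW) ?_)
    rw [← ha', X.res_zero]

/-- Let `η` be the zero ideal of one chart, and `S` the set of points all of whose neighbourhoods
contain `η`. It is visibly closed. It is open because a chart around a point of `S` contains `η`, so
its own zero ideal lies in the first chart; neighbourhoods of points of the new chart contain that
zero ideal and hence `η`. Connectedness gives `S = X`. -/
theorem exists_isGeneric (hX : X.IsIntegral) (hc : ConnectedSpace X.carrier) :
    ∃ η, IsGeneric X η := by
  obtain ⟨x₀⟩ := hc.toNonempty
  obtain ⟨A₀, _, c₀, _, h₀⟩ := hX x₀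
  have := c₀.nontrivial_of_mem h₀
  set η := c₀.toFun (PrimeSpec.zero A₀) with hη
  let S : Set X.carrier := {x | ∀ V : Opens X.carrier, x ∈ V → η ∈ V}
  have hclosed : IsClosed S := by
    rw [← isOpen_compl_iff, isOpen_iff_forall_mem_open]
    intro x hx
    obtain ⟨V, hV⟩ := not_forall.1 hx
    obtain ⟨hxV, hηV⟩ := Classical.not_imp.1 hV
    exact ⟨V, fun z hz h => hηV (h V hz), V.2, hxV⟩
  have hopen : IsOpen S := by
    rw [isOpen_iff_forall_mem_open]
    intro x hx
    obtain ⟨A, _, c, _, hxc⟩ := hX x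
    have := c.nontrivial_of_mem hxc
    refine ⟨c.range, fun z hz V hV => ?_, c.range.2, hxc⟩
    have h1 : c.toFun (PrimeSpec.zero A) ∈ V := c.zero_mem_of_mem hz hV
    have h2 : c.toFun (PrimeSpec.zero A) ∈ c₀.range :=
      c.zero_mem_of_mem (hx c.range hxc) (c₀.mem_range.2 ⟨_, rfl⟩)
    exact c₀.zero_mem_of_mem h2 h1
  have huniv : S = Set.univ := IsClopen.eq_univ ⟨hclosed, hopen⟩
    ⟨x₀, fun V hV => c₀.zero_mem_of_mem h₀ hV⟩
  exact ⟨η, isGeneric_of_isIntegral hX fun x => huniv.ge (Set.mem_univ x)⟩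

/-! ### Local bases of locally projective modules -/

/-- The sections of `M` over open subsets of `U` are locally fractions of sections over `U`. -/
structure QuasiCoherentOn (M : OModule X) (U : Opens X.carrier) : Prop where
  surj : ∀ (x : X.carrier) (V : Opens X.carrier) (hV : V ≤ U) (_ : x ∈ V) (s : M.obj V),
    ∃ (W : Opens X.carrier) (_ : x ∈ W) (hW : W ≤ V) (g : X.sheaf.obj U) (n : M.obj U),
      IsUnit (X.sheaf.res (hW.trans hV) g) ∧
      X.sheaf.res (hW.trans hV) g • M.res hW s = M.res (hW.trans hV) n
  inj : ∀ (n n' : M.obj U) (x : X.carrier) (V : Opens X.carrier) (hV : V ≤ U) (_ : x ∈ V),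
    M.res hV n = M.res hV n' → ∃ (t : X.sheaf.obj U) (W : Opens X.carrier) (_ : x ∈ W)
      (hW : W ≤ V), IsUnit (X.sheaf.res (hW.trans hV) t) ∧ t • n = t • n'

theorem isUnit_res {U V : Opens X.carrier} (h : V ≤ U) {a : X.sheaf.obj U} (ha : IsUnit a) :
    IsUnit (X.sheaf.res h a) := by
  obtain ⟨b, hb⟩ := ha.exists_right_inv
  exact IsUnit.of_mul_eq_one (X.sheaf.res h b) (by rw [← X.res_mul, hb, X.res_one])

/-- Every neighbourhood of `y` contains `U`, so a description of sections as fractions near `y` is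
valid on all of `U`. This transfers the fractions from the set `N` over the chart to the sections
over the smaller set `U`. -/
theorem AffineChart.RestrictsToTilde.quasiCoherentOn {A : Type u} [CommMonoidWithZero A]
    {c : AffineChart A X} {N : Type u} [Zero N] [MulActionWithZero A N] {M : OModule X}
    (h : c.RestrictsToTilde M N) {U : Opens X.carrier} (hU : U ≤ c.range) {y : X.carrier}
    (hyU : y ∈ U) (hy : ∀ V : Opens X.carrier, y ∈ V → U ≤ V) : QuasiCoherentOn M U := by
  obtain ⟨σ, hσ, hsurj, hinj⟩ := h.exists_sections
  have hfrac : ∀ n : M.obj U, ∃ (g : A) (ν : N), IsUnit (X.sheaf.res hU (c.coord g)) ∧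
      X.sheaf.res hU (c.coord g) • n = M.res hU (σ ν) := by
    intro n
    obtain ⟨W, hyW, hW, g, ν, h1, h2⟩ := hsurj y U hU hyU n
    obtain rfl : W = U := le_antisymm hW (hy W hyW)
    exact ⟨g, ν, h1, by rwa [M.res_id] at h2⟩
  refine ⟨fun x V hV hx s => ?_, fun n n' x V hV hx hn => ?_⟩
  · obtain ⟨W, hxW, hW, g, n, h1, h2⟩ := hsurj x V (hV.trans hU) hx s
    refine ⟨W, hxW, hW, X.sheaf.res hU (c.coord g), M.res hU (σ n), ?_, ?_⟩
    · rwa [X.sheaf.res_res]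
    · rwa [X.sheaf.res_res, M.res_res]
  · obtain ⟨g, ν, hg, hν⟩ := hfrac n
    obtain ⟨g', ν', hg', hν'⟩ := hfrac n'
    have e : M.res (hV.trans hU) (σ (g' • ν)) = M.res (hV.trans hU) (σ (g • ν')) := by
      rw [← M.res_res hU hV, ← M.res_res hU hV, hσ, hσ, M.res_smul hU, M.res_smul hU, ← hν, ← hν',
        M.res_smul, M.res_smul, M.res_smul, M.res_smul, hn, smul_smul, smul_smul, mul_comm]
    obtain ⟨t, W, hxW, hW, ht, e'⟩ := hinj _ _ x V (hV.trans hU) hx e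
    -- Multiplication by `g' * g` turns `n` and `n'` into the images of `g' • ν` and `g • ν'`, which
    -- become equal after multiplication by `t`.
    refine ⟨X.sheaf.res hU (c.coord t) *
      (X.sheaf.res hU (c.coord g') * X.sheaf.res hU (c.coord g)), W, hxW, hW, ?_, ?_⟩
    · rw [X.res_mul, X.sheaf.res_res]
      exact ht.mul (isUnit_res _ (hg'.mul hg))
    · have e'' := congrArg (fun n => M.res hU (σ n)) e'
      simp only [hσ, M.res_smul, ← hν, ← hν'] at e''
      rw [mul_smul, mul_smul, e'', mul_comm (X.sheaf.res hU (c.coord g')), mul_smul, mul_smul]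

/-- Sections over smaller open sets are locally fractions of sections over `U`, which gives
spanning. For uniqueness, denominators are cleared near `η`, the equation is moved to `U`, and the
multipliers are cancelled again. -/
theorem QuasiCoherentOn.isBasisOn {η : X.carrier} (hη : IsGeneric X η) {M : OModule X}
    {U : Opens X.carrier} (hM : QuasiCoherentOn M U)
    (hX : QuasiCoherentOn (OModule.structureModule X) U) {ι : Type*} {e : ι → M.obj U}
    (he : IsSetBasis (X.sheaf.obj U) e) : IsBasisOn M.toPreModule U e := by
  refine hη.isBasisOn_of_local (fun V h hV i j a b ha hab => ?_) (fun V h m hV x hx => ?_)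
  · obtain ⟨W₁, hW₁, h₁, g, (α : X.sheaf.obj U), hg, hα⟩ := hX.surj η V h hV a
    obtain ⟨W₂, hW₂, h₂, k, (β : X.sheaf.obj U), hk, hβ⟩ := hX.surj η V h hV b
    have hW : η ∈ W₁ ⊓ W₂ := ⟨hW₁, hW₂⟩
    have hWV : W₁ ⊓ W₂ ≤ V := inf_le_left.trans h₁
    have hα' := congrArg (X.sheaf.res (inf_le_left : W₁ ⊓ W₂ ≤ W₁)) hα
    have hβ' := congrArg (X.sheaf.res (inf_le_right : W₁ ⊓ W₂ ≤ W₂)) hβ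
    change X.sheaf.res _ (X.sheaf.res _ g * X.sheaf.res _ a) =
      X.sheaf.res _ (X.sheaf.res _ α) at hα'
    change X.sheaf.res _ (X.sheaf.res _ k * X.sheaf.res _ b) =
      X.sheaf.res _ (X.sheaf.res _ β) at hβ'
    rw [X.res_mul] at hα' hβ'
    simp only [X.sheaf.res_res] at hα' hβ'
    have hgu : X.sheaf.res (hWV.trans h) g ≠ 0 := by
      have := hη.res_ne_zero (inf_le_left : W₁ ⊓ W₂ ≤ W₁) hW (hη.ne_zero_of_isUnit hW₁ hg)
      rwa [X.sheaf.res_res] at this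
    have hku : X.sheaf.res (hWV.trans h) k ≠ 0 := by
      have := hη.res_ne_zero (inf_le_right : W₁ ⊓ W₂ ≤ W₂) hW (hη.ne_zero_of_isUnit hW₂ hk)
      rwa [X.sheaf.res_res] at this
    have hau : X.sheaf.res hWV a ≠ 0 := hη.res_ne_zero hWV hW ha
    -- With `a = α / g` and `b = β / k`, this is `a • e i = b • e j` multiplied by `g * k`.
    have e₁ : M.res (hWV.trans h) ((k * α) • e i) = M.res (hWV.trans h) ((g * β) • e j) := by
      have := congrArg (M.res hWV) hab
      rw [M.res_smul, M.res_smul, M.res_res, M.res_res] at this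
      rw [M.res_smul, M.res_smul, X.res_mul, X.res_mul, ← hα', ← hβ', mul_left_comm, mul_smul,
        mul_smul, this, ← mul_smul, ← mul_smul, mul_assoc]
    obtain ⟨t, W, hηW, hWW, ht, e₂⟩ := hM.inj _ _ η _ (hWV.trans h) hW e₁
    have ht0 : t ≠ 0 := by
      rintro rfl
      rw [X.res_zero] at ht
      exact hη.ne_zero_of_isUnit hηW ht rfl
    have hηU : η ∈ U := h hV
    have hkα : k * α ≠ 0 := by
      intro h0
      have := congrArg (X.sheaf.res (hWV.trans h)) h0
      rw [X.res_mul, ← hα', X.res_zero] at this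
      exact hη.mul_ne_zero hW hku (hη.mul_ne_zero hW hgu hau) this
    rw [smul_smul, smul_smul] at e₂
    obtain ⟨hij, e₃⟩ := he.unique (hη.mul_ne_zero hηU ht0 hkα) e₂
    refine ⟨hij, hη.res_inj hWV hW ?_⟩
    have e₄ := congrArg (X.sheaf.res (hWV.trans h)) (hη.mul_left_cancel hηU ht0 e₃)
    rw [X.res_mul, X.res_mul, ← hα', ← hβ', mul_left_comm] at e₄
    exact hη.mul_left_cancel hW hku (hη.mul_left_cancel hW hgu e₄)
  · obtain ⟨W, hxW, hW, g, n, hg, hn⟩ := hM.surj x V h hx m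
    refine ⟨W, hxW, hW, ?_⟩
    obtain ⟨f, hf⟩ := hg.exists_left_inv
    have e₁ : M.res hW m = f • M.res (hW.trans h) n := by
      rw [← hn, smul_smul, hf, one_smul]
    rw [e₁]
    refine (he.span n).imp ?_ ?_
    · rintro rfl
      rw [M.res_zero, smul_zero]
    · rintro ⟨i, a, rfl⟩
      exact ⟨i, f * X.sheaf.res (hW.trans h) a, by rw [M.res_smul, smul_smul]⟩

namespace OModule

variable {η : X.carrier} {M : OModule X}

/-- The chart carrying the basis need not be one on which `M` comes from an `A`-set. But a chart `d`
of the latter kind around the minimal point `y` of `c` contains all of `c`. -/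
theorem IsQuasiCoherent.isBasisOn_range (hη : IsGeneric X η) (hM : M.IsQuasiCoherent)
    {A : Type u} [CommMonoidWithZero A] (c : AffineChart A X) {x : X.carrier} (hx : x ∈ c.range)
    {ι : Type*} {e : ι → M.obj c.range} (he : IsSetBasis (X.sheaf.obj c.range) e) :
    IsBasisOn M.toPreModule c.range e := by
  obtain ⟨y, hy, hmin⟩ := c.exists_mem_range_forall_le hx
  obtain ⟨B, _, d, N, _, _, hyd, hd⟩ := hM y
  exact (hd.quasiCoherentOn (hmin _ hyd) hy hmin).isBasisOn hη
    (d.restrictsToTilde_structureModule.quasiCoherentOn (hmin _ hyd) hy hmin) he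

theorem IsLocallyProjective.exists_isBasisOn (hη : IsGeneric X η) (hM : M.IsLocallyProjective)
    (x : X.carrier) : ∃ (U : Opens X.carrier) (_ : x ∈ U) (ι : Type u) (e : ι → M.obj U),
      IsBasisOn M.toPreModule U e := by
  obtain ⟨A, _, c, hx, hc⟩ := hM.2 x
  have := hη.nontrivial (hη.mem hx)
  obtain ⟨ι, e, he⟩ := hc.exists_isSetBasis (hη.mul_left_cancel (hη.mem hx))
  exact ⟨c.range, hx, ι, e, hM.1.isBasisOn_range hη c hx he⟩

theorem IsLineBundle.exists_isBasisOn (hη : IsGeneric X η) (hM : M.IsLineBundle)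
    (x : X.carrier) : ∃ (U : Opens X.carrier) (_ : x ∈ U) (e : M.obj U),
      IsBasisOn M.toPreModule U (fun _ : Unit => e) := by
  obtain ⟨A, _, c, hx, hc⟩ := hM.2 x
  obtain ⟨e, he⟩ := isFreeOfRankOne_iff.1 hc
  exact ⟨c.range, hx, e, hM.1.isBasisOn_range hη c hx he⟩

/-- A basis near the minimal point of an integral chart is defined on the entire chart, where `M` is
then associated with a free set. -/
theorem isBundle_of_isBasisOn (hX : X.IsIntegral)
    (hM : ∀ x, ∃ (U : Opens X.carrier) (_ : x ∈ U) (ι : Type u) (_ : Finite ι) (e : ι → M.obj U),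
      IsBasisOn M.toPreModule U e) : M.IsBundle := by
  have H : ∀ x, ∃ (A : Type u) (_ : CommMonoidWithZero A) (c : AffineChart A X),
      x ∈ c.range ∧ IsCancelMulZero A ∧ Nontrivial A ∧
      ∃ (ι : Type u) (_ : Finite ι) (e : ι → M.obj c.range),
        IsBasisOn M.toPreModule c.range e := by
    intro x
    obtain ⟨A, _, c, hA, hx⟩ := hX x
    obtain ⟨y, hy, hmin⟩ := c.exists_mem_range_forall_le hx
    obtain ⟨U, hU, ι, hι, e, he⟩ := hM y
    exact ⟨A, _, c, hx, hA, c.nontrivial_of_mem hx, ι, hι, _, he.mono (hmin U hU)⟩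
  refine ⟨⟨fun x => ?_, fun x => ?_⟩, fun x => ?_⟩ <;>
    obtain ⟨A, _, c, hx, _, _, ι, _, e, he⟩ := H x
  · exact ⟨A, _, c, FreeSet A ι, _, _, hx, c.restrictsToTilde_of_isBasisOn he⟩
  · exact ⟨A, _, c, hx, he.self.isProjectiveSet⟩
  · exact ⟨A, _, c, FreeSet A ι, _, _, hx, FreeSet.isSetBasis_single.isFinitelyGenerated,
      c.restrictsToTilde_of_isBasisOn he⟩

theorem isLineBundle_of_isBasisOn (hX : X.IsIntegral)
    (hM : ∀ x, ∃ (U : Opens X.carrier) (_ : x ∈ U) (e : M.obj U),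
      IsBasisOn M.toPreModule U (fun _ : Unit => e)) : M.IsLineBundle := by
  refine ⟨(isBundle_of_isBasisOn hX fun x => ?_).1.1, fun x => ?_⟩
  · obtain ⟨U, hU, e, he⟩ := hM x
    exact ⟨U, hU, PUnit, inferInstance, fun _ => e, he.comp_equiv (Equiv.equivPUnit Unit).symm⟩
  · obtain ⟨A, _, c, hA, hx⟩ := hX x
    obtain ⟨y, hy, hmin⟩ := c.exists_mem_range_forall_le hx
    obtain ⟨U, hU, e, he⟩ := hM y
    exact ⟨A, _, c, hx, isFreeOfRankOne_iff.2 ⟨_, (he.mono (hmin U hU)).self⟩⟩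

/-- Near `η` each `b i` is a fraction of a multiple of some generator, and that generator must be a
nonzero multiple of `b i`. One generator can serve only one index, so `ι` embeds into the finite set
of generators. -/
theorem IsCoherent.finite (hη : IsGeneric X η) (hM : M.IsCoherent) {U : Opens X.carrier}
    (hU : η ∈ U) {ι : Type*} {b : ι → M.obj U} (hb : IsBasisOn M.toPreModule U b) :
    Finite ι := by
  obtain ⟨A, _, c, N, _, _, hηc, ⟨S, hS⟩, hc⟩ := hM η
  obtain ⟨σ, hσ, hsurj, -⟩ := hc.exists_sections
  have hW : η ∈ U ⊓ c.range := ⟨hU, hηc⟩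
  have key : ∀ i, ∃ s : S, ∃ α : X.sheaf.obj (U ⊓ c.range), α ≠ 0 ∧
      M.res inf_le_right (σ s) = α • M.res inf_le_left (b i) := by
    intro i
    obtain ⟨V, hηV, hV, g, n, hg, hn⟩ := hsurj η (U ⊓ c.range) inf_le_right hW
      (M.res inf_le_left (b i))
    obtain ⟨s, hs, a, rfl⟩ := hS n
    have hg0 := hη.ne_zero_of_isUnit hηV hg
    rw [hσ, M.res_smul, M.res_res] at hn
    rw [← M.res_res (inf_le_right : U ⊓ c.range ≤ c.range) hV (σ s)] at hn
    rcases (hb _ inf_le_left).span (M.res (inf_le_right : U ⊓ c.range ≤ _) (σ s)) with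
      h0 | ⟨j, α, hα⟩
    · rw [h0, M.res_zero, smul_zero] at hn
      exact absurd ((hb V (hV.trans inf_le_left)).smul_eq_zero.1 hn) hg0
    · rw [hα, M.res_smul, M.res_res, smul_smul] at hn
      obtain ⟨rfl, e⟩ := (hb V (hV.trans inf_le_left)).unique hg0 hn
      refine ⟨⟨s, hs⟩, α, fun h0 => hg0 ?_, hα⟩
      rw [e, h0, X.res_zero, mul_zero]
  choose f α hα hf using key
  refine Finite.of_injective f fun i j hij => ?_
  have := (hf i).symm.trans ((congrArg (fun s : S => M.res inf_le_right (σ s)) hij).trans (hf j))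
  exact ((hb _ inf_le_left).unique (hα i) this).1

end OModule

end

/-! ### Splitting into line bundles, its uniqueness, and wedges -/

section

variable {X : MonoidalSpace.{u}} {η : X.carrier}

/-! ### Existence of decompositions -/

theorem IsSetBasis.exists_equiv {A M ι κ : Type*} [CommMonoidWithZero A] [Nontrivial A] [Zero M]
    [MulActionWithZero A M] {e : ι → M} {e' : κ → M} (he : IsSetBasis A e)
    (he' : IsSetBasis A e') : ∃ σ : ι ≃ κ, ∀ i, ∃ a : A, IsUnit a ∧ e i = a • e' (σ i) := by
  choose f a hf ha using he.exists_smul_eq he'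
  choose f' a' hf' ha' using he'.exists_smul_eq he
  refine ⟨⟨f, f', fun i => ?_, fun j => ?_⟩, fun i => ⟨a i, ha i, hf i⟩⟩
  · have h := hf i
    rw [hf' (f i), ← mul_smul] at h
    exact (he.unique one_ne_zero ((one_smul A _).trans h)).1.symm
  · have h := hf' j
    rw [hf (f' j), ← mul_smul] at h
    exact (he'.unique one_ne_zero ((one_smul A _).trans h)).1.symm

namespace OModule

/-- The submodule of the sections with a local property. -/
def sub (M : OModule X) (P : ∀ V, M.obj V → Prop) (hzero : ∀ V, P V 0)
    (hsmul : ∀ V (a : X.sheaf.obj V) m, P V m → P V (a • m))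
    (hres : ∀ V W (h : W ≤ V) m, P V m → P W (M.res h m))
    (hlocal : ∀ V m, (∀ x ∈ V, ∃ (W : Opens X.carrier) (_ : x ∈ W) (hW : W ≤ V),
      P W (M.res hW m)) → P V m) : OModule X where
  obj V := {m : M.obj V // P V m}
  res h m := ⟨M.res h m.1, hres _ _ h _ m.2⟩
  res_id h m := Subtype.ext (M.res_id h _)
  res_res h h' m := Subtype.ext (M.res_res h h' _)
  zero V := ⟨⟨0, hzero V⟩⟩
  act V :=
    letI : Zero {m : M.obj V // P V m} := ⟨⟨0, hzero V⟩⟩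
    { smul := fun a m => ⟨a • m.1, hsmul V a _ m.2⟩
      one_smul := fun m => Subtype.ext (one_smul _ _)
      mul_smul := fun a b m => Subtype.ext (mul_smul _ _ _)
      smul_zero := fun a => Subtype.ext (smul_zero _)
      zero_smul := fun m => Subtype.ext (zero_smul _ _) }
  res_smul h a m := Subtype.ext (M.res_smul h a _)
  isSheaf κ U s hs := by
    obtain ⟨t, ht, hu⟩ := M.isSheaf κ U (fun i => (s i).1)
      (fun i j => congrArg Subtype.val (hs i j))
    refine ⟨⟨t, hlocal _ _ fun x hx => ?_⟩, fun i => Subtype.ext (ht i),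
      fun t' ht' => Subtype.ext (hu t'.1 fun i => congrArg Subtype.val (ht' i))⟩
    obtain ⟨i, hi⟩ := Opens.mem_iSup.1 hx
    refine ⟨U i, hi, le_iSup U i, ?_⟩
    rw [ht]
    exact (s i).2

variable {M : OModule X}

/-- Local bases of a module can be indexed by the same set in such a way that the transition
functions are diagonal. -/
theorem exists_diagonal (hη : IsGeneric X η)
    (hM : ∀ x, ∃ (U : Opens X.carrier) (_ : x ∈ U) (ι : Type u) (e : ι → M.obj U),
      IsBasisOn M.toPreModule U e) :
    ∃ (U : X.carrier → Opens X.carrier) (_ : ∀ x, x ∈ U x) (ι : Type u) (b : ∀ x, ι → M.obj (U x)),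
      (∀ x, IsBasisOn M.toPreModule (U x) (b x)) ∧ ∀ x y i, ∃ g : X.sheaf.obj (U x ⊓ U y),
        M.res inf_le_left (b x i) = g • M.res inf_le_right (b y i) := by
  choose U hU ι e he using hM
  have hηU : ∀ x, η ∈ U x := fun x => hη.mem (hU x)
  -- Each `U x` meets `U η`, and comparing the two bases on the intersection reindexes the one over
  -- `U x` by `ι η`.
  have hσ : ∀ x, ∃ σ : ι η ≃ ι x, ∀ i, ∃ a : X.sheaf.obj (U η ⊓ U x), IsUnit a ∧
      M.res inf_le_left (e η i) = a • M.res inf_le_right (e x (σ i)) := by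
    intro x
    have := hη.nontrivial (V := U η ⊓ U x) ⟨hηU η, hηU x⟩
    exact ((he η) (U η ⊓ U x) inf_le_left).exists_equiv ((he x) _ inf_le_right)
  choose σ a ha hσ using hσ
  refine ⟨U, hU, ι η, fun x i => e x (σ x i), fun x => (he x).comp_equiv (σ x), fun x y i => ?_⟩
  have hxy : η ∈ U x ⊓ U y := ⟨hηU x, hηU y⟩
  rcases ((he y).comp_equiv (σ y) (U x ⊓ U y) inf_le_right).span
    (M.res inf_le_left (e x (σ x i))) with h0 | ⟨j, g, hg⟩
  · refine ⟨0, ?_⟩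
    rw [h0, zero_smul]
  -- On the overlap the `i`-th element is a multiple of some `j`-th one; comparing both with the
  -- basis near `η` shows `i = j`.
  · suffices h : i = j by
      subst h
      exact ⟨g, hg⟩
    let W := U η ⊓ (U x ⊓ U y)
    have hW : η ∈ W := ⟨hηU η, hxy⟩
    have l₁ : W ≤ U η ⊓ U x := inf_le_inf_left _ inf_le_left
    have l₂ : W ≤ U η ⊓ U y := inf_le_inf_left _ inf_le_right
    have l₃ : W ≤ U x ⊓ U y := inf_le_right
    have e₁ := congrArg (M.res l₁) (hσ x i)
    have e₂ := congrArg (M.res l₂) (hσ y j)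
    have e₃ := congrArg (M.res l₃) hg
    simp only [PreModule.res_smul, SetPresheaf.res_res] at e₁ e₂ e₃
    rw [e₃, smul_smul] at e₁
    have e₄ := congrArg (fun m => X.sheaf.res l₂ (a y j) • m) e₁
    simp only [smul_smul] at e₄
    rw [mul_comm, mul_smul, ← e₂] at e₄
    exact (((he η).mono (inf_le_left : W ≤ U η)).self.unique
      (hη.ne_zero_of_isUnit hW (isUnit_res l₂ (ha y j))) e₄).1

/-- The summand `L i` consists of the sections that are locally multiples of some `b x i`. Because
the transition functions are diagonal, the choice of `x` does not matter, and `b x i` generates `L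
i` over `U x`. -/
theorem exists_decompOf (hη : IsGeneric X η)
    (hM : ∀ x, ∃ (U : Opens X.carrier) (_ : x ∈ U) (ι : Type u) (e : ι → M.obj U),
      IsBasisOn M.toPreModule U e) :
    ∃ (ι : Type u) (L : ι → OModule X), DecompOf M L := by
  obtain ⟨U, hU, ι, b, hb, htrans⟩ := exists_diagonal hη hM
  let P : ι → ∀ V, M.obj V → Prop := fun i V m =>
    ∀ y ∈ V, ∃ (W : Opens X.carrier) (_ : y ∈ W) (hW : W ≤ V) (x : X.carrier) (hx : W ≤ U x)
      (a : X.sheaf.obj W), M.res hW m = a • M.res hx (b x i)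
  have hres : ∀ i V W (h : W ≤ V) m, P i V m → P i W (M.res h m) := by
    intro i V W h m hm y hy
    obtain ⟨W', hyW', hW', x, hx, a, ha⟩ := hm y (h hy)
    refine ⟨W' ⊓ W, ⟨hyW', hy⟩, inf_le_right, x, inf_le_left.trans hx,
      X.sheaf.res inf_le_left a, ?_⟩
    have := congrArg (M.res (inf_le_left : W' ⊓ W ≤ W')) ha
    rwa [M.res_res, M.res_smul, M.res_res, ← M.res_res h inf_le_right] at this
  let L : ι → OModule X := fun i => M.sub (P i)
    (fun V y hy => ⟨V ⊓ U y, ⟨hy, hU y⟩, inf_le_left, y, inf_le_right, 0, by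
      rw [M.res_zero, zero_smul]⟩)
    (fun V a m hm y hy => by
      obtain ⟨W, hyW, hW, x, hx, c, hc⟩ := hm y hy
      exact ⟨W, hyW, hW, x, hx, X.sheaf.res hW a * c, by rw [M.res_smul, hc, mul_smul]⟩)
    (hres i) (fun V m hm y hy => by
      obtain ⟨W, hyW, hW, h⟩ := hm y hy
      obtain ⟨W', hyW', hW', x, hx, a, ha⟩ := h y hyW
      exact ⟨W', hyW', hW'.trans hW, x, hx, a, by rw [← ha, M.res_res]⟩)
  have hmem : ∀ x i, P i (U x) (b x i) := fun x i y hy =>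
    ⟨U x, hy, le_rfl, x, le_rfl, 1, by rw [one_smul]⟩
  let e : ∀ x i, (L i).obj (U x) := fun x i =>
    (⟨b x i, hmem x i⟩ : {m : M.obj (U x) // P i (U x) m})
  refine ⟨ι, L, U, hU, e, b, fun x i => ?_, hb, fun x y i g hg =>
    congrArg (fun m : {m : M.obj (U x ⊓ U y) // P i _ m} => m.1) hg⟩
  refine hη.isBasisOn_of_local (fun V h hV _ _ a a' _ he => ⟨rfl, ?_⟩) (fun V h m hV y hy => ?_)
  · exact (hb x V h).smul_inj (congrArg (fun m : {m : M.obj V // P i V m} => m.1) he)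
  · obtain ⟨W, hyW, hW, x', hx', a, ha⟩ := m.2 y hy
    refine ⟨W, hyW, hW, Or.inr ⟨(), ?_⟩⟩
    obtain ⟨g, hg⟩ := htrans x' x i
    have hle : W ≤ U x' ⊓ U x := le_inf hx' (hW.trans h)
    have := congrArg (M.res hle) hg
    rw [M.res_res, M.res_smul, M.res_res] at this
    rw [this, smul_smul] at ha
    exact ⟨_, Subtype.ext ha⟩

end OModule

/-! ### Uniqueness of decompositions -/

/-- Over `U x` the two bases of `M` differ by a bijection `σ x` and units `a x`. All overlaps
contain `η`, so `σ x` does not depend on `x`, and the units turn the transition functions of `L' (σ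
i)` into those of `L i`. -/
theorem DecompOn.exists_equiv (hη : IsGeneric X η) {M : OModule X} {ι κ : Type*}
    {L : ι → OModule X} {L' : κ → OModule X} {U : X.carrier → Opens X.carrier} (hU : ∀ x, x ∈ U x)
    {e : ∀ x i, (L i).obj (U x)} {b : ∀ x, ι → M.obj (U x)}
    {e' : ∀ x i, (L' i).obj (U x)} {b' : ∀ x, κ → M.obj (U x)}
    (h : DecompOn M L U e b) (h' : DecompOn M L' U e' b') :
    ∃ σ : ι ≃ κ, ∀ i, Nonempty (L i ≅ L' (σ i)) := by
  have hηU : ∀ x, η ∈ U x := fun x => hη.mem (hU x)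
  have hσ : ∀ x, ∃ σ : ι ≃ κ, ∀ i, ∃ a : X.sheaf.obj (U x), IsUnit a ∧
      b x i = a • b' x (σ i) := fun x => by
    have := hη.nontrivial (hηU x)
    exact (h.basis x).self.exists_equiv (h'.basis x).self
  choose σ a ha hσ using hσ
  -- Expanding `b x i` on the overlap in the basis `b' y`, once through `b' x` and once through `b
  -- y`, compares both the indices and the coefficients.
  have hconst : ∀ x y i (g : X.sheaf.obj (U x ⊓ U y)),
      (L i).res inf_le_left (e x i) = g • (L i).res inf_le_right (e y i) →
      σ x i = σ y i ∧ ∀ g' : X.sheaf.obj (U x ⊓ U y),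
        (L' (σ x i)).res inf_le_left (e' x (σ x i)) =
          g' • (L' (σ x i)).res inf_le_right (e' y (σ x i)) →
        X.sheaf.res inf_le_left (a x i) * g' = g * X.sheaf.res inf_le_right (a y i) := by
    intro x y i g hg
    have hne : (1 : X.sheaf.obj (U x ⊓ U y)) ≠ 0 := hη.one_ne_zero ⟨hηU x, hηU y⟩
    have hx := congrArg (M.res (inf_le_left : U x ⊓ U y ≤ U x)) (hσ x i)
    have hy := congrArg (M.res (inf_le_right : U x ⊓ U y ≤ U y)) (hσ y i)
    rw [M.res_smul] at hx hy
    obtain ⟨g', h1, h2⟩ := h'.exists_trans x y (σ x i)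
    have hb := h.trans x y i g hg
    rw [h2, smul_smul] at hx
    have key := hx.symm.trans hb
    rw [hy, smul_smul] at key
    have h0 : X.sheaf.res inf_le_left (a x i) * g' ≠ 0 := by
      intro h0
      rw [h0, zero_smul] at hx
      exact hne (((h.basis x) _ inf_le_left).smul_eq_zero.1 ((one_smul _ _).trans hx))
    obtain ⟨h3, h4⟩ := ((h'.basis y) _ inf_le_right).unique h0 key
    refine ⟨h3, fun g'' hg'' => ?_⟩
    rw [← h4, ((h'.gen y (σ x i)) _ inf_le_right).smul_inj (i := ()) (hg''.symm.trans h1)]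
  have hσx : ∀ x i, σ x i = σ η i := fun x i => by
    obtain ⟨g, hg, -⟩ := h.exists_trans x η i
    exact (hconst x η i g hg).1
  refine ⟨σ η, fun i => ?_⟩
  refine OModule.nonempty_iso_of_basis hU (fun x _ => e x i) (fun x _ => a x i • e' x (σ η i))
    (fun x => h.gen x i) (fun x => (h'.gen x _).unit_smul fun _ => ha x i) ?_
  intro x y _ _ g hg
  obtain ⟨-, h2⟩ := hconst x y i g hg
  rw [hσx] at h2
  obtain ⟨g', h3, -⟩ := h'.exists_trans x y (σ η i)
  rw [PreModule.res_smul, PreModule.res_smul, h3, smul_smul, smul_smul, h2 g' h3]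

theorem DecompOf.exists_equiv (hη : IsGeneric X η) {M : OModule X} {ι κ : Type*}
    {L : ι → OModule X} {L' : κ → OModule X} (h : DecompOf M L) (h' : DecompOf M L') :
    ∃ σ : ι ≃ κ, ∀ i, Nonempty (L i ≅ L' (σ i)) := by
  obtain ⟨U, hU, e, b, h⟩ := h
  obtain ⟨U', hU', e', b', h'⟩ := h'
  exact DecompOn.exists_equiv hη (U := fun x => U x ⊓ U' x) (fun x => ⟨hU x, hU' x⟩)
    (h.mono fun x => inf_le_left) (h'.mono fun x => inf_le_right)

/-! ### Line bundles and decompositions -/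

/-- Whatever exists near the point `y` exists on all of `U x`; hence one cover serves all modules
and all local liftings at once. -/
theorem exists_minimal_cover (hX : X.IsIntegral) : ∃ U : X.carrier → Opens X.carrier,
    (∀ x, x ∈ U x) ∧ ∀ x, ∃ y ∈ U x, ∀ V : Opens X.carrier, y ∈ V → U x ≤ V := by
  choose A _ c _ hc using hX
  exact ⟨fun x => (c x).range, hc, fun x => (c x).exists_mem_range_forall_le (hc x)⟩

theorem OModule.IsLineBundle.exists_gen (hη : IsGeneric X η) {L : OModule X} (hL : L.IsLineBundle)
    {U : Opens X.carrier} {y : X.carrier} (hU : ∀ V : Opens X.carrier, y ∈ V → U ≤ V) :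
    ∃ e : L.obj U, IsBasisOn L.toPreModule U (fun _ : Unit => e) := by
  obtain ⟨V, hV, e, he⟩ := hL.exists_isBasisOn hη y
  exact ⟨_, he.mono (hU V hV)⟩

theorem DecompOf.of_iso_isLineBundle (hη : IsGeneric X η) (hX : X.IsIntegral) {L L' : OModule X}
    (hL : L.IsLineBundle) (f : L' ≅ L) : DecompOf L' (fun _ : Unit => L) := by
  obtain ⟨U, hU, hmin⟩ := exists_minimal_cover hX
  choose y hy hmin using hmin
  choose e he using fun x => hL.exists_gen hη (hmin x)
  exact DecompOf.of_iso ⟨U, hU, fun x _ => e x, fun x _ => e x, fun x _ => he x, he,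
    fun x y _ g hg => hg⟩ f.symm

theorem DecompOf.isLineBundle (hX : X.IsIntegral) {M : OModule X} {ι : Type*} {L : ι → OModule X}
    (h : DecompOf M L) (i : ι) : (L i).IsLineBundle := by
  obtain ⟨U, hU, e, b, h⟩ := h
  exact OModule.isLineBundle_of_isBasisOn hX fun x => ⟨U x, hU x, e x i, h.gen x i⟩

theorem DecompOf.isBundle (hX : X.IsIntegral) {M : OModule X} {ι : Type u} [Finite ι]
    {L : ι → OModule X} (h : DecompOf M L) : M.IsBundle := by
  obtain ⟨U, hU, e, b, h⟩ := h
  exact OModule.isBundle_of_isBasisOn hX fun x => ⟨U x, hU x, ι, inferInstance, b x, h.basis x⟩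

theorem DecompOf.finite (hη : IsGeneric X η) {M : OModule X} {ι : Type*} {L : ι → OModule X}
    (h : DecompOf M L) (hM : M.IsCoherent) : Finite ι := by
  obtain ⟨U, hU, e, b, h⟩ := h
  exact hM.finite hη (hU η) (h.basis η)

theorem OModule.IsLineBundle.isBundle (hη : IsGeneric X η) (hX : X.IsIntegral) {L : OModule X}
    (hL : L.IsLineBundle) : L.IsBundle :=
  ((DecompOf.of_iso_isLineBundle hη hX hL (Iso.refl L)).reindex
    (Equiv.equivPUnit.{1, u + 1} Unit).symm).isBundle hX

theorem OModule.IsLocallyProjective.exists_decompOf (hη : IsGeneric X η) {M : OModule X}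
    (hM : M.IsLocallyProjective) : ∃ (ι : Type u) (L : ι → OModule X), DecompOf M L :=
  OModule.exists_decompOf hη (hM.exists_isBasisOn hη)

/-! ### Wedge sums -/

open Classical in
/-- The wedge of line bundles is decomposed by them. -/
theorem DecompOf.wedge (hη : IsGeneric X η) (hX : X.IsIntegral) {ι : Type u} {L : ι → OModule X}
    (hL : ∀ i, (L i).IsLineBundle) : DecompOf (OModule.wedge L) L := by
  obtain ⟨U, hU, hmin⟩ := exists_minimal_cover hX
  choose y hy hmin using hmin
  choose e he using fun x i => (hL i).exists_gen hη (hmin x)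
  let b : ∀ x, ι → (OModule.wedge L).obj (U x) := fun x i =>
    (⟨fun j => if j = i then e x j else 0, fun z hz => ⟨U x, hz, le_rfl, fun j k hjk => by
      by_cases hj : j = i
      · right
        have hk : k ≠ i := fun hk => hjk (hj.trans hk.symm)
        simp only [if_neg hk, PreModule.res_zero]
      · left
        simp only [if_neg hj, PreModule.res_zero]⟩⟩ : (OModule.wedgeSet L).obj (U x))
  have hb : ∀ x V (h : V ≤ U x) i (a : X.sheaf.obj V) j,
      (show (OModule.wedgeSet L).obj V from a • (OModule.wedge L).res h (b x i)).1 j =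
        if j = i then a • (L j).res h (e x j) else 0 := by
    intro x V h i a j
    change a • (L j).res h (if j = i then e x j else 0) = _
    by_cases hj : j = i
    · rw [if_pos hj, if_pos hj]
    · rw [if_neg hj, if_neg hj, PreModule.res_zero, smul_zero]
  refine ⟨U, hU, e, b, he, fun x => ?_, fun x y i g hg => ?_⟩
  · refine hη.isBasisOn_of_local (fun V h hV i j a a' ha hab => ?_) (fun V h m hV z hz => ?_)
    · have key := congrFun (congrArg Subtype.val hab) i
      have h1 := (hb x V h i a i).symm.trans (key.trans (hb x V h j a' i))
      rw [if_pos rfl] at h1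
      by_cases hij : i = j
      · rw [if_pos hij] at h1
        exact ⟨hij, (he x i V h).smul_inj (i := ()) h1⟩
      · rw [if_neg hij] at h1
        exact absurd ((he x i V h).smul_eq_zero (i := ()).1 h1) ha
    · obtain ⟨W, hzW, hW, H⟩ := m.2 z hz
      refine ⟨W, hzW, hW, ?_⟩
      -- On `W` at most one coordinate is nonzero, and that one is a multiple of the generator.
      by_cases hm : ∃ i, (L i).res hW (m.1 i) ≠ 0
      · obtain ⟨i, hi⟩ := hm
        obtain ⟨a, ha⟩ := (he x i).exists_smul_of_unit (hW.trans h) ((L i).res hW (m.1 i))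
        refine Or.inr ⟨i, a, Subtype.ext (funext fun j => ?_)⟩
        refine Eq.trans ?_ (hb x W (hW.trans h) i a j).symm
        change (L j).res hW (m.1 j) = _
        by_cases hj : j = i
        · subst hj
          rw [if_pos rfl, ha]
        · rw [if_neg hj]
          exact (H j i hj).resolve_right hi
      · push Not at hm
        exact Or.inl (Subtype.ext (funext hm))
  · refine Subtype.ext (funext fun j => Eq.trans ?_ (hb y _ inf_le_right i g j).symm)
    refine Eq.trans ?_ ((hb x _ inf_le_left i 1 j).trans ?_)
    · exact (one_smul (X.sheaf.obj (U x ⊓ U y)) _).symm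
    · by_cases hj : j = i
      · subst hj
        rw [if_pos rfl, if_pos rfl, one_smul, hg]
      · rw [if_neg hj, if_neg hj]

end

/-! ### Admissible exact sequences split at the level of decompositions -/

section

variable {X : MonoidalSpace.{u}} {η : X.carrier}

/-! ### Admissible exact sequences -/

theorem SetPresheaf.exists_res_eq_of_germ_eq {Y : Type u} [TopologicalSpace Y]
    {F : SetPresheaf Y} {U : Opens Y} {x : Y} {hx : x ∈ U} {s t : F.obj U}
    (h : F.germ hx s = F.germ hx t) :
    ∃ (V : Opens Y) (_ : x ∈ V) (hV : V ≤ U), F.res hV s = F.res hV t := by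
  obtain ⟨W, hxW, h1, h2, e⟩ := Quotient.exact h
  exact ⟨W, hxW, h1, e⟩

theorem SetPresheaf.germ_eq_of_res_eq {Y : Type u} [TopologicalSpace Y]
    {F : SetPresheaf Y} {U V : Opens Y} {x : Y} {hx : x ∈ U} {s t : F.obj U} (hV : V ≤ U)
    (hxV : x ∈ V) (h : F.res hV s = F.res hV t) : F.germ hx s = F.germ hx t := by
  rw [← F.germ_res hV hxV, h, F.germ_res]

theorem SetPresheaf.exists_germ_eq {Y : Type u} [TopologicalSpace Y] {F : SetPresheaf Y} {x : Y}
    (a b : F.Stalk x) : ∃ (U : Opens Y) (hx : x ∈ U) (s t : F.obj U),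
      F.germ hx s = a ∧ F.germ hx t = b := by
  obtain ⟨⟨⟨U, hU⟩, s⟩, rfl⟩ := Quotient.exists_rep a
  obtain ⟨⟨⟨V, hV⟩, t⟩, rfl⟩ := Quotient.exists_rep b
  exact ⟨U ⊓ V, ⟨hU, hV⟩, F.res inf_le_left s, F.res inf_le_right t, F.germ_res _ _ _,
    F.germ_res _ _ _⟩

namespace OModule

variable {M N M₁ M₂ M₃ : OModule X} {f : Hom M₁ M₂} {g : Hom M₂ M₃}

theorem Hom.stalkMap_germ (f : Hom M N) {U : Opens X.carrier} {x : X.carrier} (hx : x ∈ U)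
    (m : M.obj U) : f.stalkMap x (M.germ hx m) = N.germ hx (f.app U m) := rfl

theorem Hom.map_zero (f : Hom M N) (U : Opens X.carrier) : f.app U 0 = 0 :=
  map_zero_of_map_smul (f.map_smul U)

/-- Normality settles the points at which the image has a nonzero germ; near the others the image
vanishes and `h0` takes over. -/
theorem Hom.IsNormal.eq_of_app_eq (hf : f.IsNormal) {U : Opens X.carrier} {m m' : M₁.obj U}
    (h : f.app U m = f.app U m')
    (h0 : ∀ (V : Opens X.carrier) (hV : V ≤ U), M₂.res hV (f.app U m) = 0 →
      M₁.res hV m = M₁.res hV m') : m = m' := by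
  refine M₁.isSheaf.ext fun x hx => ?_
  by_cases hs : f.stalkMap x (M₁.germ hx m) = M₂.stalkZero x
  · rw [f.stalkMap_germ, M₂.stalkZero_eq hx] at hs
    obtain ⟨V, hxV, hV, e⟩ := SetPresheaf.exists_res_eq_of_germ_eq hs
    rw [M₂.res_zero] at e
    exact ⟨V, hxV, hV, h0 V hV e⟩
  · refine SetPresheaf.exists_res_eq_of_germ_eq (hf x _ (M₁.germ hx m') ?_ hs)
    rw [f.stalkMap_germ, f.stalkMap_germ, h]

namespace IsAdmissibleExact

theorem left_injective (h : IsAdmissibleExact f g) (U : Opens X.carrier) :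
    Function.Injective (f.app U) := by
  intro m m' e
  refine h.normal_left.eq_of_app_eq e fun V hV h0 => ?_
  have h1 := h0
  rw [e] at h1
  rw [← f.map_res, h.exact_left] at h0 h1
  rw [h0, h1]

/-- A nonzero multiple of a basis element does not vanish on any nonempty open set, so normality of
`g` makes its preimage unique. This is the source of all splittings. -/
theorem eq_of_app_eq_smul (h : IsAdmissibleExact f g) (hη : IsGeneric X η) {U : Opens X.carrier}
    {κ : Type*} {e : κ → M₃.obj U} (he : IsBasisOn M₃.toPreModule U e) {V : Opens X.carrier}
    (hV : V ≤ U) {m m' : M₂.obj V} {a : X.sheaf.obj V} (ha : a ≠ 0) {j : κ}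
    (h1 : g.app V m = a • M₃.res hV (e j)) (h2 : g.app V m' = a • M₃.res hV (e j)) : m = m' := by
  refine h.normal_right.eq_of_app_eq (h1.trans h2.symm) fun W hW h0 => ?_
  by_cases hηW : η ∈ W
  · rw [h1, M₃.res_smul, M₃.res_res] at h0
    exact absurd ((he W (hW.trans hV)).smul_eq_zero.1 h0) (hη.res_ne_zero hW hηW ha)
  · exact eq_of_one_eq_zero (hη.one_eq_zero_of_notMem hηW) _ _

/-- Exactness provides preimages locally only; they glue because `f` is injective on sections. -/
theorem exists_app_eq (h : IsAdmissibleExact f g) {U : Opens X.carrier} {m : M₂.obj U}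
    (hm : g.app U m = 0) : ∃ n, f.app U n = m := by
  have H := (h.exact_mid U m).1 hm
  choose V hxV hV n hn using H
  obtain ⟨t, ht⟩ := M₁.isSheaf.glue_of_mem V hxV hV n (by
    intro x hx y hy W h1 h2
    refine h.left_injective W ?_
    rw [f.map_res, f.map_res, hn, hn, M₂.res_res, M₂.res_res])
  exact ⟨t, M₂.isSheaf.ext fun x hx => ⟨V x hx, hxV x hx, hV x hx, by
    rw [← f.map_res, ht, hn]⟩⟩

/-- A section of `M₂` that `g` kills comes from `M₁`. Any other has image `a • g (c j)` with `a ≠ 0`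
and equals `a • c j` by uniqueness of preimages. -/
theorem isBasisOn (h : IsAdmissibleExact f g) (hη : IsGeneric X η) {U : Opens X.carrier}
    {ι κ : Type*} {b₁ : ι → M₁.obj U} {c : κ → M₂.obj U} (hb₁ : IsBasisOn M₁.toPreModule U b₁)
    (hc : IsBasisOn M₃.toPreModule U (fun j => g.app U (c j))) :
    IsBasisOn M₂.toPreModule U (Sum.elim (fun i => f.app U (b₁ i)) c) := by
  intro V hV
  have hgf : ∀ n, g.app V (f.app V n) = 0 := fun n => (h.exact_mid V _).2 fun x hx =>
    ⟨V, hx, le_rfl, n, by rw [M₂.res_id]⟩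
  have hg : ∀ (a : X.sheaf.obj V) j, g.app V (a • M₂.res hV (c j)) =
      a • M₃.res hV (g.app U (c j)) := fun a j => by rw [g.map_smul, g.map_res]
  have hf : ∀ (a : X.sheaf.obj V) i, a • M₂.res hV (f.app U (b₁ i)) =
      f.app V (a • M₁.res hV (b₁ i)) := fun a i => by rw [f.map_smul, f.map_res]
  -- Multiples of the two kinds of basis elements coincide only at `0`: applying `g` kills the first
  -- kind and not the second.
  have hmix : ∀ (a b : X.sheaf.obj V) i j,
      a • M₂.res hV (f.app U (b₁ i)) = b • M₂.res hV (c j) → a = 0 ∧ b = 0 := by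
    intro a b i j e
    have e' := congrArg (g.app V) e
    rw [hg, hf, hgf] at e'
    have hb0 := (hc V hV).smul_eq_zero.1 e'.symm
    rw [hb0, zero_smul, hf, h.exact_left] at e
    exact ⟨(hb₁ V hV).smul_eq_zero.1 e, hb0⟩
  refine ⟨fun m => ?_, fun {k l a b} ha e => ?_⟩
  · rcases (hc V hV).span (g.app V m) with h0 | ⟨j, a, hja⟩
    · obtain ⟨n, rfl⟩ := h.exists_app_eq h0
      rcases (hb₁ V hV).span n with rfl | ⟨i, a, rfl⟩
      · exact Or.inl (f.map_zero V)
      · exact Or.inr ⟨Sum.inl i, a, (hf a i).symm⟩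
    · by_cases ha : a = 0
      · rw [ha, zero_smul] at hja
        obtain ⟨n, rfl⟩ := h.exists_app_eq hja
        rcases (hb₁ V hV).span n with rfl | ⟨i, a, rfl⟩
        · exact Or.inl (f.map_zero V)
        · exact Or.inr ⟨Sum.inl i, a, (hf a i).symm⟩
      · exact Or.inr ⟨Sum.inr j, a, h.eq_of_app_eq_smul hη hc hV ha hja (hg a j)⟩
  · rcases k with i | j <;> rcases l with i' | j'
    · obtain ⟨h1, h2⟩ := (hb₁ V hV).unique ha
        (h.left_injective V ((hf a i).symm.trans (e.trans (hf b i'))))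
      exact ⟨congrArg _ h1, h2⟩
    · exact absurd (hmix _ _ _ _ e).1 ha
    · exact absurd (hmix _ _ _ _ e.symm).2 ha
    · obtain ⟨h1, h2⟩ := (hc V hV).unique ha
        ((hg a j).symm.trans ((congrArg (g.app V) e).trans (hg b j')))
      exact ⟨congrArg _ h1, h2⟩

end IsAdmissibleExact

end OModule

/-- The data near `y x` restrict to `U x`, so decompositions of several modules can be moved to one
prescribed cover. -/
theorem DecompOf.exists_of_minimal {M : OModule X} {ι : Type*} {L : ι → OModule X}
    (h : DecompOf M L) {U : X.carrier → Opens X.carrier} {y : X.carrier → X.carrier}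
    (hU : ∀ x (V : Opens X.carrier), y x ∈ V → U x ≤ V) :
    ∃ (e : ∀ x i, (L i).obj (U x)) (b : ∀ x, ι → M.obj (U x)), DecompOn M L U e b := by
  obtain ⟨V, hV, e, b, h⟩ := h
  have h' : DecompOn M L (fun x => V (y x)) (fun x => e (y x)) (fun x => b (y x)) :=
    ⟨fun x => h.gen (y x), fun x => h.basis (y x), fun x x' => h.trans (y x) (y x')⟩
  exact ⟨_, _, h'.mono fun x => hU x _ (hV (y x))⟩

/-- Over the minimal open sets the basis of `M₃` lifts to `M₂`. Since lifts are unique, an equation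
between basis elements of `M₃` on an overlap holds for the lifts, so they have the transition
functions of `L'`. -/
theorem OModule.IsAdmissibleExact.decompOf (hη : IsGeneric X η) (hX : X.IsIntegral)
    {M₁ M₂ M₃ : OModule X} {f : OModule.Hom M₁ M₂} {g : OModule.Hom M₂ M₃}
    (h : OModule.IsAdmissibleExact f g) {ι κ : Type*} {L : ι → OModule X} {L' : κ → OModule X}
    (h₁ : DecompOf M₁ L) (h₃ : DecompOf M₃ L') : DecompOf M₂ (Sum.elim L L') := by
  obtain ⟨U, hU, hmin⟩ := exists_minimal_cover hX
  choose y hy hmin using hmin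
  obtain ⟨e, b, h₁⟩ := h₁.exists_of_minimal hmin
  obtain ⟨e', b', h₃⟩ := h₃.exists_of_minimal hmin
  have hc : ∀ x j, ∃ c : M₂.obj (U x), g.app _ c = b' x j := by
    intro x j
    obtain ⟨V, hV, hVU, m, hm⟩ := h.exact_right _ (b' x j) (y x) (hy x)
    -- A preimage near `y x` is already defined on all of `U x`.
    obtain rfl : V = U x := le_antisymm hVU (hmin x V hV)
    exact ⟨m, by rw [hm, M₃.res_id]⟩
  choose c hc using hc
  have hb : ∀ x, IsBasisOn M₂.toPreModule (U x) (Sum.elim (fun i => f.app _ (b x i)) (c x)) :=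
    fun x => h.isBasisOn hη (h₁.basis x) (by simp only [hc]; exact h₃.basis x)
  refine ⟨U, hU, fun x k => match k with
    | .inl i => e x i
    | .inr j => e' x j, fun x => Sum.elim (fun i => f.app _ (b x i)) (c x),
    ⟨fun x k => ?_, hb, fun x x' k a ha => ?_⟩⟩
  · rcases k with i | j
    · exact h₁.gen x i
    · exact h₃.gen x j
  · rcases k with i | j
    · have := congrArg (f.app _) (h₁.trans x x' i a ha)
      rwa [f.map_smul, f.map_res, f.map_res] at this
    · have hne : (1 : X.sheaf.obj (U x ⊓ U x')) ≠ 0 :=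
        hη.one_ne_zero ⟨hη.mem (hU x), hη.mem (hU x')⟩
      refine h.eq_of_app_eq_smul hη (h₃.basis x) inf_le_left hne (j := j) ?_ ?_
      · rw [Sum.elim_inr, one_smul, g.map_res, hc]
      · rw [Sum.elim_inr, one_smul, g.map_smul, g.map_res, hc, h₃.trans x x' j a ha]

/-! ### Wedges of two modules -/

namespace OModule

/-- The family consisting of two modules. -/
def pair (M N : OModule X) : ULift.{u} Bool → OModule X
  | ⟨true⟩ => M
  | ⟨false⟩ => N

variable (M N : OModule X)

/-- The inclusion of the first summand. -/
def wedgeInl : Hom M (wedge (pair M N)) where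
  app U m := (⟨fun k => match k with
    | ⟨true⟩ => m
    | ⟨false⟩ => (0 : N.obj U), fun x hx => ⟨U, hx, le_rfl, by
      rintro ⟨_ | _⟩ ⟨_ | _⟩ h
      · exact absurd rfl h
      · exact Or.inl (N.res_zero _)
      · exact Or.inr (N.res_zero _)
      · exact absurd rfl h⟩⟩ : (wedgeSet (pair M N)).obj U)
  map_smul U a m := Subtype.ext (funext (by
    rintro ⟨_ | _⟩
    · exact (smul_zero (A := N.obj U) a).symm
    · rfl))
  map_res h m := Subtype.ext (funext (by
    rintro ⟨_ | _⟩
    · exact (N.res_zero h).symm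
    · rfl))

/-- The inclusion of the second summand. -/
def wedgeInr : Hom N (wedge (pair M N)) where
  app U n := (⟨fun k => match k with
    | ⟨true⟩ => (0 : M.obj U)
    | ⟨false⟩ => n, fun x hx => ⟨U, hx, le_rfl, by
      rintro ⟨_ | _⟩ ⟨_ | _⟩ h
      · exact absurd rfl h
      · exact Or.inr (M.res_zero _)
      · exact Or.inl (M.res_zero _)
      · exact absurd rfl h⟩⟩ : (wedgeSet (pair M N)).obj U)
  map_smul U a m := Subtype.ext (funext (by
    rintro ⟨_ | _⟩
    · rfl
    · exact (smul_zero (A := M.obj U) a).symm))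
  map_res h m := Subtype.ext (funext (by
    rintro ⟨_ | _⟩
    · rfl
    · exact (M.res_zero h).symm))

/-- The projection to the second summand. -/
def wedgeSnd : Hom (wedge (pair M N)) N where
  app U m := m.1 ⟨false⟩
  map_smul U a m := rfl
  map_res h m := rfl

theorem wedge_pair_ext {U : Opens X.carrier} {m m' : (wedge (pair M N)).obj U}
    (h1 : m.1 ⟨true⟩ = m'.1 ⟨true⟩) (h2 : m.1 ⟨false⟩ = m'.1 ⟨false⟩) : m = m' :=
  Subtype.ext (funext (by
    rintro ⟨_ | _⟩
    · exact h2
    · exact h1))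

/-- The projection is normal because where the germ of the second coordinate is nonzero, the first
coordinate vanishes nearby, so the germ is determined by its image. -/
theorem isAdmissibleExact_wedge : IsAdmissibleExact (wedgeInl M N) (wedgeSnd M N) where
  exact_left U m := by
    refine ⟨fun h => congrFun (congrArg Subtype.val h) ⟨true⟩, ?_⟩
    rintro rfl
    exact Hom.map_zero _ U
  exact_mid U m := by
    constructor
    · intro h x hx
      refine ⟨U, hx, le_rfl, m.1 ⟨true⟩, ?_⟩
      rw [SetPresheaf.res_id]
      exact wedge_pair_ext M N rfl h.symm
    · intro h
      refine N.isSheaf.ext fun x hx => ?_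
      obtain ⟨V, hxV, hV, n, hn⟩ := h x hx
      refine ⟨V, hxV, hV, ?_⟩
      rw [← (wedgeSnd M N).map_res, ← hn, N.res_zero]
      rfl
  exact_right U n x hx := ⟨U, hx, le_rfl, (wedgeInr M N).app U n, (N.res_id _ n).symm⟩
  normal_left x a b h _ := by
    obtain ⟨U, hx, m, m', rfl, rfl⟩ := SetPresheaf.exists_germ_eq a b
    obtain ⟨V, hxV, hV, e⟩ := SetPresheaf.exists_res_eq_of_germ_eq h
    refine SetPresheaf.germ_eq_of_res_eq hV hxV ?_
    exact congrFun (congrArg Subtype.val e) ⟨true⟩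
  normal_right x a b h h0 := by
    obtain ⟨U, hx, m, m', rfl, rfl⟩ := SetPresheaf.exists_germ_eq a b
    have key : ∀ n : (wedge (pair M N)).obj U,
        (wedgeSnd M N).stalkMap x ((wedge (pair M N)).germ hx n) ≠ N.stalkZero x →
        ∃ (V : Opens X.carrier) (_ : x ∈ V) (hV : V ≤ U), M.res hV (n.1 ⟨true⟩) = 0 := by
      intro n hn
      obtain ⟨V, hxV, hV, H⟩ := n.2 x hx
      refine ⟨V, hxV, hV, (H ⟨true⟩ ⟨false⟩ (by simp)).resolve_right fun e => hn ?_⟩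
      rw [N.stalkZero_eq hx]
      exact SetPresheaf.germ_eq_of_res_eq hV hxV (e.trans (N.res_zero hV).symm)
    obtain ⟨V, hxV, hV, e⟩ := SetPresheaf.exists_res_eq_of_germ_eq h
    obtain ⟨V₁, hxV₁, hV₁, e₁⟩ := key m h0
    obtain ⟨V₂, hxV₂, hV₂, e₂⟩ := key m' (h ▸ h0)
    refine SetPresheaf.germ_eq_of_res_eq (V := V ⊓ (V₁ ⊓ V₂)) (inf_le_left.trans hV)
      ⟨hxV, hxV₁, hxV₂⟩ (wedge_pair_ext M N ?_ ?_)
    · have l₁ : V ⊓ (V₁ ⊓ V₂) ≤ V₁ := inf_le_right.trans inf_le_left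
      have l₂ : V ⊓ (V₁ ⊓ V₂) ≤ V₂ := inf_le_right.trans inf_le_right
      have e₁' := (M.res_res hV₁ l₁ (m.1 ⟨true⟩)).symm.trans
        ((congrArg (M.res l₁) e₁).trans (M.res_zero l₁))
      have e₂' := (M.res_res hV₂ l₂ (m'.1 ⟨true⟩)).symm.trans
        ((congrArg (M.res l₂) e₂).trans (M.res_zero l₂))
      exact e₁'.trans e₂'.symm
    · have l : V ⊓ (V₁ ⊓ V₂) ≤ V := inf_le_left
      exact (N.res_res hV l (m.1 ⟨false⟩)).symm.trans
        ((congrArg (N.res l) e).trans (N.res_res hV l (m'.1 ⟨false⟩)))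

end OModule

end

/-! ### `K₀` as the free abelian group on the Picard group -/

section

variable {X : MonoidalSpace.{u}} {η : X.carrier}

/-! ### The Grothendieck group -/

namespace OModule

variable {M N Z : OModule X}

/-- The morphism to a trivial module. -/
def zeroHom (M Z : OModule X) : Hom M Z where
  app _ _ := 0
  map_smul _ a _ := (smul_zero a).symm
  map_res h _ := (Z.res_zero h).symm

/-- The relations of `K₀` do not mention isomorphisms; this sequence, with trivial third term, makes
classes isomorphism invariant. -/
theorem isAdmissibleExact_of_iso (e : M ≅ N) (hZ : ∀ U, Subsingleton (Z.obj U)) :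
    IsAdmissibleExact (M₁ := M) (M₂ := N) (M₃ := Z) e.hom (zeroHom N Z) where
  exact_left U m := by
    refine ⟨fun h => ?_, fun h => h ▸ Hom.map_zero _ U⟩
    rw [← iso_inv_app_hom e U m, h, Hom.map_zero]
  exact_mid U m := ⟨fun _ x hx => ⟨U, hx, le_rfl, Hom.app e.inv U m, by
    rw [iso_hom_app_inv, N.res_id]⟩, fun _ => (hZ U).elim _ _⟩
  exact_right U m x hx := ⟨U, hx, le_rfl, 0, (hZ U).elim _ _⟩
  normal_left x a b h _ := by
    obtain ⟨U, hx, m, m', rfl, rfl⟩ := SetPresheaf.exists_germ_eq a b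
    obtain ⟨V, hxV, hV, h'⟩ := SetPresheaf.exists_res_eq_of_germ_eq h
    refine SetPresheaf.germ_eq_of_res_eq hV hxV ?_
    have h'' : Hom.app e.hom V (M.res hV m) = Hom.app e.hom V (M.res hV m') :=
      (Hom.map_res e.hom hV m).trans (h'.trans (Hom.map_res e.hom hV m').symm)
    rw [← iso_inv_app_hom e V (M.res hV m), h'', iso_inv_app_hom]
  normal_right x a b _ h0 := by
    obtain ⟨U, hx, m, m', rfl, rfl⟩ := SetPresheaf.exists_germ_eq a b
    exact absurd (Z.stalkZero_eq hx).symm h0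

end OModule

namespace K0

variable {M M₁ M₂ M₃ : OModule X}

theorem mk_eq_add {f : OModule.Hom M₁ M₂} {g : OModule.Hom M₂ M₃}
    (h : OModule.IsAdmissibleExact f g) (h₁ : M₁.IsBundle) (h₂ : M₂.IsBundle)
    (h₃ : M₃.IsBundle) : K0.mk M₂ h₂ = K0.mk M₁ h₁ + K0.mk M₃ h₃ := by
  have := (QuotientAddGroup.eq_zero_iff (N := AddSubgroup.closure (k0Relations X)) _).2
    (AddSubgroup.subset_closure ⟨⟨M₁, h₁⟩, ⟨M₂, h₂⟩, ⟨M₃, h₃⟩, f, g, h, rfl⟩)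
  rw [QuotientAddGroup.mk_sub, QuotientAddGroup.mk_sub, sub_sub, sub_eq_zero] at this
  exact this

theorem hom_ext {G : Type*} [AddCommGroup G] {f g : K0 X →+ G}
    (h : ∀ M : Bundle X, f (K0.mk M.1 M.2) = g (K0.mk M.1 M.2)) : f = g := by
  exact QuotientAddGroup.addMonoidHom_ext _ (FreeAbelianGroup.lift_ext _ _ h)

theorem exists_lift {G : Type*} [AddCommGroup G] (d : Bundle X → G)
    (hd : ∀ (M₁ M₂ M₃ : Bundle X) (f : OModule.Hom M₁.1 M₂.1) (g : OModule.Hom M₂.1 M₃.1),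
      OModule.IsAdmissibleExact f g → d M₂ = d M₁ + d M₃) :
    ∃ f : K0 X →+ G, ∀ M : Bundle X, f (K0.mk M.1 M.2) = d M := by
  refine ⟨QuotientAddGroup.lift _ (FreeAbelianGroup.lift d) ?_, fun M => ?_⟩
  · rw [AddSubgroup.closure_le]
    rintro _ ⟨M₁, M₂, M₃, f, g, h, rfl⟩
    simp [FreeAbelianGroup.lift_apply_of, hd _ _ _ f g h]
  · exact FreeAbelianGroup.lift_apply_of _ _

/-- The sequence with all three terms `M` is admissible and gives `[M] = [M] + [M]`. -/
theorem mk_eq_zero (hM : M.IsBundle) (h : ∀ U, Subsingleton (M.obj U)) : K0.mk M hM = 0 := by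
  have := mk_eq_add (OModule.isAdmissibleExact_of_iso (Iso.refl M) h) hM hM hM
  rwa [left_eq_add] at this

end K0

theorem DecompOf.subsingleton {M : OModule X} {ι : Type*} [IsEmpty ι] {L : ι → OModule X}
    (h : DecompOf M L) (V : Opens X.carrier) : Subsingleton (M.obj V) := by
  obtain ⟨U, hU, e, b, h⟩ := h
  have key : ∀ m : M.obj V, m = 0 := fun m => M.isSheaf.ext fun x hx => by
    refine ⟨V ⊓ U x, ⟨hx, hU x⟩, inf_le_left, ?_⟩
    obtain h0 | ⟨i, -⟩ := ((h.basis x) _ (inf_le_right : V ⊓ U x ≤ U x)).span (M.res inf_le_left m)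
    · rw [h0, M.res_zero]
    · exact isEmptyElim i
  exact ⟨fun m m' => (key m).trans (key m').symm⟩

namespace K0

variable {M N : OModule X}

theorem mk_eq_mk (hη : IsGeneric X η) (hX : X.IsIntegral) (hM : M.IsBundle) (hN : N.IsBundle)
    (e : M ≅ N) : K0.mk M hM = K0.mk N hN := by
  -- The empty wedge supplies the trivial third term.
  have hZ := DecompOf.wedge hη hX (ι := PEmpty.{u + 1}) (L := fun i => i.elim) (fun i => i.elim)
  have := mk_eq_add (OModule.isAdmissibleExact_of_iso e hZ.subsingleton) hM hN (hZ.isBundle hX)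
  rw [this, mk_eq_zero _ hZ.subsingleton, add_zero]

/-- Induction on the index set: the wedge of one line bundle with the wedge of the others sits in an
admissible sequence, and it is isomorphic to `M` because both have the same decomposition. -/
theorem mk_eq_sum (hη : IsGeneric X η) (hX : X.IsIntegral) {ι : Type u} [Fintype ι]
    {L : ι → OModule X} (h : DecompOf M L) (hM : M.IsBundle) :
    K0.mk M hM = ∑ i, K0.mk (L i) ((h.isLineBundle hX i).isBundle hη hX) := by
  -- That the `L i` are line bundles becomes a separate hypothesis, so that the summands do not
  -- depend on the decomposition, which varies in the induction.
  refine Fintype.induction_empty_option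
    (P := fun ι _ => ∀ (L : ι → OModule X) (hL : ∀ i, (L i).IsLineBundle) (M : OModule X)
      (_ : DecompOf M L) (hM : M.IsBundle), K0.mk M hM = ∑ i, K0.mk (L i) ((hL i).isBundle hη hX))
    ?_ ?_ ?_ ι L (h.isLineBundle hX) M h hM
  · intro α β _ e H L hL M h hM
    let : Fintype α := Fintype.ofEquiv β e.symm
    rw [H (fun a => L (e a)) (fun a => hL _) M (h.reindex e) hM]
    exact Fintype.sum_equiv e _ _ fun _ => rfl
  · intro L hL M h hM
    rw [mk_eq_zero hM h.subsingleton]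
    exact (Finset.sum_of_isEmpty _).symm
  · intro α _ H L hL M h hM
    have hW := DecompOf.wedge hη hX (fun i => hL (some i))
    have h1 : DecompOf (L none) (fun _ : Unit => L none) :=
      DecompOf.of_iso_isLineBundle hη hX (hL none) (Iso.refl _)
    have hs := OModule.isAdmissibleExact_wedge (OModule.wedge fun i => L (some i)) (L none)
    have hd := ((hs.decompOf hη hX hW h1).reindex (Equiv.optionEquivSumPUnit.{0} α))
    have hL' : (fun k => Sum.elim (fun i => L (some i)) (fun _ : Unit => L none)
        (Equiv.optionEquivSumPUnit.{0} α k)) = L := by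
      funext k
      cases k <;> rfl
    rw [hL'] at hd
    obtain ⟨e⟩ := h.nonempty_iso hd
    rw [mk_eq_mk hη hX hM (hd.isBundle hX) e,
      mk_eq_add hs (hW.isBundle hX) (hd.isBundle hX) ((hL none).isBundle hη hX),
      H _ (fun i => hL (some i)) _ hW (hW.isBundle hX), Fintype.sum_option, add_comm]

/-- `K₀(X)` is free on the isomorphism classes of line bundles. -/
theorem exists_addEquiv (hη : IsGeneric X η) (hX : X.IsIntegral) :
    ∃ e : (Pic X →₀ ℤ) ≃+ K0 X, ∀ L (hL : OModule.IsLineBundle L),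
      e (Finsupp.single (Pic.mk L hL) 1) = K0.mk L (hL.isBundle hη hX) := by
  let c : Pic X → K0 X := Quotient.lift (fun L => K0.mk L.1 (L.2.isBundle hη hX)) (by
    rintro L L' ⟨f⟩
    exact mk_eq_mk hη hX _ _ f)
  let F : (Pic X →₀ ℤ) →+ K0 X := Finsupp.liftAddHom fun p => (zmultiplesHom _) (c p)
  have hF : ∀ L (hL : OModule.IsLineBundle L),
      F (Finsupp.single (Pic.mk L hL) 1) = K0.mk L (hL.isBundle hη hX) := fun L hL => by
    change F (Finsupp.single (Pic.mk L hL) 1) = c (Pic.mk L hL)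
    simp [F]
  have hdec : ∀ M : Bundle X, ∃ (ι : Type u) (_ : Fintype ι) (L : ι → OModule X),
      DecompOf M.1 L := fun M => by
    obtain ⟨ι, L, h⟩ := M.2.1.exists_decompOf hη
    have := h.finite hη M.2.2
    exact ⟨ι, Fintype.ofFinite ι, L, h⟩
  choose I _ L hL using hdec
  -- The candidate inverse sums the classes in a chosen decomposition; `hd` shows by uniqueness that
  -- the choice is immaterial.
  let d : Bundle X → (Pic X →₀ ℤ) := fun M =>
    ∑ i, Finsupp.single (Pic.mk (L M i) ((hL M).isLineBundle hX i)) 1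
  have hd : ∀ (M : Bundle X) (κ : Type u) [Fintype κ] (L' : κ → OModule X) (h : DecompOf M.1 L'),
      d M = ∑ k, Finsupp.single (Pic.mk (L' k) (h.isLineBundle hX k)) 1 := by
    intro M κ _ L' h
    obtain ⟨σ, hσ⟩ := (hL M).exists_equiv hη h
    refine Fintype.sum_equiv σ _ _ fun i => ?_
    exact congrArg (fun p => Finsupp.single p 1) (Quotient.sound (hσ i))
  -- Additivity: the middle term of an admissible sequence is decomposed by the union of the line
  -- bundles of the outer terms.
  obtain ⟨D, hD⟩ := exists_lift d (by
    intro M₁ M₂ M₃ f g h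
    rw [hd M₂ _ _ (h.decompOf hη hX (hL M₁) (hL M₃)), Fintype.sum_sum_type]
    rfl)
  have h1 : F.comp D = AddMonoidHom.id _ := hom_ext fun M => by
    rw [AddMonoidHom.comp_apply, hD, map_sum, AddMonoidHom.id_apply,
      mk_eq_sum hη hX (hL M) M.2]
    exact Finset.sum_congr rfl fun i _ => hF _ _
  have h2 : D.comp F = AddMonoidHom.id _ := by
    refine Finsupp.addHom_ext' fun p => AddMonoidHom.ext_int ?_
    induction p using Quotient.inductionOn with | _ L =>
    change D (F (Finsupp.single (Pic.mk L.1 L.2) 1)) = Finsupp.single (Pic.mk L.1 L.2) 1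
    let B : Bundle X := ⟨L.1, L.2.isBundle hη hX⟩
    have hB : DecompOf B.1 (fun _ : PUnit.{u + 1} => L.1) :=
      (DecompOf.of_iso_isLineBundle hη hX L.2 (Iso.refl _)).reindex Equiv.punitEquivPUnit
    exact (congrArg D (hF L.1 L.2)).trans ((hD B).trans ((hd B _ _ hB).trans
      (Fintype.sum_unique _)))
  exact ⟨AddMonoidHom.toAddEquiv F D h2 h1, hF⟩

theorem exists_basis (hη : IsGeneric X η) (hX : X.IsIntegral) :
    ∃ b : Module.Basis (Pic X) ℤ (K0 X), ∀ L (hL : OModule.IsLineBundle L),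
      ∃ hB : L.IsBundle, b (Pic.mk L hL) = K0.mk L hB := by
  obtain ⟨e, he⟩ := exists_addEquiv hη hX
  exact ⟨.ofRepr e.symm.toIntLinearEquiv, fun L hL => ⟨_, he L hL⟩⟩

end K0

end

/-! ### Duals, and the group laws for line bundles up to isomorphism -/

section

variable {X : MonoidalSpace.{u}} {η : X.carrier}

/-! ### The dual module -/

section Dual

namespace LocalHom

variable {T T' : PreModule X} {U V W : Opens X.carrier}

theorem ext {l l' : LocalHom T T' U} (h : ∀ V hV m, l.app V hV m = l'.app V hV m) : l = l' := by
  obtain ⟨f, _, _⟩ := l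
  obtain ⟨f', _, _⟩ := l'
  obtain rfl : f = f' := by
    funext V hV m
    exact h V hV m
  rfl

/-- The restriction of a morphism to a smaller open subset. -/
def restrict (h : V ≤ U) (l : LocalHom T T' U) : LocalHom T T' V where
  app W hW := l.app W (hW.trans h)
  map_smul W hW := l.map_smul W _
  map_res hW hW' := l.map_res (hW.trans h) hW'

instance : Zero (LocalHom T T' U) where
  zero :=
    { app _ _ _ := 0
      map_smul _ _ a _ := (smul_zero a).symm
      map_res _ h _ := (T'.res_zero h).symm }

instance : MulActionWithZero (X.sheaf.obj U) (LocalHom T T' U) where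
  smul a l :=
    { app V hV m := X.sheaf.res hV a • l.app V hV m
      map_smul V hV b m := by rw [l.map_smul, smul_smul, smul_smul, mul_comm]
      map_res hV hW m := by rw [l.map_res, T'.res_smul, X.sheaf.res_res] }
  one_smul l := ext fun V hV m => by
    change X.sheaf.res hV 1 • l.app V hV m = _
    rw [X.res_one, one_smul]
  mul_smul a b l := ext fun V hV m => by
    change X.sheaf.res hV (a * b) • l.app V hV m = X.sheaf.res hV a • X.sheaf.res hV b • _
    rw [X.res_mul, mul_smul]
  smul_zero a := ext fun V hV m => smul_zero _
  zero_smul l := ext fun V hV m => by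
    change X.sheaf.res hV 0 • l.app V hV m = 0
    rw [X.res_zero, zero_smul]

end LocalHom

namespace OModule

/-- The sheaf of morphisms from `M` to `N`. -/
def sheafHom (M N : OModule X) : OModule X where
  obj U := LocalHom M.toPreModule N.toPreModule U
  res h l := l.restrict h
  res_id _ _ := rfl
  res_res _ _ _ := rfl
  res_smul h a l := LocalHom.ext fun V hV m => by
    change X.sheaf.res _ a • l.app V _ m = X.sheaf.res hV (X.sheaf.res h a) • l.app V _ m
    rw [X.sheaf.res_res]
  isSheaf := by
    intro ι U s hs
    have key : ∀ i j V (hi : V ≤ U i) (hj : V ≤ U j) m, (s i).app V hi m = (s j).app V hj m :=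
      fun i j V hi hj m =>
        congrArg (fun l : LocalHom M.toPreModule N.toPreModule (U i ⊓ U j) =>
          l.app V (le_inf hi hj) m) (hs i j)
    have hg : ∀ V, V ≤ iSup U → ∀ m : M.obj V, ∃! n : N.obj V, ∀ i,
        N.res (inf_le_left : V ⊓ U i ≤ V) n =
          (s i).app (V ⊓ U i) inf_le_right (M.res inf_le_left m) := fun V hV m =>
      N.isSheaf.glue (fun i => V ⊓ U i) (fun i => inf_le_left) (fun x hx => by
        obtain ⟨i, hi⟩ := Opens.mem_iSup.1 (hV hx)
        exact ⟨i, hx, hi⟩) _ (fun i j W hi hj => by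
        rw [← (s i).map_res, ← (s j).map_res, M.res_res, M.res_res]
        exact key _ _ _ _ _ _)
    choose t ht huniq using hg
    -- The glued morphism is known on every open set inside some `U i`; its properties follow from
    -- this by `hext`.
    have ht' : ∀ V (hV : V ≤ iSup U) m W (hW : W ≤ V) i (hi : W ≤ U i),
        N.res hW (t V hV m) = (s i).app W hi (M.res hW m) := fun V hV m W hW i hi => by
      have := congrArg (N.res (le_inf hW hi)) (ht V hV m i)
      rwa [N.res_res, ← (s i).map_res, M.res_res] at this
    have hext : ∀ V, V ≤ iSup U → ∀ n n' : N.obj V,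
        (∀ W (h : W ≤ V) i, W ≤ U i → N.res h n = N.res h n') → n = n' := fun V hV n n' h => by
      refine N.isSheaf.ext fun x hx => ?_
      obtain ⟨i, hi⟩ := Opens.mem_iSup.1 (hV hx)
      exact ⟨V ⊓ U i, ⟨hx, hi⟩, inf_le_left, h _ _ i inf_le_right⟩
    refine ⟨⟨t, fun V hV a m => hext V hV _ _ fun W h i hi => ?_,
      fun {V W} hV hW m => hext W (hW.trans hV) _ _ fun W' h i hi => ?_⟩,
      fun i => LocalHom.ext fun V hV m => ?_, fun l hl => LocalHom.ext fun V hV m => ?_⟩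
    · rw [ht' _ _ _ _ _ i hi, N.res_smul, ht' _ _ _ _ _ i hi, M.res_smul, (s i).map_smul]
    · rw [ht' _ _ _ _ _ i hi, N.res_res, ht' _ _ _ _ _ i hi, M.res_res]
    · have := ht' V (hV.trans (le_iSup U i)) m V le_rfl i hV
      rwa [N.res_id, M.res_id] at this
    · refine hext V hV _ _ fun W h i hi => ?_
      rw [ht' _ _ _ _ _ i hi, ← l.map_res hV h m, ← hl i]
      rfl

end OModule

/-- The sheaf of morphisms from a line bundle `L` to the structure sheaf is generated by the
element dual to a generator of `L`. -/
theorem IsBasisOn.exists_dual {L : OModule X} {U : Opens X.carrier} {e : L.obj U}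
    (he : IsBasisOn L.toPreModule U (fun _ : Unit => e)) :
    ∃ l : LocalHom L.toPreModule (OModule.structureModule X).toPreModule U,
      (∀ V h, l.app V h (L.res h e) = (1 : X.sheaf.obj V)) ∧
      IsBasisOn (L.sheafHom (OModule.structureModule X)).toPreModule U (fun _ : Unit => l) := by
  obtain ⟨l, hl⟩ := he.exists_localHom (T' := (OModule.structureModule X).toPreModule)
    (fun _ : Unit => (1 : X.sheaf.obj U))
  have hl' : ∀ V h, l.app V h (L.res h e) = (1 : X.sheaf.obj V) := fun V h =>
    (hl V h ()).trans (X.res_one h)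
  refine ⟨l, hl', isBasisOn_unit (fun V h (m : LocalHom _ _ V) => ?_) (fun V h a b hab => ?_)⟩
  -- A morphism to the structure sheaf is its value at the generator times the dual generator.
  · obtain ⟨c, hc⟩ : ∃ c : X.sheaf.obj V, m.app V le_rfl (L.res h e) = c := ⟨_, rfl⟩
    refine ⟨c, LocalHom.ext fun W hW n => ?_⟩
    refine (he W (hW.trans h)).map_eq (m.map_smul W hW)
      (l' := ((c • l.restrict h).app W hW)) (LocalHom.map_smul _ W hW) (fun i => ?_) n
    have h1 : m.app W hW (L.res (hW.trans h) e) = X.sheaf.res hW c := by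
      rw [← L.res_res h hW, ← hc]
      exact m.map_res le_rfl hW _
    refine h1.trans ((mul_one (X.sheaf.res hW c)).symm.trans ?_)
    exact congrArg (fun d : X.sheaf.obj W => X.sheaf.res hW c * d) (hl' W (hW.trans h)).symm
  · have h1 : ∀ c : X.sheaf.obj V, (c • l.restrict h).app V le_rfl (L.res h e) = c := fun c =>
      (congrArg₂ (fun c d : X.sheaf.obj V => c * d) (X.sheaf.res_id le_rfl c) (hl' V h)).trans
        (mul_one c)
    rw [← h1 a, ← h1 b]
    exact congrArg (fun l : LocalHom L.toPreModule (OModule.structureModule X).toPreModule V =>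
      l.app V le_rfl (L.res h e)) hab

end Dual

/-! ### Isomorphisms between line bundles -/

theorem isBasisOn_one (U : Opens X.carrier) :
    IsBasisOn (OModule.structureModule X).toPreModule U
      (fun _ : Unit => (1 : X.sheaf.obj U)) :=
  isBasisOn_unit (T := (OModule.structureModule X).toPreModule)
    (fun V h m => ⟨m, (mul_one (M := X.sheaf.obj V) m).symm.trans
      (congrArg (fun c : X.sheaf.obj V => (show X.sheaf.obj V from m) * c) (X.res_one h).symm)⟩)
    (fun V h a b hab => by
      have h1 : ∀ c : X.sheaf.obj V, c * X.sheaf.res h 1 = c := fun c => by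
        rw [X.res_one, mul_one]
      exact (h1 a).symm.trans (hab.trans (h1 b)))

theorem IsBasisOn.tensor_unit (hη : IsGeneric X η) {M N : OModule X} {U : Opens X.carrier}
    {b : M.obj U} {c : N.obj U} (hb : IsBasisOn M.toPreModule U (fun _ : Unit => b))
    (hc : IsBasisOn N.toPreModule U (fun _ : Unit => c)) :
    IsBasisOn (M.tensor N).toPreModule U (fun _ : Unit => OModule.tmul b c) :=
  (hb.tensor hη hc).comp_equiv
    (⟨fun _ => ((), ()), fun _ => (), fun _ => rfl, fun _ => rfl⟩ : Unit ≃ Unit × Unit)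

namespace OModule

variable {L M N : OModule X}

theorem nonempty_iso_of_gen {U : X.carrier → Opens X.carrier} (hU : ∀ x, x ∈ U x)
    {e : ∀ x, M.obj (U x)} {e' : ∀ x, N.obj (U x)}
    (he : ∀ x, IsBasisOn M.toPreModule (U x) (fun _ : Unit => e x))
    (he' : ∀ x, IsBasisOn N.toPreModule (U x) (fun _ : Unit => e' x))
    (h : ∀ x y, ∃ g : X.sheaf.obj (U x ⊓ U y),
      M.res inf_le_left (e x) = g • M.res inf_le_right (e y) ∧
      N.res inf_le_left (e' x) = g • N.res inf_le_right (e' y)) : Nonempty (M ≅ N) := by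
  refine nonempty_iso_of_basis hU (fun x _ => e x) (fun x _ => e' x) he he' ?_
  intro x y i j g hg
  obtain ⟨g', h1, h2⟩ := h x y
  rw [h2, ((he y) _ inf_le_right).smul_inj (i := ()) (h1.symm.trans hg)]

variable (hη : IsGeneric X η) (hX : X.IsIntegral)

include hη hX

/-- Line bundles on the members of a common cover are generated by one section. -/
theorem exists_cover_gen : ∃ (U : X.carrier → Opens X.carrier) (_ : ∀ x, x ∈ U x),
    ∀ (L : OModule X), L.IsLineBundle →
      ∃ e : ∀ x, L.obj (U x), (∀ x, IsBasisOn L.toPreModule (U x) (fun _ : Unit => e x)) ∧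
        ∀ x y, ∃ g : X.sheaf.obj (U x ⊓ U y),
          L.res inf_le_left (e x) = g • L.res inf_le_right (e y) := by
  obtain ⟨U, hU, hmin⟩ := exists_minimal_cover hX
  refine ⟨U, hU, fun L hL => ?_⟩
  choose e he using fun x => hL.exists_gen hη (hmin x).choose_spec.2
  exact ⟨e, he, fun x y => (he y).exists_smul_of_unit inf_le_right _⟩

theorem IsLineBundle.tensor (hM : M.IsLineBundle) (hN : N.IsLineBundle) :
    (M.tensor N).IsLineBundle := by
  obtain ⟨U, hU, H⟩ := exists_cover_gen hη hX
  obtain ⟨e, he, -⟩ := H M hM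
  obtain ⟨f, hf, -⟩ := H N hN
  exact isLineBundle_of_isBasisOn hX fun x => ⟨U x, hU x, _, (he x).tensor_unit hη (hf x)⟩

omit hη in
theorem isLineBundle_structureModule : (structureModule X).IsLineBundle :=
  isLineBundle_of_isBasisOn hX fun x => ⟨⊤, trivial, _, isBasisOn_one ⊤⟩

theorem IsLineBundle.nonempty_tensor_congr {L' M' : OModule X} (hL : L.IsLineBundle)
    (hM : M.IsLineBundle) (f : L' ≅ L) (g : M' ≅ M) : Nonempty (L'.tensor M' ≅ L.tensor M) :=
  ((DecompOf.of_iso_isLineBundle hη hX hL f).tensor hη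
    (DecompOf.of_iso_isLineBundle hη hX hM g)).nonempty_iso
    ((DecompOf.of_iso_isLineBundle hη hX hL (Iso.refl _)).tensor hη
      (DecompOf.of_iso_isLineBundle hη hX hM (Iso.refl _)))

theorem IsLineBundle.nonempty_tensor_assoc (hL : L.IsLineBundle) (hM : M.IsLineBundle)
    (hN : N.IsLineBundle) : Nonempty ((L.tensor M).tensor N ≅ L.tensor (M.tensor N)) := by
  obtain ⟨U, hU, H⟩ := exists_cover_gen hη hX
  obtain ⟨e, he, he'⟩ := H L hL
  obtain ⟨f, hf, hf'⟩ := H M hM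
  obtain ⟨g, hg, hg'⟩ := H N hN
  refine nonempty_iso_of_gen hU (fun x => ((he x).tensor_unit hη (hf x)).tensor_unit hη (hg x))
    (fun x => (he x).tensor_unit hη ((hf x).tensor_unit hη (hg x))) fun x y => ?_
  obtain ⟨a, ha⟩ := he' x y
  obtain ⟨b, hb⟩ := hf' x y
  obtain ⟨c, hc⟩ := hg' x y
  refine ⟨a * b * c, ?_, ?_⟩
  · simp only [res_tmul, ha, hb, hc, smul_tmul_smul]
  · simp only [res_tmul, ha, hb, hc, smul_tmul_smul, mul_assoc]

theorem IsLineBundle.nonempty_tensor_comm (hL : L.IsLineBundle) (hM : M.IsLineBundle) :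
    Nonempty (L.tensor M ≅ M.tensor L) := by
  obtain ⟨U, hU, H⟩ := exists_cover_gen hη hX
  obtain ⟨e, he, he'⟩ := H L hL
  obtain ⟨f, hf, hf'⟩ := H M hM
  refine nonempty_iso_of_gen hU (fun x => (he x).tensor_unit hη (hf x))
    (fun x => (hf x).tensor_unit hη (he x)) fun x y => ?_
  obtain ⟨a, ha⟩ := he' x y
  obtain ⟨b, hb⟩ := hf' x y
  refine ⟨a * b, ?_, ?_⟩
  · simp only [res_tmul, ha, hb, smul_tmul_smul]
  · simp only [res_tmul, ha, hb, smul_tmul_smul, mul_comm]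

omit hX in
-- Generators that agree on overlaps have trivial transition functions, and tensoring with them
-- changes nothing.
theorem nonempty_tensor_iso_of_res_eq {U : X.carrier → Opens X.carrier} (hU : ∀ x, x ∈ U x)
    {e : ∀ x, M.obj (U x)} {f : ∀ x, L.obj (U x)}
    (he : ∀ x, IsBasisOn M.toPreModule (U x) (fun _ : Unit => e x))
    (hf : ∀ x, IsBasisOn L.toPreModule (U x) (fun _ : Unit => f x))
    (he' : ∀ x y, M.res (inf_le_left : U x ⊓ U y ≤ U x) (e x) = M.res inf_le_right (e y))
    (hf' : ∀ x y, ∃ g : X.sheaf.obj (U x ⊓ U y),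
      L.res inf_le_left (f x) = g • L.res inf_le_right (f y)) : Nonempty (M.tensor L ≅ L) := by
  refine nonempty_iso_of_gen hU (fun x => (he x).tensor_unit hη (hf x)) hf fun x y => ?_
  obtain ⟨a, ha⟩ := hf' x y
  refine ⟨a, ?_, ha⟩
  have h := smul_tmul_smul (1 : X.sheaf.obj (U x ⊓ U y)) a (M.res inf_le_right (e y))
    (L.res inf_le_right (f y))
  rw [one_smul, one_mul] at h
  rw [res_tmul, res_tmul, he', ha, h]

theorem IsLineBundle.nonempty_structureModule_tensor (hL : L.IsLineBundle) :
    Nonempty ((structureModule X).tensor L ≅ L) := by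
  obtain ⟨U, hU, H⟩ := exists_cover_gen hη hX
  obtain ⟨e, he, he'⟩ := H L hL
  exact nonempty_tensor_iso_of_res_eq hη hU (fun x => isBasisOn_one (U x)) he
    (fun x y => (X.res_one _).trans (X.res_one _).symm) he'

theorem IsLineBundle.dual (hL : L.IsLineBundle) :
    (L.sheafHom (structureModule X)).IsLineBundle := by
  obtain ⟨U, hU, H⟩ := exists_cover_gen hη hX
  obtain ⟨e, he, -⟩ := H L hL
  exact isLineBundle_of_isBasisOn hX fun x => ⟨U x, hU x,
    (he x).exists_dual.choose, (he x).exists_dual.choose_spec.2⟩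

omit hX in
-- The factor `a` takes `f y` to `f x` but `e x` to `e y`, so the products `e x ⊗ f x` agree on
-- overlaps.
theorem nonempty_tensor_iso_structureModule {U : X.carrier → Opens X.carrier}
    (hU : ∀ x, x ∈ U x) {e : ∀ x, M.obj (U x)} {f : ∀ x, L.obj (U x)}
    (he : ∀ x, IsBasisOn M.toPreModule (U x) (fun _ : Unit => e x))
    (hf : ∀ x, IsBasisOn L.toPreModule (U x) (fun _ : Unit => f x))
    (h : ∀ x y, ∃ a : X.sheaf.obj (U x ⊓ U y),
      L.res inf_le_left (f x) = a • L.res inf_le_right (f y) ∧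
      M.res inf_le_right (e y) = a • M.res inf_le_left (e x)) :
    Nonempty (M.tensor L ≅ structureModule X) := by
  refine nonempty_iso_of_gen hU (fun x => (he x).tensor_unit hη (hf x))
    (fun x => isBasisOn_one (U x)) fun x y => ⟨1, ?_, ?_⟩
  · obtain ⟨a, hL, hM⟩ := h x y
    have h1 := smul_tmul_smul (1 : X.sheaf.obj (U x ⊓ U y)) a
      (M.res (inf_le_left : U x ⊓ U y ≤ U x) (e x)) (L.res (inf_le_right : U x ⊓ U y ≤ U y) (f y))
    have h2 := smul_tmul_smul a (1 : X.sheaf.obj (U x ⊓ U y))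
      (M.res (inf_le_left : U x ⊓ U y ≤ U x) (e x)) (L.res (inf_le_right : U x ⊓ U y ≤ U y) (f y))
    rw [one_smul, one_mul] at h1
    rw [one_smul, mul_one] at h2
    rw [res_tmul, res_tmul, hL, hM, one_smul, h1, h2]
  · exact (X.res_one _).trans ((X.res_one _).symm.trans (one_smul _ _).symm)

theorem IsLineBundle.nonempty_dual_tensor (hL : L.IsLineBundle) :
    Nonempty ((L.sheafHom (structureModule X)).tensor L ≅ structureModule X) := by
  obtain ⟨U, hU, H⟩ := exists_cover_gen hη hX
  obtain ⟨e, he, he'⟩ := H L hL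
  choose l hl hl' using fun x => (he x).exists_dual
  refine nonempty_tensor_iso_structureModule hη hU hl' he fun x y => ?_
  obtain ⟨a, ha⟩ := he' x y
  refine ⟨a, ha, ?_⟩
  -- Both `l y` and `a • l x` take the value `a` at the generator `e x`.
  refine LocalHom.ext fun V hV m => ?_
  refine ((he x) V (hV.trans inf_le_left)).map_eq
    (l := (l y).app V (hV.trans inf_le_right))
    (l' := (a • (l x).restrict (inf_le_left : U x ⊓ U y ≤ U x)).app V hV)
    (LocalHom.map_smul _ V _) (LocalHom.map_smul _ V _) (fun _ => ?_) m
  have h2 : L.res (hV.trans inf_le_left) (e x) =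
      X.sheaf.res hV a • L.res (hV.trans inf_le_right) (e y) := by
    rw [← L.res_res inf_le_left hV, ha, L.res_smul, L.res_res]
  have h3 : (l y).app V (hV.trans inf_le_right) (L.res (hV.trans inf_le_left) (e x)) =
      X.sheaf.res hV a := by
    rw [h2, (l y).map_smul]
    exact (congrArg (fun c : X.sheaf.obj V => X.sheaf.res hV a * c) (hl y V _)).trans (mul_one _)
  refine h3.trans ((mul_one (X.sheaf.res hV a)).symm.trans ?_)
  exact congrArg (fun c : X.sheaf.obj V => X.sheaf.res hV a * c) (hl x V _).symm

end OModule

end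

/-! ### The Picard group, the ring structure of `K₀`, and functoriality -/

section

variable {X Y : MonoidalSpace.{u}} {η : X.carrier} {θ : Y.carrier}

/-! ### The Picard group and the ring structure of `K₀` -/

theorem OModule.IsLineBundle.decompOf (hη : IsGeneric X η) (hX : X.IsIntegral) {L : OModule X}
    (hL : L.IsLineBundle) : DecompOf L (fun _ : Unit => L) :=
  DecompOf.of_iso_isLineBundle hη hX hL (Iso.refl L)

theorem Pic.mk_eq_mk {L L' : OModule X} {hL : L.IsLineBundle} {hL' : L'.IsLineBundle} :
    Pic.mk L hL = Pic.mk L' hL' ↔ Nonempty (L ≅ L') :=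
  ⟨fun h => Quotient.exact h, fun h => Quotient.sound h⟩

theorem Pic.ind {P : Pic X → Prop} (h : ∀ L hL, P (Pic.mk L hL)) (p : Pic X) : P p :=
  Quotient.inductionOn p fun L => h L.1 L.2

theorem exists_isTensorGroup (hη : IsGeneric X η) (hX : X.IsIntegral) :
    ∃ G : CommGroup (Pic X), IsTensorGroup G := by
  let : Mul (Pic X) := ⟨Quotient.map₂
    (fun L L' => ⟨L.1.tensor L'.1, L.2.tensor hη hX L'.2⟩) (by
      rintro L M ⟨f⟩ L' M' ⟨f'⟩
      exact M.2.nonempty_tensor_congr hη hX M'.2 f f')⟩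
  have mul : ∀ (L L' : OModule X) (hL : L.IsLineBundle) (hL' : L'.IsLineBundle),
      Pic.mk L hL * Pic.mk L' hL' = Pic.mk (L.tensor L') (hL.tensor hη hX hL') :=
    fun _ _ _ _ => rfl
  let : One (Pic X) := ⟨Pic.mk _ (OModule.isLineBundle_structureModule hX)⟩
  have one_eq : (1 : Pic X) = Pic.mk _ (OModule.isLineBundle_structureModule hX) := rfl
  have hinv : ∀ p : Pic X, ∃ q, q * p = 1 := Pic.ind fun L hL =>
    ⟨Pic.mk _ (hL.dual hη hX), Pic.mk_eq_mk.2 (hL.nonempty_dual_tensor hη hX)⟩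
  choose inv hinv using hinv
  let : Inv (Pic X) := ⟨inv⟩
  have assoc : ∀ a b c : Pic X, a * b * c = a * (b * c) := Pic.ind fun L hL => Pic.ind fun M hM =>
    Pic.ind fun N hN => Pic.mk_eq_mk.2 (hL.nonempty_tensor_assoc hη hX hM hN)
  have comm : ∀ a b : Pic X, a * b = b * a := Pic.ind fun L hL => Pic.ind fun M hM =>
    Pic.mk_eq_mk.2 (hL.nonempty_tensor_comm hη hX hM)
  have one_mul : ∀ a : Pic X, 1 * a = a := Pic.ind fun L hL =>
    Pic.mk_eq_mk.2 (hL.nonempty_structureModule_tensor hη hX)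
  exact ⟨{ Group.ofLeftAxioms assoc one_mul hinv with mul_comm := comm },
    ⟨⟨_, rfl⟩, fun L L' hL hL' => ⟨_, rfl⟩⟩⟩

/-- The ring structure on `K₀(X)` obtained from the group ring of the Picard group. -/
theorem exists_ringEquiv (hη : IsGeneric X η) (hX : X.IsIntegral) (G : CommGroup (Pic X))
    (hG : IsTensorGroup G) :
    ∃ (R : CommRing (K0 X)) (Θ : MonoidAlgebra ℤ (Pic X) ≃+* K0 X), IsTensorRing R ∧
      (∀ L (hL : OModule.IsLineBundle L),
        ∃ hB, Θ (MonoidAlgebra.of ℤ _ (Pic.mk L hL)) = K0.mk L hB) ∧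
      ∀ (M : OModule X) (hM : M.IsBundle) (ι : Type u) [Fintype ι] (L : ι → OModule X)
        (h : DecompOf M L),
        Θ (∑ i, MonoidAlgebra.of ℤ _ (Pic.mk (L i) (h.isLineBundle hX i))) = K0.mk M hM := by
  obtain ⟨e, he⟩ := K0.exists_addEquiv hη hX
  let ε : MonoidAlgebra ℤ (Pic X) ≃+ K0 X := MonoidAlgebra.coeffAddEquiv.trans e
  have hε : ∀ L (hL : OModule.IsLineBundle L),
      ε (MonoidAlgebra.of ℤ _ (Pic.mk L hL)) = K0.mk L (hL.isBundle hη hX) := he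
  have hsum : ∀ (M : OModule X) (hM : M.IsBundle) (ι : Type u) [Fintype ι] (L : ι → OModule X)
        (h : DecompOf M L),
        ε (∑ i, MonoidAlgebra.of ℤ _ (Pic.mk (L i) (h.isLineBundle hX i))) = K0.mk M hM := by
    intro M hM ι _ L h
    rw [map_sum, K0.mk_eq_sum hη hX h hM]
    exact Finset.sum_congr rfl fun i _ => hε _ _
  -- The multiplication is transported from the group ring, while the addition stays that of the
  -- Grothendieck group. That products are tensor products is verified afterwards.
  let R : CommRing (K0 X) :=
    { (inferInstance : AddCommGroup (K0 X)) with
      mul := fun a b => ε (ε.symm a * ε.symm b)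
      one := ε 1
      mul_assoc := fun a b c => by
        change ε (ε.symm (ε (ε.symm a * ε.symm b)) * ε.symm c) =
          ε (ε.symm a * ε.symm (ε (ε.symm b * ε.symm c)))
        rw [ε.symm_apply_apply, ε.symm_apply_apply, mul_assoc]
      one_mul := fun a => by
        change ε (ε.symm (ε 1) * ε.symm a) = a
        rw [ε.symm_apply_apply, one_mul, ε.apply_symm_apply]
      mul_one := fun a => by
        change ε (ε.symm a * ε.symm (ε 1)) = a
        rw [ε.symm_apply_apply, mul_one, ε.apply_symm_apply]
      left_distrib := fun a b c => by
        change ε (ε.symm a * ε.symm (b + c)) = ε (ε.symm a * ε.symm b) + ε (ε.symm a * ε.symm c)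
        rw [map_add, mul_add, map_add]
      right_distrib := fun a b c => by
        change ε (ε.symm (a + b) * ε.symm c) = ε (ε.symm a * ε.symm c) + ε (ε.symm b * ε.symm c)
        rw [map_add, add_mul, map_add]
      zero_mul := fun a => by
        change ε (ε.symm 0 * ε.symm a) = 0
        rw [map_zero, zero_mul, map_zero]
      mul_zero := fun a => by
        change ε (ε.symm a * ε.symm 0) = 0
        rw [map_zero, mul_zero, map_zero]
      mul_comm := fun a b => congrArg ε (mul_comm _ _) }
  refine ⟨R, @RingEquiv.mk _ _ _ _ _ _ ε.toEquiv (fun a b => ?_) ε.map_add,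
    ⟨fun a b => rfl, ?_, fun M N hM hN => ?_⟩,
    fun L hL => ⟨_, hε L hL⟩, hsum⟩
  · change ε (a * b) = ε (ε.symm (ε a) * ε.symm (ε b))
    rw [ε.symm_apply_apply, ε.symm_apply_apply]
  · obtain ⟨h, h1⟩ := hG.one
    refine ⟨h.isBundle hη hX, ?_⟩
    rw [← hε _ h, ← h1, map_one]
    rfl
  · obtain ⟨ι, L, h⟩ := hM.1.exists_decompOf hη
    obtain ⟨κ, L', h'⟩ := hN.1.exists_decompOf hη
    have := h.finite hη hM.2
    have := h'.finite hη hN.2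
    have := Fintype.ofFinite ι
    have := Fintype.ofFinite κ
    have ht := h.tensor hη h'
    refine ⟨ht.isBundle hX, ?_⟩
    -- Both classes are sums over decompositions; the double sum of products is the sum over the
    -- decomposition of the tensor product.
    change ε (ε.symm _ * ε.symm _) = _
    rw [← hsum M hM ι L h, ← hsum N hN κ L' h', ← hsum _ (ht.isBundle hX) _ _ ht,
      ε.symm_apply_apply, ε.symm_apply_apply, Finset.sum_mul_sum, Fintype.sum_prod_type]
    refine congrArg ε (Finset.sum_congr rfl fun i _ => Finset.sum_congr rfl fun j _ => ?_)
    obtain ⟨_, h⟩ := hG.mul _ _ (h.isLineBundle hX i) (h'.isLineBundle hX j)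
    rw [← map_mul, h]

/-! ### Inverse images of line bundles -/

namespace OModule

variable (φ : SchemeHom X Y) {L M : OModule Y}

theorem IsLineBundle.pullback (hη : IsGeneric X η) (hX : X.IsIntegral) (hθ : IsGeneric Y θ)
    (hY : Y.IsIntegral) (hL : L.IsLineBundle) : (pullback φ L).IsLineBundle :=
  ((hL.decompOf hθ hY).pullback φ hη).isLineBundle hX ()

theorem IsLineBundle.nonempty_pullback_tensor (hη : IsGeneric X η) (hθ : IsGeneric Y θ)
    (hY : Y.IsIntegral) (hL : L.IsLineBundle) (hM : M.IsLineBundle) :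
    Nonempty (MonoidGeometry.pullback φ (L.tensor M) ≅
      (MonoidGeometry.pullback φ L).tensor (MonoidGeometry.pullback φ M)) := by
  obtain ⟨U, hU, H⟩ := exists_cover_gen hθ hY
  obtain ⟨e, he, he'⟩ := H L hL
  obtain ⟨f, hf, hf'⟩ := H M hM
  refine nonempty_iso_of_gen (U := fun x => (U (φ.base x)).comap φ.base) (fun x => hU _)
    (fun x => ((he _).tensor_unit hθ (hf _)).pullback φ hη le_rfl)
    (fun x => ((he _).pullback φ hη le_rfl).tensor_unit hη ((hf _).pullback φ hη le_rfl))
    fun x y => ?_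
  obtain ⟨a, ha⟩ := he' (φ.base x) (φ.base y)
  obtain ⟨b, hb⟩ := hf' (φ.base x) (φ.base y)
  have hle : (U (φ.base x)).comap φ.base ⊓ (U (φ.base y)).comap φ.base ≤
    (U (φ.base x) ⊓ U (φ.base y)).comap φ.base := le_comap_inf inf_le_left inf_le_right
  refine ⟨X.sheaf.res hle (φ.app _ (a * b)), ?_, ?_⟩
  · rw [res_pullbackSection φ inf_le_left inf_le_left le_rfl hle,
      res_pullbackSection φ inf_le_right inf_le_right le_rfl hle, res_tmul, res_tmul, ha, hb,
      smul_tmul_smul, pullbackSection_smul]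
  · rw [res_tmul, res_tmul, res_pullbackSection φ inf_le_left inf_le_left le_rfl hle,
      res_pullbackSection φ inf_le_right inf_le_right le_rfl hle,
      res_pullbackSection φ inf_le_left inf_le_left le_rfl hle,
      res_pullbackSection φ inf_le_right inf_le_right le_rfl hle, ha, hb, pullbackSection_smul,
      pullbackSection_smul, smul_tmul_smul, map_mul, X.res_mul]

end OModule

theorem exists_pic_hom (φ : SchemeHom X Y) (hη : IsGeneric X η) (hX : X.IsIntegral)
    (hθ : IsGeneric Y θ) (hY : Y.IsIntegral) (G : CommGroup (Pic X)) (hG : IsTensorGroup G)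
    (G' : CommGroup (Pic Y)) (hG' : IsTensorGroup G') :
    ∃ f : Pic Y →* Pic X, ∀ (L : OModule Y) (hL : L.IsLineBundle),
      ∃ h, f (Pic.mk L hL) = Pic.mk (pullback φ L) h := by
  let f : Pic Y → Pic X := Quotient.map
    (fun L => ⟨pullback φ L.1, L.2.pullback φ hη hX hθ hY⟩) (by
      rintro L M ⟨g⟩
      exact ((DecompOf.of_iso_isLineBundle hθ hY M.2 g).pullback φ hη).nonempty_iso
        ((M.2.decompOf hθ hY).pullback φ hη))
  have hf : ∀ (L : OModule Y) (hL : L.IsLineBundle),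
      f (Pic.mk L hL) = Pic.mk (pullback φ L) (hL.pullback φ hη hX hθ hY) := fun _ _ => rfl
  refine ⟨MonoidHom.mk' f (Pic.ind fun L hL => Pic.ind fun M hM => ?_), fun L hL => ⟨_, hf L hL⟩⟩
  obtain ⟨_, h1⟩ := hG'.mul L M hL hM
  rw [h1, hf, hf, hf]
  obtain ⟨_, h2⟩ := hG.mul _ _ (hL.pullback φ hη hX hθ hY) (hM.pullback φ hη hX hθ hY)
  rw [h2]
  exact Pic.mk_eq_mk.2 (hL.nonempty_pullback_tensor φ hη hθ hY hM)

/-- Choice of the structures on `Pic X` and `K₀(X)` for all connected integral schemes. -/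
theorem exists_tensorRing_all :
    ∃ (G : ∀ X : IntegralScheme.{u}, CommGroup (Pic X.toMonoidalSpace))
      (R : ∀ X : IntegralScheme.{u}, CommRing (K0 X.toMonoidalSpace))
      (Θ : ∀ X : IntegralScheme.{u},
        MonoidAlgebra ℤ (Pic X.toMonoidalSpace) ≃+* K0 X.toMonoidalSpace),
      (∀ X, IsTensorGroup (G X)) ∧ (∀ X, IsTensorRing (R X)) ∧
      (∀ (X : IntegralScheme.{u}) (L : OModule X.toMonoidalSpace) (hL : L.IsLineBundle),
        ∃ hB : L.IsBundle, Θ X (MonoidAlgebra.of ℤ _ (Pic.mk L hL)) = K0.mk L hB) ∧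
      ∀ (X : IntegralScheme.{u}) (M : OModule X.toMonoidalSpace) (hM : M.IsBundle) (ι : Type u)
        [Fintype ι] (L : ι → OModule X.toMonoidalSpace) (h : DecompOf M L),
        Θ X (∑ i, MonoidAlgebra.of ℤ _ (Pic.mk (L i) (h.isLineBundle X.isIntegral i))) =
          K0.mk M hM := by
  choose η hη using fun X : IntegralScheme.{u} => exists_isGeneric X.isIntegral X.connected
  choose G hG using fun X : IntegralScheme.{u} => exists_isTensorGroup (hη X) X.isIntegral
  choose R Θ hR hΘ hsum using fun X : IntegralScheme.{u} =>
    exists_ringEquiv (hη X) X.isIntegral (G X) (hG X)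
  exact ⟨G, R, Θ, hG, hR, hΘ, hsum⟩

end

/-! ### Points and coordinate monoids of projective space -/

section

/-! ### Laurent monomials -/

section Monomials

variable {n : ℕ}

/-- The Laurent monomial `x^e`. -/
def mon (e : Fin (n + 1) → ℤ) : LaurentMonomials n :=
  ((Multiplicative.ofAdd e : Multiplicative (Fin (n + 1) → ℤ)) : LaurentMonomials n)

theorem mon_add (e d : Fin (n + 1) → ℤ) : mon (e + d) = mon e * mon d := rfl

theorem mon_zero : mon (0 : Fin (n + 1) → ℤ) = 1 := rfl

theorem mon_ne_zero (e : Fin (n + 1) → ℤ) : mon e ≠ 0 := WithZero.coe_ne_zero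

theorem mon_inj {e d : Fin (n + 1) → ℤ} (h : mon e = mon d) : e = d :=
  congrArg Multiplicative.toAdd (WithZero.coe_inj.1 h)

theorem eq_zero_or_mon (a : LaurentMonomials n) : a = 0 ∨ ∃ e, a = mon e := by
  induction a using WithZero.recZeroCoe with
  | zero => exact Or.inl rfl
  | coe a => exact Or.inr ⟨Multiplicative.toAdd a, rfl⟩

theorem isRegularAt_mon {k : ℤ} {I : ProjPoint n} {e : Fin (n + 1) → ℤ} :
    IsRegularAt k I (mon e) ↔ ∑ i, e i = k ∧ ∀ i ∉ I.1, 0 ≤ e i := by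
  refine ⟨fun h => h e rfl, fun h d hd => ?_⟩
  obtain rfl := mon_inj hd
  exact h

end Monomials

/-! ### The topology of projective space -/

namespace ProjPoint

variable {n : ℕ}

/-- Together with `isOpen_of_forall_subset`, which uses that there are finitely many coordinates,
this says that the open sets are exactly those stable under enlarging `I`. -/
theorem mem_of_subset {V : Set (ProjPoint n)} (hV : IsOpen V) {I J : ProjPoint n} (hI : I ∈ V)
    (h : I.1 ⊆ J.1) : J ∈ V := by
  induction hV with
  | basic s hs =>
    obtain ⟨i, rfl⟩ := hs
    exact h hI
  | univ => trivial
  | inter s t _ _ hs ht => exact ⟨hs hI.1, ht hI.2⟩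
  | sUnion S _ hS =>
    obtain ⟨s, hs, hI⟩ := hI
    exact ⟨s, hs, hS s hs hI⟩

theorem isOpen_of_forall_subset {V : Set (ProjPoint n)}
    (h : ∀ I ∈ V, ∀ J : ProjPoint n, I.1 ⊆ J.1 → J ∈ V) : IsOpen V := by
  refine isOpen_iff_forall_mem_open.2 fun I hI => ⟨⋂ i ∈ I.1, {J : ProjPoint n | i ∈ J.1},
    fun J hJ => h I hI J fun i hi => Set.mem_iInter₂.1 hJ i hi,
    (Set.toFinite _).isOpen_biInter fun i _ => isOpen_generateFrom_of_mem ⟨i, rfl⟩,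
    Set.mem_iInter₂.2 fun i hi => hi⟩

/-- The generic point. -/
def generic (n : ℕ) : ProjPoint n := ⟨Set.univ, Set.univ_nonempty⟩

theorem generic_mem {V : Set (ProjPoint n)} (hV : IsOpen V) {I : ProjPoint n} (hI : I ∈ V) :
    generic n ∈ V := mem_of_subset hV hI (Set.subset_univ _)

instance : ConnectedSpace (ProjPoint n) := by
  have : PreirreducibleSpace (ProjPoint n) := ⟨fun u v hu hv ⟨x, _, hx⟩ ⟨y, _, hy⟩ =>
    ⟨generic n, trivial, generic_mem hu hx, generic_mem hv hy⟩⟩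
  have : Nonempty (ProjPoint n) := ⟨generic n⟩
  have : IrreducibleSpace (ProjPoint n) := ⟨‹_›⟩
  infer_instance

/-- The closed point at which only the coordinate `i` does not vanish. -/
def closed (i : Fin (n + 1)) : ProjPoint n := ⟨{i}, Set.singleton_nonempty i⟩

end ProjPoint

/-! ### The affine charts of projective space -/

section Chart

variable {n : ℕ} (i : Fin (n + 1))

/-- The monoid of the Laurent monomials of degree zero without pole at the points where the
coordinate `i` does not vanish. -/
def ChartMonoid : Type := {a : LaurentMonomials n // IsRegularAt 0 (ProjPoint.closed i) a}

namespace ChartMonoid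

instance : Zero (ChartMonoid i) := ⟨⟨0, isRegularAt_zero _ _⟩⟩

instance : One (ChartMonoid i) := ⟨⟨1, isRegularAt_one _⟩⟩

instance : Mul (ChartMonoid i) := ⟨fun a b => ⟨a.1 * b.1, by simpa using a.2.mul b.2⟩⟩

instance : CommMonoidWithZero (ChartMonoid i) where
  mul_assoc a b c := Subtype.ext (mul_assoc _ _ _)
  mul_comm a b := Subtype.ext (mul_comm _ _)
  one_mul a := Subtype.ext (one_mul _)
  mul_one a := Subtype.ext (mul_one _)
  zero_mul a := Subtype.ext (zero_mul _)
  mul_zero a := Subtype.ext (mul_zero _)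

instance : IsCancelMulZero (ChartMonoid i) :=
  Function.Injective.isCancelMulZero (fun a : ChartMonoid i => a.1) Subtype.val_injective rfl
    fun _ _ => rfl

/-- The inclusion into the monoid of all Laurent monomials. -/
def val : ChartMonoid i →* LaurentMonomials n where
  toFun a := a.1
  map_one' := rfl
  map_mul' _ _ := rfl

variable {i}

theorem val_injective : Function.Injective (val i) := Subtype.val_injective

/-- The monomial `x^e` as an element of the coordinate monoid. -/
def ofMon (e : Fin (n + 1) → ℤ) (h0 : ∑ l, e l = 0) (h : ∀ l, l ≠ i → 0 ≤ e l) : ChartMonoid i :=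
  ⟨mon e, isRegularAt_mon.2 ⟨h0, h⟩⟩

theorem sum_eq_zero {a : ChartMonoid i} {e : Fin (n + 1) → ℤ} (h : val i a = mon e) :
    ∑ l, e l = 0 := (a.2 e h).1

theorem nonneg {a : ChartMonoid i} {e : Fin (n + 1) → ℤ} (h : val i a = mon e) {l : Fin (n + 1)}
    (hl : l ≠ i) : 0 ≤ e l := (a.2 e h).2 l hl

theorem eq_zero_or_mon (a : ChartMonoid i) : a = 0 ∨ ∃ e, val i a = mon e :=
  (MonoidGeometry.eq_zero_or_mon a.1).imp Subtype.ext id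

variable (i) in
/-- The quotient `x_j / x_i`. -/
def ratio (j : Fin (n + 1)) : ChartMonoid i :=
  ofMon (Pi.single j 1 - Pi.single i 1) (by simp) fun l hl => by
    by_cases hj : l = j
    · subst hj
      simp [hl]
    · simp [hl, hj]

theorem ratio_self : ratio i i = 1 := by
  refine val_injective ?_
  change mon _ = 1
  rw [sub_self, mon_zero]

/-- The prime ideal of the monomials that vanish at `I`. -/
def primeAt (i : Fin (n + 1)) (I : ProjPoint n) : PrimeSpec (ChartMonoid i) where
  -- The condition is void for `0`. The index `i` is left out because its exponent is the one that
  -- may be negative.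
  carrier := {a | ∀ e, val i a = mon e → ∃ j ∉ I.1, j ≠ i ∧ 0 < e j}
  zero_mem e he := absurd he.symm (mon_ne_zero e)
  mul_mem a b hb e he := by
    rcases eq_zero_or_mon a with rfl | ⟨d, hd⟩
    · rw [zero_mul] at he
      exact absurd he.symm (mon_ne_zero e)
    rcases eq_zero_or_mon b with rfl | ⟨f, hf⟩
    · rw [mul_zero] at he
      exact absurd he.symm (mon_ne_zero e)
    obtain ⟨j, hj, hji, h⟩ := hb f hf
    rw [map_mul, hd, hf, ← mon_add] at he
    obtain rfl := mon_inj he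
    exact ⟨j, hj, hji, add_pos_of_nonneg_of_pos (nonneg hd hji) h⟩
  one_notMem h := by
    obtain ⟨j, -, -, h⟩ := h 0 rfl
    exact lt_irrefl _ h
  mem_or_mem {a b} h := by
    by_contra! hab
    obtain ⟨ha, hb⟩ := hab
    simp only [Set.mem_ofPred_eq, not_forall] at ha hb
    obtain ⟨d, hd, ha⟩ := ha
    obtain ⟨f, hf, hb⟩ := hb
    obtain ⟨j, hj, hji, h⟩ := h (d + f) (by rw [map_mul, hd, hf, mon_add])
    rcases lt_or_ge 0 (d j) with h' | h'
    · exact ha ⟨j, hj, hji, h'⟩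
    · exact hb ⟨j, hj, hji, by rw [Pi.add_apply] at h; lia⟩

theorem notMem_primeAt {I : ProjPoint n} {a : ChartMonoid i} :
    a ∉ (primeAt i I).carrier ↔
      ∃ e, val i a = mon e ∧ ∀ j ∉ I.1, j ≠ i → e j ≤ 0 := by
  change ¬ (∀ e, _) ↔ _
  push Not
  rfl

/-- The point of projective space given by a prime ideal. -/
def toPoint (p : PrimeSpec (ChartMonoid i)) : ProjPoint n :=
  ⟨{j | ratio i j ∉ p.carrier}, i, by
    change ratio i i ∉ p.carrier
    rw [ratio_self]
    exact p.one_notMem⟩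

theorem mem_toPoint_self (p : PrimeSpec (ChartMonoid i)) : i ∈ (toPoint p).1 := by
  change ratio i i ∉ p.carrier
  rw [ratio_self]
  exact p.one_notMem

theorem toPoint_primeAt {I : ProjPoint n} (hI : i ∈ I.1) : toPoint (primeAt i I) = I := by
  refine Subtype.ext (Set.ext fun j => ?_)
  change ratio i j ∉ (primeAt i I).carrier ↔ _
  rw [notMem_primeAt]
  constructor
  · rintro ⟨e, he, h⟩
    obtain rfl := mon_inj (show mon _ = mon e from he)
    by_contra hj
    have hji : j ≠ i := fun h => hj (h ▸ hI)
    have := h j hj hji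
    simp [hji] at this
  · intro hj
    refine ⟨_, rfl, fun l hl hli => ?_⟩
    have hlj : l ≠ j := fun h => hl (h ▸ hj)
    simp [hli, hlj]

/-- Splitting off `x_j / x_i` lowers `-e i` by one, so every monomial of the chart is a product of
such ratios. -/
theorem exists_eq_mul_ratio {a : ChartMonoid i} {e : Fin (n + 1) → ℤ} (he : val i a = mon e)
    {j : Fin (n + 1)} (hji : j ≠ i) (hj : 0 < e j) :
    ∃ b : ChartMonoid i, val i b = mon (e - Pi.single j 1 + Pi.single i 1) ∧
      a = b * ratio i j := by
  refine ⟨ofMon (e - Pi.single j 1 + Pi.single i 1) ?_ fun l hl => ?_, rfl, val_injective ?_⟩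
  · simp [Finset.sum_add_distrib, sum_eq_zero he]
  · by_cases h : l = j
    · subst h
      simp [hl]
      lia
    · simpa [Pi.single_apply, hl, h] using nonneg he hl
  · rw [map_mul, he]
    change _ = mon _ * mon _
    rw [← mon_add]
    congr 1
    abel

/-- Induction on `N = -e i`, the number of ratios in the product `a`: a prime containing a product
contains a factor. For `N = 0` the element is `1`, which lies in no prime. -/
theorem exists_ratio_mem {p : PrimeSpec (ChartMonoid i)} (N : ℕ) :
    ∀ (a : ChartMonoid i) (e : Fin (n + 1) → ℤ), val i a = mon e → -e i = N → a ∈ p.carrier →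
      ∃ j, ratio i j ∈ p.carrier ∧ j ≠ i ∧ 0 < e j := by
  induction N with
  | zero =>
    intro a e he hN ha
    have h0 := sum_eq_zero he
    have hi : e i = 0 := by simpa using hN
    rw [← Finset.add_sum_erase _ _ (Finset.mem_univ i), hi, zero_add,
      Finset.sum_eq_zero_iff_of_nonneg fun l hl => nonneg he (Finset.ne_of_mem_erase hl)] at h0
    have : e = 0 := by
      funext l
      by_cases hl : l = i
      · rw [hl, hi]; rfl
      · exact h0 l (Finset.mem_erase.2 ⟨hl, Finset.mem_univ _⟩)
    subst this
    have : a = 1 := val_injective he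
    exact absurd (this ▸ ha) p.one_notMem
  | succ N ih =>
    intro a e he hN ha
    have h0 := sum_eq_zero he
    rw [← Finset.add_sum_erase _ _ (Finset.mem_univ i)] at h0
    obtain ⟨j, hj, hj'⟩ : ∃ j ∈ Finset.univ.erase i, 0 < e j := by
      by_contra! h
      have := Finset.sum_nonpos h
      push_cast at hN
      lia
    have hji := Finset.ne_of_mem_erase hj
    obtain ⟨b, hb, rfl⟩ := exists_eq_mul_ratio he hji hj'
    rcases p.mem_or_mem ha with hbp | hr
    · obtain ⟨l, hl, hli, hl'⟩ := ih b _ hb (by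
        simp [hji.symm]
        push_cast at hN
        lia) hbp
      refine ⟨l, hl, hli, ?_⟩
      by_cases hlj : l = j
      · exact hlj ▸ hj'
      · simpa [Pi.single_apply, hli, hlj] using hl'
    · exact ⟨j, hr, hji, hj'⟩

/-- Elements are zero or products of ratios, so a prime is determined by the ratios it contains. -/
theorem primeAt_toPoint (p : PrimeSpec (ChartMonoid i)) : primeAt i (toPoint p) = p := by
  refine PrimeSpec.ext (Set.ext fun a => ⟨fun h => ?_, fun h e he => ?_⟩)
  · rcases eq_zero_or_mon a with rfl | ⟨e, he⟩
    · exact p.zero_mem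
    · obtain ⟨j, hj, hji, hj'⟩ := h e he
      obtain ⟨b, -, rfl⟩ := exists_eq_mul_ratio he hji hj'
      exact p.mul_mem b (not_not.1 hj)
  · have hN : -e i = ((-e i).toNat : ℤ) := by
      have h0 := sum_eq_zero he
      rw [← Finset.add_sum_erase _ _ (Finset.mem_univ i)] at h0
      have := Finset.sum_nonneg fun l (hl : l ∈ Finset.univ.erase i) =>
        nonneg he (Finset.ne_of_mem_erase hl)
      lia
    obtain ⟨j, hj, hji, hj'⟩ := exists_ratio_mem _ a e he hN h
    exact ⟨j, not_not.2 hj, hji, hj'⟩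

theorem primeAt_subset {I J : ProjPoint n} (h : I.1 ⊆ J.1) :
    (primeAt i J).carrier ⊆ (primeAt i I).carrier := fun a ha e he => by
  obtain ⟨j, hj, hji, hj'⟩ := ha e he
  exact ⟨j, fun hI => hj (h hI), hji, hj'⟩

theorem mem_image_toPoint {V : Set (PrimeSpec (ChartMonoid i))} {I : ProjPoint n} :
    I ∈ toPoint '' V ↔ i ∈ I.1 ∧ primeAt i I ∈ V := by
  constructor
  · rintro ⟨p, hp, rfl⟩
    exact ⟨mem_toPoint_self p, (primeAt_toPoint p).symm ▸ hp⟩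
  · rintro ⟨hI, hV⟩
    exact ⟨_, hV, toPoint_primeAt hI⟩

theorem isOpenEmbedding_toPoint :
    Topology.IsOpenEmbedding (toPoint : PrimeSpec (ChartMonoid i) → ProjPoint n) := by
  refine .of_continuous_injective_isOpenMap (continuous_generateFrom_iff.2 ?_)
    (fun p q h => by rw [← primeAt_toPoint p, h, primeAt_toPoint]) fun V hV => ?_
  · rintro _ ⟨j, rfl⟩
    exact isOpen_generateFrom_of_mem ⟨ratio i j, rfl⟩
  · refine ProjPoint.isOpen_of_forall_subset fun I hI J hIJ => ?_
    obtain ⟨hI, hIV⟩ := mem_image_toPoint.1 hI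
    exact mem_image_toPoint.2 ⟨hIJ hI,
      PrimeSpec.mem_of_subset (primeAt_subset hIJ) (V := ⟨V, hV⟩) hIV⟩

/-! #### Fractions -/

/-- The Laurent monomial that is the value of a fraction. -/
noncomputable def fracVal (p : PrimeSpec (ChartMonoid i)) :
    Localization p.compl →* LaurentMonomials n :=
  (Localization.monoidOf p.compl).lift (g := val i) fun y => by
    refine IsUnit.mk0 _ fun h => y.2 ?_
    have : y.1 = 0 := val_injective h
    rw [this]
    exact p.zero_mem

theorem fracVal_mul (p : PrimeSpec (ChartMonoid i)) (a : ChartMonoid i) (s : p.compl) :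
    val i s.1 * fracVal p (OreLocalization.oreDiv a s : Localization p.compl) = val i a := by
  have : (OreLocalization.oreDiv a s : Localization p.compl) =
      (Localization.monoidOf p.compl).mk' a s := Localization.mk_eq_monoidOf_mk'_apply a s
  rw [this]
  exact ((Submonoid.LocalizationMap.lift_mk'_spec _ _ _ _ _).1 rfl).symm

theorem val_ne_zero {p : PrimeSpec (ChartMonoid i)} {f : ChartMonoid i} (hf : f ∉ p.carrier) :
    val i f ≠ 0 := fun h => hf (by
  have : f = 0 := val_injective h
  exact this ▸ p.zero_mem)

theorem fracVal_injective (p : PrimeSpec (ChartMonoid i)) : Function.Injective (fracVal p) := by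
  intro x y h
  induction x using OreLocalization.ind with | _ a s =>
  induction y using OreLocalization.ind with | _ b t =>
  refine oreDiv_eq_oreDiv_iff.2 ⟨1, one_mem _, ?_⟩
  have h1 := fracVal_mul p a s
  have h2 := fracVal_mul p b t
  rw [one_smul, one_smul]
  refine val_injective ((map_mul _ _ _).trans (Eq.trans ?_ (map_mul _ _ _).symm))
  rw [← h1, ← h2, h]
  exact mul_left_comm _ _ _

/-- A denominator outside the prime of `I` has no positive exponent outside `I`, so dividing by it
creates no pole at `I`. -/
theorem isRegularAt_of_mul {I : ProjPoint n} (hI : i ∈ I.1) {b f : ChartMonoid i}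
    (hf : f ∉ (primeAt i I).carrier) {a : LaurentMonomials n} (h : val i f * a = val i b) :
    IsRegularAt 0 I a := by
  obtain ⟨d, hd, hd'⟩ := notMem_primeAt.1 hf
  rcases MonoidGeometry.eq_zero_or_mon a with rfl | ⟨e, rfl⟩
  · exact isRegularAt_zero _ _
  rw [hd, ← mon_add] at h
  have h0 := sum_eq_zero h.symm
  simp only [Pi.add_apply, Finset.sum_add_distrib, sum_eq_zero hd, zero_add] at h0
  refine isRegularAt_mon.2 ⟨h0, fun l hl => ?_⟩
  have hli : l ≠ i := fun h => hl (h ▸ hI)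
  have h1 := nonneg h.symm hli
  have h2 := hd' l hl hli
  rw [Pi.add_apply] at h1
  lia

theorem exists_mul_eq {I : ProjPoint n} {a : LaurentMonomials n} (h : IsRegularAt 0 I a) :
    ∃ b f : ChartMonoid i, f ∉ (primeAt i I).carrier ∧ val i f * a = val i b := by
  classical
  rcases MonoidGeometry.eq_zero_or_mon a with rfl | ⟨e, rfl⟩
  · exact ⟨0, 1, (primeAt i I).one_notMem, mul_zero _⟩
  obtain ⟨h0, h⟩ := isRegularAt_mon.1 h
  -- Negative exponents of `e` occur only in `I`, and adding `|e l|` there removes them. The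
  -- exponent at `i` is then adjusted to make the denominator `x^d` of degree zero.
  let c : Fin (n + 1) → ℤ := fun l => if l ∈ I.1 then |e l| else 0
  have hc : ∀ l, 0 ≤ c l := fun l => by
    by_cases hl : l ∈ I.1 <;> simp [c, hl]
  let d : Fin (n + 1) → ℤ := c - Pi.single i (∑ l, c l)
  have hd : ∀ l, l ≠ i → d l = c l := fun l hl => by simp [d, hl]
  have hd0 : ∑ l, d l = 0 := by simp [d]
  refine ⟨ofMon (d + e) (by simp [Finset.sum_add_distrib, hd0, h0]) fun l hl => ?_,
    ofMon d hd0 fun l hl => (hd l hl).symm ▸ hc l, ?_, rfl⟩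
  · rw [Pi.add_apply, hd l hl]
    by_cases hI : l ∈ I.1
    · simp only [c, hI, if_true]
      linarith [neg_abs_le (e l)]
    · simpa [c, hI] using h l hI
  · refine notMem_primeAt.2 ⟨d, rfl, fun j hj hji => ?_⟩
    rw [hd j hji]
    simp [c, hj]

end ChartMonoid

end Chart

end

/-! ### Projective space as an integral scheme; the twisted sheaves -/

section

/-! ### Projective space as a scheme -/

namespace ChartMonoid

variable {n : ℕ} {i : Fin (n + 1)}

/-- The image of an open subset of the spectrum of the coordinate monoid. -/
def imageOpens (V : Opens (PrimeSpec (ChartMonoid i))) : Opens (ProjPoint n) :=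
  ⟨toPoint (i := i) '' V, isOpenEmbedding_toPoint.isOpenMap _ V.2⟩

theorem primeAt_mem {V : Opens (PrimeSpec (ChartMonoid i))} (y : imageOpens V) :
    primeAt i y.1 ∈ V := (mem_image_toPoint.1 y.2).2

theorem mem_of_mem_imageOpens {V : Opens (PrimeSpec (ChartMonoid i))} {I : ProjPoint n}
    (h : I ∈ imageOpens V) : i ∈ I.1 := (mem_image_toPoint.1 h).1

/-- The values of a section of the structure sheaf of the spectrum. -/
noncomputable def toSection (V : Opens (PrimeSpec (ChartMonoid i))) :
    (tildeSheaf (ChartMonoid i) (ChartMonoid i)).obj V →* (twistSheaf n 0).obj (imageOpens V) where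
  toFun s := ⟨fun y => fracVal (primeAt i y.1) (s.1 ⟨primeAt i y.1, primeAt_mem y⟩), fun y => by
    obtain ⟨W, hp, hW, a, f, h⟩ := s.2 ⟨primeAt i y.1, primeAt_mem y⟩
    have hy : y.1 ∈ imageOpens W := mem_image_toPoint.2 ⟨mem_of_mem_imageOpens y.2, hp⟩
    have key : ∀ z : imageOpens W, val i f * fracVal (primeAt i z.1) (s.1 ⟨primeAt i z.1,
        hW (primeAt_mem z)⟩) = val i a := fun z => by
      obtain ⟨hf, e⟩ := h ⟨primeAt i z.1, primeAt_mem z⟩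
      dsimp only at e
      rw [e]
      exact fracVal_mul _ a ⟨f, hf⟩
    -- Where a section is the fraction `a / f`, its values are the single Laurent monomial or zero
    -- `val i a / val i f`.
    refine ⟨imageOpens W, hy, Set.image_mono hW, val i a / val i f, fun z => ?_⟩
    have hf := (h ⟨primeAt i z.1, primeAt_mem z⟩).1
    have hz := eq_div_of_mul_eq (val_ne_zero hf) ((mul_comm _ _).trans (key z))
    exact ⟨hz, hz ▸ isRegularAt_of_mul (mem_of_mem_imageOpens z.2) hf (key z)⟩⟩
  map_one' := Subtype.ext (funext fun y => map_one _)
  map_mul' s t := Subtype.ext (funext fun y => map_mul (fracVal (primeAt i y.1)) _ _)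

/-- Fractions embed into Laurent monomials with zero, which gives injectivity pointwise. Conversely,
each value of a section is a fraction by `exists_mul_eq`, and local constancy of the values makes
one fraction valid nearby. -/
theorem toSection_bijective (V : Opens (PrimeSpec (ChartMonoid i))) :
    Function.Bijective (toSection V) := by
  constructor
  · intro s t h
    refine Subtype.ext (funext fun p => ?_)
    have hp : toPoint p.1 ∈ imageOpens V := ⟨p.1, p.2, rfl⟩
    have h1 := fracVal_injective _ (congrFun (congrArg Subtype.val h) ⟨toPoint p.1, hp⟩)
    -- The prime `primeAt i (toPoint p)` is only propositionally equal to `p`, so the equality of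
    -- values has to be transported.
    have h2 : ∀ q : PrimeSpec (ChartMonoid i), q = p.1 → ∀ hq : q ∈ V,
        s.1 ⟨q, hq⟩ = t.1 ⟨q, hq⟩ → s.1 p = t.1 p := by
      rintro _ rfl _ h
      exact h
    exact h2 _ (primeAt_toPoint p.1) _ h1
  · intro t
    have hex : ∀ p : V, ∃ b f : ChartMonoid i, f ∉ p.1.carrier ∧
        val i f * t.1 ⟨toPoint p.1, p.1, p.2, rfl⟩ = val i b := fun p => by
      obtain ⟨W, hp, hW, a, h⟩ := t.2 ⟨toPoint p.1, p.1, p.2, rfl⟩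
      obtain ⟨e, h⟩ := h ⟨toPoint p.1, hp⟩
      obtain ⟨b, f, hf, hb⟩ := exists_mul_eq (i := i) h
      rw [primeAt_toPoint] at hf
      exact ⟨b, f, hf, by rw [← hb, ← e]⟩
    choose b f hf hb using hex
    have hval : ∀ p : V, fracVal p.1 (OreLocalization.oreDiv (b p) (⟨f p, hf p⟩ : p.1.compl)) =
        t.1 ⟨toPoint p.1, p.1, p.2, rfl⟩ := fun p =>
      mul_left_cancel₀ (val_ne_zero (hf p)) ((fracVal_mul p.1 _ ⟨f p, hf p⟩).trans (hb p).symm)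
    refine ⟨⟨fun p => OreLocalization.oreDiv (b p) ⟨f p, hf p⟩, fun p => ?_⟩,
      Subtype.ext (funext fun y => ?_)⟩
    · obtain ⟨W, hp, hW, a, h⟩ := t.2 ⟨toPoint p.1, p.1, p.2, rfl⟩
      have hW' : ∀ q : V, toPoint q.1 ∈ W → t.1 ⟨toPoint q.1, q.1, q.2, rfl⟩ = a :=
        fun q hq => (h ⟨toPoint q.1, hq⟩).1
      let W' : Opens (PrimeSpec (ChartMonoid i)) :=
        ⟨toPoint ⁻¹' W, W.2.preimage isOpenEmbedding_toPoint.continuous⟩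
      -- On this neighbourhood `t` keeps its value at `p` and `f p` remains a valid denominator.
      refine ⟨V ⊓ (W' ⊓ PrimeSpec.basicOpen (f p)), ⟨p.2, hp, hf p⟩, inf_le_left, b p, f p,
        fun q => ⟨q.2.2.2, fracVal_injective _ ?_⟩⟩
      have h1 := hval ⟨q.1, q.2.1⟩
      rw [hW' ⟨q.1, q.2.1⟩ q.2.2.1] at h1
      refine h1.trans (mul_left_cancel₀ (val_ne_zero q.2.2.2) ?_)
      refine Eq.trans ?_ (fracVal_mul q.1 (b p) ⟨f p, q.2.2.2⟩).symm
      rw [← hb p, hW' p hp]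
    · have hp := hval ⟨primeAt i y.1, primeAt_mem y⟩
      refine hp.trans ?_
      have h2 : ∀ I : ProjPoint n, I = y.1 → ∀ hI : I ∈ imageOpens V, t.1 ⟨I, hI⟩ = t.1 y := by
        rintro _ rfl _
        rfl
      exact h2 _ (toPoint_primeAt (mem_of_mem_imageOpens y.2)) _

/-- The sections of the structure sheaves agree on the affine chart. -/
noncomputable def sectionEquiv (V : Opens (PrimeSpec (ChartMonoid i))) :
    (tildeSheaf (ChartMonoid i) (ChartMonoid i)).obj V ≃* (twistSheaf n 0).obj (imageOpens V) :=
  MulEquiv.ofBijective (toSection V) (toSection_bijective V)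

variable (i) in
/-- The affine chart on which the coordinate `i` does not vanish. -/
noncomputable def chart : AffineChart (ChartMonoid i) (ProjSpace n) where
  toFun := toPoint
  isOpenEmbedding := isOpenEmbedding_toPoint
  sec V := sectionEquiv V
  sec_res _ _ := rfl

theorem mem_range_chart {I : ProjPoint n} (h : i ∈ I.1) : I ∈ (chart i).range :=
  ⟨primeAt i I, Set.mem_univ _, toPoint_primeAt h⟩

end ChartMonoid

/-- Projective space as a connected integral scheme. -/
def projScheme (n : ℕ) : IntegralScheme.{0} where
  toMonoidalSpace := ProjSpace n
  isM0Scheme x := ⟨_, _, ChartMonoid.chart x.2.choose,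
    ChartMonoid.mem_range_chart x.2.choose_spec⟩
  isIntegral x := ⟨_, _, ChartMonoid.chart x.2.choose, inferInstance,
    ChartMonoid.mem_range_chart x.2.choose_spec⟩
  connected := inferInstanceAs (ConnectedSpace (ProjPoint n))

theorem isGeneric_projSpace (n : ℕ) : IsGeneric (ProjSpace n) (ProjPoint.generic n) :=
  isGeneric_of_isIntegral (projScheme n).isIntegral fun _ V hx => ProjPoint.generic_mem V.2 hx

/-! ### The twisted sheaves -/

section Twist

variable {n : ℕ}

/-- The open subset on which the coordinate `i` does not vanish. -/
def coordOpen (i : Fin (n + 1)) : Opens (ProjSpace n).carrier :=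
  ⟨{I : ProjPoint n | i ∈ I.1}, isOpen_generateFrom_of_mem ⟨i, rfl⟩⟩

/-- The section given by a Laurent monomial. -/
def monSection {k : ℤ} {V : Opens (ProjPoint n)} (e : Fin (n + 1) → ℤ)
    (h : ∀ I ∈ V, IsRegularAt k I (mon e)) : (twistSheaf n k).obj V :=
  ⟨fun _ => mon e, fun I => ⟨V, I.2, le_rfl, mon e, fun J => ⟨rfl, h J.1 J.2⟩⟩⟩

/-- The generator `x_i^k` of `𝒪(k)` on the open subset where `x_i` does not vanish. -/
def twistGen (k : ℤ) (i : Fin (n + 1)) : (twist n k).obj (coordOpen i) :=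
  monSection (Pi.single i k) fun I hI => isRegularAt_mon.2 ⟨by simp, fun l hl => by
    have : l ≠ i := fun h => hl (h ▸ hI)
    simp [this]⟩

/-- Where `x_i` does not vanish, multiplication by `x_i^k` is inverted by `x_i^(-k)`, without
introducing poles. -/
theorem isBasisOn_twistGen (k : ℤ) (i : Fin (n + 1)) :
    IsBasisOn (twist n k).toPreModule (coordOpen i) (fun _ : Unit => twistGen k i) := by
  refine isBasisOn_unit (fun V h (m : (twistSheaf n k).obj V) => ?_)
    (fun V h (a b : (twistSheaf n 0).obj V) hab => ?_)
  · refine ⟨(⟨fun I => m.1 I * mon (Pi.single i (-k)), fun I => ?_⟩ : (twistSheaf n 0).obj V),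
      Subtype.ext (funext fun I => ?_)⟩
    · obtain ⟨W, hx, hW, a, ha⟩ := m.2 I
      refine ⟨W, hx, hW, a * mon (Pi.single i (-k)), fun J => ?_⟩
      obtain ⟨e, hr⟩ := ha J
      dsimp only at e ⊢
      refine ⟨by rw [e], ?_⟩
      have hJ : i ∈ J.1.1 := h (hW J.2)
      have := hr.mul (l := -k) (isRegularAt_mon.2 ⟨by simp, fun l hl => by
        have : l ≠ i := fun h => hl (h ▸ hJ)
        simp [this]⟩ : IsRegularAt (-k) J.1 (mon (Pi.single i (-k))))
      rwa [add_neg_cancel] at this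
    · change m.1 I = m.1 I * mon (Pi.single i (-k)) * mon (Pi.single i k)
      rw [mul_assoc, ← mon_add, ← Pi.single_add, neg_add_cancel, Pi.single_zero, mon_zero, mul_one]
  · exact Subtype.ext (funext fun I => mul_right_cancel₀ (mon_ne_zero (Pi.single i k))
      (congrFun (congrArg Subtype.val hab) I))

theorem isLineBundle_twist (n : ℕ) (k : ℤ) : (twist n k).IsLineBundle :=
  OModule.isLineBundle_of_isBasisOn (projScheme n).isIntegral fun x =>
    ⟨coordOpen x.2.choose, x.2.choose_spec, _, isBasisOn_twistGen k _⟩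

/-- The transition function `(x_i / x_j)^k`. -/
def transition (k : ℤ) (i j : Fin (n + 1)) :
    (ProjSpace n).sheaf.obj (coordOpen i ⊓ coordOpen j) :=
  monSection (Pi.single i k - Pi.single j k) fun I hI => isRegularAt_mon.2 ⟨by simp, fun l hl => by
    have hi : l ≠ i := fun h => hl (h ▸ hI.1)
    have hj : l ≠ j := fun h => hl (h ▸ hI.2)
    simp [hi, hj]⟩

theorem res_twistGen (k : ℤ) (i j : Fin (n + 1)) :
    (twist n k).res (inf_le_left : coordOpen i ⊓ coordOpen j ≤ _) (twistGen k i) =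
      transition k i j • (twist n k).res inf_le_right (twistGen k j) :=
  Subtype.ext (funext fun I => by
    change mon (Pi.single i k) = mon (Pi.single i k - Pi.single j k) * mon (Pi.single j k)
    rw [← mon_add, sub_add_cancel])

theorem transition_mul (k l : ℤ) (i j : Fin (n + 1)) :
    transition k i j * transition l i j = transition (k + l) i j :=
  Subtype.ext (funext fun I => by
    change mon (Pi.single i k - Pi.single j k) * mon (Pi.single i l - Pi.single j l) =
      mon (Pi.single i (k + l) - Pi.single j (k + l))
    rw [← mon_add, Pi.single_add, Pi.single_add, add_sub_add_comm])

theorem nonempty_twist_tensor_iso (n : ℕ) (k l : ℤ) :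
    Nonempty ((twist n k).tensor (twist n l) ≅ twist n (k + l)) := by
  refine OModule.nonempty_iso_of_gen (U := fun x => coordOpen x.2.choose)
    (fun x => x.2.choose_spec)
    (fun x => (isBasisOn_twistGen k x.2.choose).tensor_unit (isGeneric_projSpace n)
      (isBasisOn_twistGen l x.2.choose))
    (fun x => isBasisOn_twistGen (k + l) x.2.choose) fun x y =>
      ⟨transition (k + l) x.2.choose y.2.choose, ?_, res_twistGen _ _ _⟩
  rw [OModule.res_tmul, OModule.res_tmul, res_twistGen, res_twistGen, OModule.smul_tmul_smul,
    transition_mul]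

end Twist

end

/-! ### Classification of the line bundles on projective space -/

section

/-! ### Line bundles on projective space -/

section ProjPic

variable {n : ℕ}

/-- Sections are locally constant and all nonempty open sets contain the generic point, so a section
is a single element, its generic value, regular at all points of `V`. -/
theorem twistSheaf_apply {k : ℤ} {V : Opens (ProjPoint n)} (s : (twistSheaf n k).obj V)
    {I : ProjPoint n} (hI : I ∈ V) (hg : ProjPoint.generic n ∈ V) :
    s.1 ⟨I, hI⟩ = s.1 ⟨ProjPoint.generic n, hg⟩ ∧
      IsRegularAt k I (s.1 ⟨ProjPoint.generic n, hg⟩) := by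
  obtain ⟨W, hW, hWV, a, ha⟩ := s.2 ⟨I, hI⟩
  have h1 := ha ⟨I, hW⟩
  have h2 := ha ⟨_, ProjPoint.generic_mem W.2 hW⟩
  dsimp only at h1 h2
  exact ⟨h1.1.trans h2.1.symm, h2.1.symm ▸ h1.2⟩

theorem generic_mem_coordOpen (i : Fin (n + 1)) : ProjPoint.generic n ∈ coordOpen i :=
  Set.mem_univ i

theorem coordOpen_le {i : Fin (n + 1)} {V : Opens (ProjSpace n).carrier}
    (h : ProjPoint.closed i ∈ V) : coordOpen i ≤ V := fun _ hI =>
  ProjPoint.mem_of_subset V.2 h (Set.singleton_subset_iff.2 hI)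

/-- The monomial that is the value of a function at the generic point. -/
def genVal {V : Opens (ProjSpace n).carrier} (hV : ProjPoint.generic n ∈ V)
    (s : (ProjSpace n).sheaf.obj V) : LaurentMonomials n :=
  (show (twistSheaf n 0).obj V from s).1 ⟨ProjPoint.generic n, hV⟩

theorem genVal_mul {V : Opens (ProjSpace n).carrier} (hV : ProjPoint.generic n ∈ V)
    (s t : (ProjSpace n).sheaf.obj V) : genVal hV (s * t) = genVal hV s * genVal hV t := rfl

theorem genVal_one {V : Opens (ProjSpace n).carrier} (hV : ProjPoint.generic n ∈ V) :
    genVal hV (1 : (ProjSpace n).sheaf.obj V) = 1 := rfl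

theorem isRegularAt_genVal {V : Opens (ProjSpace n).carrier} (hV : ProjPoint.generic n ∈ V)
    (s : (ProjSpace n).sheaf.obj V) {I : ProjPoint n} (hI : I ∈ V) :
    IsRegularAt 0 I (genVal hV s) := (twistSheaf_apply s hI hV).2

theorem genVal_injective {V : Opens (ProjSpace n).carrier} (hV : ProjPoint.generic n ∈ V) :
    Function.Injective (genVal hV) := fun s t h =>
  Subtype.ext (funext fun I => (twistSheaf_apply s I.2 hV).1.trans
    (h.trans (twistSheaf_apply t I.2 hV).1.symm))

theorem exists_mon_of_mul_eq_one {a b : LaurentMonomials n} (h : a * b = 1) :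
    ∃ e, a = mon e ∧ b = mon (-e) := by
  rcases eq_zero_or_mon a with rfl | ⟨e, rfl⟩
  · rw [zero_mul] at h
    exact absurd h zero_ne_one
  refine ⟨e, rfl, mul_left_cancel₀ (mon_ne_zero e) (h.trans ?_)⟩
  rw [← mon_add, add_neg_cancel, mon_zero]

/-- Two generators of a line bundle on the open subset where `x_i` does not vanish are equal. -/
theorem gen_unique {L : OModule (ProjSpace n)} {i : Fin (n + 1)} {e e' : L.obj (coordOpen i)}
    (he : IsBasisOn L.toPreModule (coordOpen i) (fun _ : Unit => e))
    (he' : IsBasisOn L.toPreModule (coordOpen i) (fun _ : Unit => e')) : e = e' := by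
  obtain ⟨u, hu⟩ := he'.exists_smul_of_unit le_rfl e
  obtain ⟨v, hv⟩ := he.exists_smul_of_unit le_rfl e'
  rw [L.res_id] at hu hv
  have huv : u * v = 1 := he.self.smul_inj (i := ()) (by
    rw [mul_smul, ← hv, ← hu, one_smul])
  have hg := generic_mem_coordOpen (n := n) i
  have hi : ProjPoint.closed i ∈ coordOpen i := Set.mem_singleton i
  obtain ⟨d, hd, hd'⟩ := exists_mon_of_mul_eq_one
    (((genVal_mul hg u v).symm.trans (congrArg (genVal hg) huv)).trans (genVal_one hg))
  have h1 := isRegularAt_genVal hg u hi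
  have h2 := isRegularAt_genVal hg v hi
  rw [hd, isRegularAt_mon] at h1
  rw [hd', isRegularAt_mon] at h2
  -- Both `x^d` and its inverse are regular at the closed point `{i}`, so the exponents other than
  -- `d i` vanish; degree zero then forces `d i = 0`.
  have h3 : ∀ l, l ≠ i → d l = 0 := fun l hl =>
    le_antisymm (neg_nonneg.1 (h2.2 l hl)) (h1.2 l hl)
  have h4 : d = 0 := funext fun l => by
    by_cases hl : l = i
    · rw [hl]
      exact (Fintype.sum_eq_single i h3).symm.trans h1.1
    · exact h3 l hl
  have hu1 : u = 1 := genVal_injective hg (hd.trans (by rw [h4]; rfl))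
  rw [hu, hu1, one_smul]

theorem zero_ne_one_fin (hn : 1 ≤ n) : (0 : Fin (n + 1)) ≠ 1 := fun h => by
  have := congrArg Fin.val h
  rw [Fin.val_zero, Fin.val_one', Nat.mod_eq_of_lt (by lia)] at this
  exact zero_ne_one this

/-- An isomorphism matches the unique generators, hence `(x_0 / x_1)^k = (x_0 / x_1)^l`. Two
distinct coordinates are needed here. -/
theorem eq_of_nonempty_twist_iso (hn : 1 ≤ n) {k l : ℤ} (f : twist n k ≅ twist n l) : k = l := by
  have hf : ∀ i, OModule.Hom.app f.hom _ (twistGen k i) = twistGen l i := fun i =>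
    gen_unique (OModule.IsBasisOn.map_iso f (isBasisOn_twistGen k i)) (isBasisOn_twistGen l i)
  have h1 := congrArg (OModule.Hom.app f.hom _) (res_twistGen k (0 : Fin (n + 1)) 1)
  rw [OModule.Hom.map_smul, OModule.Hom.map_res, OModule.Hom.map_res, hf, hf, res_twistGen] at h1
  have h2 := (isBasisOn_twistGen l (1 : Fin (n + 1)) _ inf_le_right).smul_inj (i := ()) h1
  have h3 := mon_inj (congrArg (genVal (V := coordOpen 0 ⊓ coordOpen 1)
    ⟨generic_mem_coordOpen (n := n) 0, generic_mem_coordOpen (n := n) 1⟩) h2)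
  have h4 := congrFun h3 0
  simpa [zero_ne_one_fin hn] using h4.symm

/-- Support in `{i, j}` and sum zero make `d i j` a multiple of the difference of two unit vectors.
The cocycle relation for `i, 1, 0`, evaluated at `0`, shows that the multiple for `d i 0` with `i ≠
0` is always that of `d 1 0`, and `d i j` is the difference of `d i 0` and `d j 0`. -/
theorem exists_eq_single_sub_single (hn : 1 ≤ n)
    (d : Fin (n + 1) → Fin (n + 1) → Fin (n + 1) → ℤ)
    (hc : ∀ i j k, d i j + d j k = d i k) (hs : ∀ i j l, l ≠ i → l ≠ j → d i j l = 0)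
    (h0 : ∀ i j, ∑ l, d i j l = 0) :
    ∃ m : ℤ, ∀ i j, d i j = Pi.single i m - Pi.single j m := by
  have h01 := zero_ne_one_fin hn
  have hsum : ∀ i, i ≠ 0 → d i 0 i + d i 0 0 = 0 := fun i hi =>
    (Fintype.sum_eq_add i 0 hi fun l hl => hs i 0 l hl.1 hl.2).symm.trans (h0 i 0)
  have hi0 : ∀ i, d i 0 = Pi.single i (d 1 0 1) - Pi.single 0 (d 1 0 1) := fun i => by
    by_cases hi : i = 0
    · subst hi
      have := hc 0 0 0
      rw [add_eq_left] at this
      rw [this, sub_self]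
    · have h1 := congrFun (hc i 1 0) 0
      rw [Pi.add_apply, hs i 1 0 (Ne.symm hi) h01, zero_add] at h1
      have h2 := hsum i hi
      have h3 := hsum 1 h01.symm
      funext l
      by_cases hli : l = i
      · subst hli
        simp [hi]
        lia
      · by_cases hl0 : l = 0
        · subst hl0
          simp [Ne.symm hi]
          lia
        · simp [hli, hl0, hs i 0 l hli hl0]
  refine ⟨d 1 0 1, fun i j => ?_⟩
  rw [eq_sub_of_add_eq (hc i j 0), hi0 i, hi0 j]
  abel

/-- Every line bundle on projective space is isomorphic to a twisted sheaf. -/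
theorem exists_iso_twist (hn : 1 ≤ n) {L : OModule (ProjSpace n)} (hL : L.IsLineBundle) :
    ∃ m : ℤ, Nonempty (L ≅ twist n m) := by
  choose e he using fun i : Fin (n + 1) =>
    hL.exists_gen (isGeneric_projSpace n) (U := coordOpen i) fun V => coordOpen_le
  choose h hh using fun i j => (he j).exists_smul_of_unit
    (inf_le_right : coordOpen i ⊓ coordOpen j ≤ _) (L.res inf_le_left (e i))
  have hg : ∀ i j, ProjPoint.generic n ∈ coordOpen i ⊓ coordOpen j := fun i j =>
    ⟨generic_mem_coordOpen i, generic_mem_coordOpen j⟩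
  have hres : ∀ i j W (hi : W ≤ coordOpen i) (hj : W ≤ coordOpen j), L.res hi (e i) =
      (ProjSpace n).sheaf.res (le_inf hi hj) (h i j) • L.res hj (e j) := fun i j W hi hj => by
    rw [← L.res_res inf_le_left (le_inf hi hj), hh, L.res_smul, L.res_res]
  have hcoc : ∀ i j k, genVal (hg i j) (h i j) * genVal (hg j k) (h j k) =
      genVal (hg i k) (h i k) := fun i j k => by
    let W := coordOpen i ⊓ (coordOpen j ⊓ coordOpen k)
    have hW : ProjPoint.generic n ∈ W := ⟨generic_mem_coordOpen i, hg j k⟩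
    have hi : W ≤ coordOpen i := inf_le_left
    have hj : W ≤ coordOpen j := inf_le_right.trans inf_le_left
    have hk : W ≤ coordOpen k := inf_le_right.trans inf_le_right
    have h1 := hres i k W hi hk
    rw [hres i j W hi hj, hres j k W hj hk, smul_smul] at h1
    exact congrArg (genVal hW) ((he k W hk).smul_inj (i := ()) h1)
  have hone : ∀ i, genVal (hg i i) (h i i) = 1 := fun i => by
    have h1 := hres i i _ (inf_le_left : coordOpen i ⊓ coordOpen i ≤ _) inf_le_left
    have h2 := (he i _ inf_le_left).smul_inj (i := ()) ((one_smul _ _).trans h1)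
    exact (congrArg (genVal (hg i i)) h2).symm
  have hmon : ∀ i j, ∃ d, genVal (hg i j) (h i j) = mon d ∧ genVal (hg j i) (h j i) = mon (-d) :=
    fun i j => exists_mon_of_mul_eq_one ((hcoc i j i).trans (hone i))
  choose d hd hd' using hmon
  obtain ⟨m, hm⟩ := exists_eq_single_sub_single hn d
    (fun i j k => by
      have := hcoc i j k
      rw [hd, hd, hd, ← mon_add] at this
      exact mon_inj this)
    -- The transition function and its inverse are both regular at the point `{i, j}`, so no other
    -- coordinate occurs in them.
    (fun i j l hli hlj => by
      let I : ProjPoint n := ⟨{i, j}, Set.insert_nonempty _ _⟩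
      have hI : I ∈ coordOpen i ⊓ coordOpen j :=
        ⟨Set.mem_insert _ _, Set.mem_insert_of_mem _ (Set.mem_singleton j)⟩
      have hl : l ∉ I.1 := by
        rintro (hl | hl)
        · exact hli hl
        · exact hlj hl
      have h1 := isRegularAt_genVal (hg i j) (h i j) hI
      have h2 := isRegularAt_genVal (hg j i) (h j i) ⟨hI.2, hI.1⟩
      rw [hd, isRegularAt_mon] at h1
      rw [hd', isRegularAt_mon] at h2
      exact le_antisymm (neg_nonneg.1 (h2.2 l hl)) (h1.2 l hl))
    (fun i j => by
      have h1 := isRegularAt_genVal (hg i j) (h i j) (hg i j)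
      rw [hd, isRegularAt_mon] at h1
      exact h1.1)
  -- No rescaling of generators is needed: the transition functions are those of `𝒪(m)` exactly.
  have ht : ∀ i j, h i j = transition m i j := fun i j => by
    refine genVal_injective (hg i j) ((hd i j).trans ?_)
    rw [hm]
    rfl
  refine ⟨m, OModule.nonempty_iso_of_gen (U := fun x => coordOpen x.2.choose)
    (fun x => x.2.choose_spec) (fun x => he x.2.choose)
    (fun x => isBasisOn_twistGen m x.2.choose) fun x y =>
      ⟨h x.2.choose y.2.choose, hh _ _, ?_⟩⟩
  rw [ht]
  exact res_twistGen _ _ _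

/-- The map sending `k` to the class of `𝒪(k)` is an isomorphism from the integers to `Pic`, and
Laurent polynomials are the group ring of the integers. -/
theorem exists_laurent_ringEquiv (n : ℕ) (hn : 1 ≤ n) :
    ∃ (R : CommRing (K0 (ProjSpace n))) (Ψ : LaurentPolynomial ℤ ≃+* K0 (ProjSpace n)),
      IsTensorRing R ∧
      ∀ k : ℤ, ∃ hB : (twist n k).IsBundle,
        Ψ (LaurentPolynomial.T k) = K0.mk (twist n k) hB := by
  have hη := isGeneric_projSpace n
  have hX := (projScheme n).isIntegral
  obtain ⟨G, hG⟩ := exists_isTensorGroup hη hX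
  obtain ⟨R, Θ, hR, hΘ, -⟩ := exists_ringEquiv hη hX G hG
  let f : Multiplicative ℤ →* Pic (ProjSpace n) :=
    MonoidHom.mk' (fun k => Pic.mk _ (isLineBundle_twist n k.toAdd)) fun k l => by
      obtain ⟨_, h⟩ := hG.mul _ _ (isLineBundle_twist n k.toAdd) (isLineBundle_twist n l.toAdd)
      rw [h]
      exact Pic.mk_eq_mk.2 ⟨(nonempty_twist_tensor_iso n _ _).some.symm⟩
  have hf : Function.Bijective f := by
    refine ⟨fun k l h => ?_, Pic.ind fun L hL => ?_⟩
    · obtain ⟨e⟩ := Pic.mk_eq_mk.1 h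
      exact eq_of_nonempty_twist_iso hn e
    · obtain ⟨m, ⟨e⟩⟩ := exists_iso_twist hn hL
      exact ⟨Multiplicative.ofAdd m, Pic.mk_eq_mk.2 ⟨e.symm⟩⟩
  refine ⟨R, ((AddMonoidAlgebra.toMultiplicative ℤ ℤ).trans
    (MonoidAlgebra.mapDomainRingEquiv ℤ (MulEquiv.ofBijective f hf))).trans Θ, hR, fun k => ?_⟩
  obtain ⟨hB, h⟩ := hΘ _ (isLineBundle_twist n k)
  refine ⟨hB, Eq.trans (congrArg Θ ?_) h⟩
  change MonoidAlgebra.mapDomainRingEquiv ℤ (MulEquiv.ofBijective f hf)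
    (AddMonoidAlgebra.toMultiplicative ℤ ℤ (AddMonoidAlgebra.single k 1)) = _
  simp [-LaurentPolynomial.single_eq_C_mul_T, f]

end ProjPic

end

end MonoidGeometry

open MonoidGeometry in
theorem mainTheorem7 :
    -- `K₀(X)` is naturally isomorphic to the group ring of `Pic X`
    (∃ (G : ∀ X : IntegralScheme.{u}, CommGroup (Pic X.toMonoidalSpace))
        (R : ∀ X : IntegralScheme.{u}, CommRing (K0 X.toMonoidalSpace))
        (Θ : ∀ X : IntegralScheme.{u},
          MonoidAlgebra ℤ (Pic X.toMonoidalSpace) ≃+* K0 X.toMonoidalSpace),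
      (∀ X, IsTensorGroup (G X)) ∧ (∀ X, IsTensorRing (R X)) ∧
      -- the isomorphism is the canonical one
      (∀ (X : IntegralScheme.{u}) (L : OModule X.toMonoidalSpace) (hL : L.IsLineBundle),
        ∃ hB : L.IsBundle, Θ X (MonoidAlgebra.of ℤ _ (Pic.mk L hL)) = K0.mk L hB) ∧
      -- it is compatible with inverse images
      (∀ (X Y : IntegralScheme.{u}) (φ : SchemeHom X.toMonoidalSpace Y.toMonoidalSpace),
        ∃ (fP : Pic Y.toMonoidalSpace →* Pic X.toMonoidalSpace)
          (fK : K0 Y.toMonoidalSpace →+* K0 X.toMonoidalSpace),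
          (∀ (L : OModule Y.toMonoidalSpace) (hL : L.IsLineBundle),
            ∃ h, fP (Pic.mk L hL) = Pic.mk (pullback φ L) h) ∧
          (∀ (M : OModule Y.toMonoidalSpace) (hM : M.IsBundle),
            ∃ h, fK (K0.mk M hM) = K0.mk (pullback φ M) h) ∧
          ∀ a, fK (Θ Y a) = Θ X (MonoidAlgebra.mapDomainRingHom ℤ fP a))) ∧
    -- `K₀(X)` is freely generated by the isomorphism classes of line bundles
    (∀ X : IntegralScheme.{u},
      ∃ b : Module.Basis (Pic X.toMonoidalSpace) ℤ (K0 X.toMonoidalSpace),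
        ∀ (L : OModule X.toMonoidalSpace) (hL : L.IsLineBundle),
          ∃ hB : L.IsBundle, b (Pic.mk L hL) = K0.mk L hB) ∧
    -- locally projective sheaves decompose uniquely into line bundles
    (∀ (X : IntegralScheme.{u}) (M : OModule X.toMonoidalSpace), M.IsLocallyProjective →
      (∃ (ι : Type u) (L : ι → OModule X.toMonoidalSpace), (∀ i, (L i).IsLineBundle) ∧
        Nonempty (M ≅ OModule.wedge L) ∧ (M.IsCoherent → Finite ι)) ∧
      ∀ (ι κ : Type u) (L : ι → OModule X.toMonoidalSpace) (L' : κ → OModule X.toMonoidalSpace),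
        (∀ i, (L i).IsLineBundle) → (∀ i, (L' i).IsLineBundle) →
        Nonempty (M ≅ OModule.wedge L) → Nonempty (M ≅ OModule.wedge L') →
        ∃ σ : ι ≃ κ, ∀ i, Nonempty (L i ≅ L' (σ i))) ∧
    -- projective space
    (∀ n : ℕ, 1 ≤ n →
      (∃ X : IntegralScheme.{0}, X.toMonoidalSpace = ProjSpace n) ∧
      (∀ k l : ℤ, Nonempty ((twist n k).tensor (twist n l) ≅ twist n (k + l))) ∧
      (∀ k : ℤ, (twist n k).IsLineBundle) ∧
      ∃ (R : CommRing (K0 (ProjSpace n))) (Ψ : LaurentPolynomial ℤ ≃+* K0 (ProjSpace n)),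
        IsTensorRing R ∧
        ∀ k : ℤ, ∃ hB : (twist n k).IsBundle, Ψ (LaurentPolynomial.T k) = K0.mk (twist n k) hB) := by
  obtain ⟨G, R, Θ, hG, hR, hΘ, hsum⟩ := exists_tensorRing_all.{u}
  refine ⟨⟨G, R, Θ, hG, hR, hΘ, fun X Y φ => ?_⟩, fun X => ?_, fun X M hM => ⟨?_, ?_⟩, fun n hn =>
    ⟨⟨projScheme n, rfl⟩, nonempty_twist_tensor_iso n, isLineBundle_twist n,
      exists_laurent_ringEquiv n hn⟩⟩
  · obtain ⟨η, hη⟩ := exists_isGeneric X.isIntegral X.connected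
    obtain ⟨θ, hθ⟩ := exists_isGeneric Y.isIntegral Y.connected
    obtain ⟨fP, hfP⟩ := exists_pic_hom φ hη X.isIntegral hθ Y.isIntegral _ (hG X) _ (hG Y)
    -- The homomorphism on `K₀` is defined through the group rings, which makes naturality
    -- immediate. That it sends `[M]` to the class of the inverse image follows by decomposing `M`
    -- and pulling the decomposition back.
    refine ⟨fP, ((Θ X).toRingHom.comp (MonoidAlgebra.mapDomainRingHom ℤ fP)).comp
      (Θ Y).symm.toRingHom, hfP, fun M hM => ?_, fun a => ?_⟩
    · obtain ⟨ι, L, h⟩ := hM.1.exists_decompOf hθ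
      have := h.finite hθ hM.2
      have := Fintype.ofFinite ι
      have hφ := h.pullback φ hη
      refine ⟨hφ.isBundle X.isIntegral, ?_⟩
      rw [← hsum Y M hM ι L h, ← hsum X _ (hφ.isBundle X.isIntegral) ι _ hφ]
      change Θ X (MonoidAlgebra.mapDomainRingHom ℤ fP ((Θ Y).symm (Θ Y _))) = _
      rw [(Θ Y).symm_apply_apply, map_sum]
      refine congrArg (Θ X) (Finset.sum_congr rfl fun i _ => ?_)
      obtain ⟨_, h2⟩ := hfP (L i) (h.isLineBundle Y.isIntegral i)
      rw [← h2]
      simp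
    · change Θ X (MonoidAlgebra.mapDomainRingHom ℤ fP ((Θ Y).symm (Θ Y a))) = _
      rw [(Θ Y).symm_apply_apply]
  · obtain ⟨η, hη⟩ := exists_isGeneric X.isIntegral X.connected
    exact K0.exists_basis hη X.isIntegral
  · obtain ⟨η, hη⟩ := exists_isGeneric X.isIntegral X.connected
    obtain ⟨ι, L, h⟩ := hM.exists_decompOf hη
    have hL := h.isLineBundle X.isIntegral
    exact ⟨ι, L, hL, h.nonempty_iso (DecompOf.wedge hη X.isIntegral hL), fun hc => h.finite hη hc⟩
  · rintro ι κ L L' hL hL' ⟨e⟩ ⟨e'⟩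
    obtain ⟨η, hη⟩ := exists_isGeneric X.isIntegral X.connected
    exact ((DecompOf.wedge hη X.isIntegral hL).of_iso e.symm).exists_equiv hη
      ((DecompOf.wedge hη X.isIntegral hL').of_iso e'.symm)
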